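/- Let $\mathbb k$ be a commutative ring with unit; $H^*(-)$ denotes singular cohomology with coefficients in $\mathbb k$. **Notions.** Two polytopes are combinatorially equivalent if their face lattices are isomorphic. A convex $n$-dimensional polytope is simple if each of its vertices lies in exactly $n$ facets. For a simple polytope $P$ with set of facets $F(P)$, the nerve complex $K_P$ is the simplicial complex on the vertex set $F(P)$ whose simplices are the sets of facets with a common point. The moment-angle manifold is $\mathcal Z_P=(S^1)^{F(P)}\times P/\!\sim$, where $(t,p)\sim(s,q)$ iff $p=q$ and $t_F=s_F$ for every facet $F\not\ni p$. The moment-angle complex of a simplicial complex $K$ on a vertex set $V$ is $\mathcal Z_K=\bigcup_{\sigma\in K}\{z\in\mathbb C^V: |z_v|\le 1 \text{ for } v\in\sigma,\ |z_v|=1 \text{ for } v\notin\sigma\}$. A face embedding $i:P\hookrightarrow\partial Q$ is a topological embedding $P\to Q$ whose image is a proper face of $Q$ and which identifies the faces of $P$ with the faces of $Q$ contained in $i(P)$. It induces the map $\hat\phi:\mathcal Z_P\to\mathcal Z_Q$, $[t,p]\mapsto[\hat t,i(p)]$, where $\hat t_H=t_G$ if the facet $H$ of $Q$ satisfies $H\cap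 i(P)=i(G)$ for a facet $G$ of $P$, and $\hat t_H=1$ if there is no such $G$. An isomorphism $j$ of $K$ with a full subcomplex of $L$ induces the map $\hat{\jmath}:\mathcal Z_K\to\mathcal Z_L$ that puts $1$ in all coordinates outside the image of the vertex set of $K$. A sequence $\{P^n\}_{n\ge 0}$ of simple polytopes with $\dim P^n=n$ is a *geometric direct family* if there are 1. face embeddings $i_r^n:P^r\hookrightarrow\partial P^n$ for all $r<n$, with $i_n^m\circ i_r^n=i_r^m$ for $r<n<m$; 2. simplicial embeddings $j_r^n:K_{P^r}\hookrightarrow K_{P^n}$ onto full subcomplexes for all $r<n$, with $j_n^m\circ j_r^n=j_r^m$ for $r<n<m$; 3. homeomorphisms $h_n:\mathcal Z_{P^n}\to\mathcal Z_{K_{P^n}}$ such that for all $r<n$ the homomorphisms induced in cohomology by $\hat\phi_r^n:\mathcal Z_{P^r}\to\mathcal Z_{P^n}$ and by $\hat{\jmath}_r^{\,n}:\mathcal Z_{K_{P^r}}\to\mathcal Z_{K_{P^n}}$ are equivalent through $h_r^*$ and $h_n^*$, i.e. $h_r^*\circ(\hat{\jmath}_r^{\,n})^*=(\hat\phi_r^n)^*\circ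 h_n^*$ in every degree. A connected building set on $[n+1]=\{1,\dots,n+1\}$ is a set $B$ of nonempty subsets of $[n+1]$ that contains all singletons and $[n+1]$, and contains $S\cup T$ whenever $S,T\in B$ and $S\cap T\ne\varnothing$. Its nestohedron is the Minkowski sum $P_B=\sum_{S\in B}\mathrm{conv}(e_i: i\in S)\subset\mathbb R^{n+1}$. For $S\in B$ let $B|_S=\{T\in B: T\subseteq S\}$, a connected building set on $S$, with nestohedron $P_{B|_S}$ defined in the same way. For a graph $\Gamma$ on $[n+1]$, the graphical building set consists of all $S$ such that the induced subgraph $\Gamma_S$ is connected. Permutohedra, stellahedra, cyclohedra and associahedra are the nestohedra of the graphical building sets of, respectively, the complete, star, cycle and path graphs on $[n+1]$, $n\ge 0$ (for $n=0$ and $n=1$ the graph is a single vertex, respectively a single edge). **Proposition.** Let $B(n)$ be a connected building set on $[n+1]$ for each $n\ge 0$. Suppose that for every $n\ge 2$ there is an element $S(n)\in B(n)$ with $|S(n)|=n$ such that $P_{B(n)|_{S(n)}}$ is combinatorially equivalent to $P_{B(n-1)}$. Then $\{P_{B(n)}\mid n\ge 0\}$ is a geometric direct family. Moreover, the following are geometric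 direct families: the cubes (both as $[0,1]^n$ and as the nestohedra of the building sets consisting of the sets $\{i\}$ and $\{1,\dots,i\}$, $1\le i\le n+1$), the permutohedra, the stellahedra, the cyclohedra, and the associahedra. -/

import Mathlib

open CategoryTheory
open scoped Pointwise

noncomputable section

namespace ToricFamilies

/-! ### Polytopes: faces, facets, combinatorial equivalence, nerve complexes -/

section Polytopes

variable {E E' : Type} [AddCommGroup E] [Module ℝ E] [TopologicalSpace E]
  [AddCommGroup E'] [Module ℝ E'] [TopologicalSpace E']

/-- The dimension of (the affine hull of) a nonempty set. -/
def polyDim (P : Set E) : ℕ := Module.finrank ℝ (vectorSpan ℝ P)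

/-- The face lattice of a polytope `P`, ordered by inclusion; the empty face and `P` itself are
faces. -/
def Face (P : Set E) : Type := {F : Set E // IsExposed ℝ P F}

instance (P : Set E) : PartialOrder (Face P) :=
  inferInstanceAs (PartialOrder {F : Set E // IsExposed ℝ P F})

/-- Combinatorial equivalence: the face lattices are isomorphic. -/
def CombEquiv (P : Set E) (Q : Set E') : Prop := Nonempty (Face P ≃o Face Q)

/-- The facets of a polytope: the (nonempty) faces of codimension one. -/
def Facet (P : Set E) : Type :=
  {F : Set E // IsExposed ℝ P F ∧ F.Nonempty ∧ polyDim F + 1 = polyDim P}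

/-- `P` is a simple convex polytope of dimension `n`: it is the convex hull of a nonempty finite
set, its dimension is `n`, and every vertex lies in exactly `n` facets. -/
structure IsSimplePolytope (n : ℕ) (P : Set E) : Prop where
  exists_finset : ∃ s : Finset E, s.Nonempty ∧ P = convexHull ℝ (s : Set E)
  dim_eq : polyDim P = n
  simple : ∀ v ∈ Set.extremePoints ℝ P, {F : Facet P | v ∈ F.1}.ncard = n

/-- The nerve complex `K_P` (equal to `∂P*` for a simple polytope): its vertices are the facets of
`P`, and a set of facets is a simplex when the facets have a common point. As always with
Mathlib's `AbstractSimplicialComplex` the empty simplex is not listed among the faces. -/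
def nerveComplex (P : Set E) : AbstractSimplicialComplex (Facet P) where
  faces := {σ | σ.Nonempty ∧ (⋂ F ∈ σ, F.1).Nonempty}
  isRelLowerSet_faces := by
    intro σ hσ
    refine ⟨hσ.1, fun τ hτ hne => ⟨hne, ?_⟩⟩
    obtain ⟨x, hx⟩ := hσ.2
    refine ⟨x, ?_⟩
    simp only [Set.mem_iInter] at hx ⊢
    exact fun F hF => hx F (hτ hF)
  singleton_mem := by
    intro F
    refine ⟨Finset.singleton_nonempty F, ?_⟩
    simpa using F.2.2.1

end Polytopes

/-! ### Moment-angle complexes -/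

section MomentAngleComplex

variable {V W : Type}

/-- The moment-angle complex `Z_K = ⋃_{σ ∈ K} (D², S¹)^σ`; the union includes the empty simplex. -/
def momentAngleComplex (K : AbstractSimplicialComplex V) : Set (V → ℂ) :=
  {z | ∃ σ : Finset V, (σ = ∅ ∨ σ ∈ K.faces) ∧
    ∀ v, (v ∈ σ → z v ∈ Metric.closedBall (0 : ℂ) 1) ∧ (v ∉ σ → z v ∈ Metric.sphere (0 : ℂ) 1)}

/-- A simplicial embedding `K ↪ L` identifying `K` with the full subcomplex `L_J`, where `J` is the
image of the vertex set of `K`. -/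
structure FullEmbedding (K : AbstractSimplicialComplex V) (L : AbstractSimplicialComplex W) where
  toEmbedding : V ↪ W
  mem_iff : ∀ σ : Finset V, σ ∈ K.faces ↔ σ.map toEmbedding ∈ L.faces

theorem FullEmbedding.extend_mem {K : AbstractSimplicialComplex V}
    {L : AbstractSimplicialComplex W} (j : FullEmbedding K L) {z : V → ℂ}
    (hz : z ∈ momentAngleComplex K) :
    Function.extend j.toEmbedding z (fun _ => 1) ∈ momentAngleComplex L := by
  obtain ⟨σ, hσ, h⟩ := hz
  refine ⟨σ.map j.toEmbedding, ?_, fun w => ?_⟩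
  · rcases hσ with rfl | hσ
    · exact Or.inl (by simp)
    · exact Or.inr ((j.mem_iff σ).1 hσ)
  · by_cases hw : ∃ v, j.toEmbedding v = w
    · obtain ⟨v, rfl⟩ := hw
      rw [j.toEmbedding.injective.extend_apply]
      simpa using h v
    · rw [Function.extend_apply' _ _ _ hw]
      simp

/-- The map `Z_K → Z_L` induced by the embedding of `K` as a full subcomplex of `L`: the
coordinates outside the image of the vertex set are equal to `1`. -/
def FullEmbedding.momentAngleMap {K : AbstractSimplicialComplex V}
    {L : AbstractSimplicialComplex W} (j : FullEmbedding K L) :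
    C(momentAngleComplex K, momentAngleComplex L) where
  toFun z := ⟨Function.extend j.toEmbedding z.1 (fun _ => 1), j.extend_mem z.2⟩
  continuous_toFun := by
    refine Continuous.subtype_mk (continuous_pi fun w => ?_) _
    by_cases hw : ∃ v, j.toEmbedding v = w
    · obtain ⟨v, rfl⟩ := hw
      simp only [j.toEmbedding.injective.extend_apply]
      exact (continuous_apply v).comp continuous_subtype_val
    · simp only [Function.extend_apply' _ _ _ hw]
      exact continuous_const

end MomentAngleComplex

/-! ### Moment-angle manifolds of polytopes and face embeddings -/

section MomentAngleManifold

variable {E E' : Type} [AddCommGroup E] [Module ℝ E] [TopologicalSpace E]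
  [AddCommGroup E'] [Module ℝ E'] [TopologicalSpace E']

/-- The relation `(t, p) ∼ (s, q)` on `T^F × P`: `p = q`, and `t s⁻¹` lies in the coordinate subtorus
spanned by the facets that contain `p`, that is, `t` and `s` agree at all other facets. -/
def momentAngleSetoid (P : Set E) : Setoid ((Facet P → Circle) × P) where
  r x y := x.2 = y.2 ∧ ∀ F : Facet P, (x.2 : E) ∉ F.1 → x.1 F = y.1 F
  iseqv :=
    { refl := fun _ => ⟨rfl, fun _ _ => rfl⟩
      symm := fun h => ⟨h.1.symm, fun F hF => (h.2 F (h.1 ▸ hF)).symm⟩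
      trans := fun h h' =>
        ⟨h.1.trans h'.1, fun F hF => (h.2 F hF).trans (h'.2 F (h.1 ▸ hF))⟩ }

/-- The moment-angle manifold `Z_P = T^F × P / ∼`, with the quotient topology. -/
abbrev MomentAngleManifold (P : Set E) : Type := Quotient (momentAngleSetoid P)

/-- A face embedding `P ↪ ∂Q ⊂ Q`: a topological embedding whose image is a proper face of `Q` and
which identifies the faces of `P` with the faces of that face. -/
structure FaceEmbedding (P : Set E) (Q : Set E') where
  toFun : P → Q
  isEmbedding : Topology.IsEmbedding toFun
  isExposed_iff : ∀ A : Set P,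
    IsExposed ℝ P ((fun p : P => (p : E)) '' A) ↔
      IsExposed ℝ Q ((fun p : P => (toFun p : E')) '' A)
  range_ne : Set.range toFun ≠ Set.univ

namespace FaceEmbedding

variable {P : Set E} {Q : Set E'}

/-- `i.Cuts G H` says that the facet `H` of `Q` cuts the face `i(P)` of `Q` along its facet
`i(G)`. -/
def Cuts (i : FaceEmbedding P Q) (G : Facet P) (H : Facet Q) : Prop :=
  ∀ p : P, (p : E) ∈ G.1 ↔ (i.toFun p : E') ∈ H.1

open Classical in
/-- The homomorphism of tori induced by a face embedding `i`: the coordinate at a facet `H` of `Q` is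
the coordinate at the facet `G` of `P` with `i(G) = i(P) ∩ H`, and it is `1` if there is no such
`G`. (There is at most one.) -/
def torusMap (i : FaceEmbedding P Q) (t : Facet P → Circle) : Facet Q → Circle := fun H =>
  if h : ∃ G : Facet P, i.Cuts G H then t h.choose else 1

/-- The map `φ̂ : Z_P → Z_Q` of moment-angle manifolds induced by a face embedding,
`[t, p] ↦ [torusMap t, i(p)]`. -/
def momentAngleMap (i : FaceEmbedding P Q) : C(MomentAngleManifold P, MomentAngleManifold Q) where
  toFun := Quotient.map (fun x => (i.torusMap x.1, i.toFun x.2)) (by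
    rintro ⟨t, p⟩ ⟨s, q⟩ ⟨hpq, h⟩
    obtain rfl : p = q := hpq
    refine ⟨rfl, fun H hH => ?_⟩
    by_cases hG : ∃ G : Facet P, i.Cuts G H
    · simp only [torusMap, dif_pos hG]
      exact h _ fun hp => hH ((hG.choose_spec p).1 hp)
    · simp only [torusMap, dif_neg hG])
  continuous_toFun := by
    refine Continuous.quotient_map' ?_ _
    refine Continuous.prodMk (continuous_pi fun H => ?_)
      (i.isEmbedding.continuous.comp continuous_snd)
    by_cases hG : ∃ G : Facet P, i.Cuts G H
    · simp only [torusMap, dif_pos hG]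
      fun_prop
    · simp only [torusMap, dif_neg hG]
      exact continuous_const

end FaceEmbedding

end MomentAngleManifold

/-! ### Singular cohomology -/

universe u

/-- Singular cohomology `X ↦ H^k(X; 𝕜)`: the degree `k` cohomology of the cochain complex
`Hom(C_•(X; 𝕜), 𝕜)`, where `C_•(X; 𝕜)` is the singular chain complex with coefficients in `𝕜`. -/
def singularCohomology (𝕜 : Type u) [CommRing 𝕜] (k : ℕ) :
    TopCat.{0}ᵒᵖ ⥤ AddCommGrpCat.{u} :=
  ((AlgebraicTopology.singularChainComplexFunctor (ModuleCat.{u} 𝕜)).obj (ModuleCat.of 𝕜 𝕜)).op ⋙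
    HomologicalComplex.opFunctor _ _ ⋙
    (preadditiveYoneda.obj (ModuleCat.of 𝕜 𝕜)).mapHomologicalComplex _ ⋙
    HomologicalComplex.homologyFunctor _ _ k

/-- The map `f^* : H^k(Y; 𝕜) → H^k(X; 𝕜)` induced by a continuous map `f : X → Y`. -/
def cohomologyMap (𝕜 : Type u) [CommRing 𝕜] (k : ℕ) {X Y : Type} [TopologicalSpace X]
    [TopologicalSpace Y] (f : C(X, Y)) :
    (singularCohomology 𝕜 k).obj (Opposite.op (TopCat.of Y)) ⟶
      (singularCohomology 𝕜 k).obj (Opposite.op (TopCat.of X)) :=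
  (singularCohomology 𝕜 k).map (TopCat.ofHom f).op

/-! ### Geometric direct families -/

/-- A sequence `P⁰, P¹, P², …` of simple polytopes, `dim Pⁿ = n`, is a geometric direct family
(for cohomology with coefficients in `𝕜`) if there are
(1) a direct system of face embeddings `i_r^n : P^r ↪ ∂P^n`, `r < n`;
(2) a direct system of embeddings `j_r^n : K_{P^r} ↪ K_{P^n}`, `r < n`, onto full subcomplexes; and
(3) the homomorphisms `(φ̂_r^n)^*` and `(j_r^n)^*` induced in cohomology by the maps
`Z_{P^r} → Z_{P^n}` and `Z_{K_{P^r}} → Z_{K_{P^n}}` are equivalent, the isomorphisms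
`H^*(Z_{K_{P^n}}) ≅ H^*(Z_{P^n})` being induced by homeomorphisms `h_n : Z_{P^n} ≅ Z_{K_{P^n}}`. -/
def IsGeometricDirectFamily (𝕜 : Type u) [CommRing 𝕜] {E : ℕ → Type}
    [∀ n, AddCommGroup (E n)] [∀ n, Module ℝ (E n)] [∀ n, TopologicalSpace (E n)]
    (P : ∀ n, Set (E n)) : Prop :=
  (∀ n, IsSimplePolytope n (P n)) ∧
  ∃ (i : ∀ r n : ℕ, r < n → FaceEmbedding (P r) (P n))
    (j : ∀ r n : ℕ, r < n → FullEmbedding (nerveComplex (P r)) (nerveComplex (P n)))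
    (h : ∀ n : ℕ, MomentAngleManifold (P n) ≃ₜ momentAngleComplex (nerveComplex (P n))),
    (∀ (q r n : ℕ) (hqr : q < r) (hrn : r < n) (p : P q),
      (i r n hrn).toFun ((i q r hqr).toFun p) = (i q n (hqr.trans hrn)).toFun p) ∧
    (∀ (q r n : ℕ) (hqr : q < r) (hrn : r < n) (F : Facet (P q)),
      (j r n hrn).toEmbedding ((j q r hqr).toEmbedding F) =
        (j q n (hqr.trans hrn)).toEmbedding F) ∧
    (∀ (r n : ℕ) (hrn : r < n) (k : ℕ),
      cohomologyMap 𝕜 k (j r n hrn).momentAngleMap ≫ cohomologyMap 𝕜 k (h r : C(_, _)) =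
        cohomologyMap 𝕜 k (h n : C(_, _)) ≫ cohomologyMap 𝕜 k (i r n hrn).momentAngleMap)

/-! ### Building sets and nestohedra -/

section Nestohedra

variable {α : Type} [Fintype α] [DecidableEq α]

/-- Connected building sets on the finite set `α`. -/
structure IsConnectedBuildingSet (B : Finset (Finset α)) : Prop where
  empty_notMem : ∅ ∉ B
  singleton_mem : ∀ a : α, {a} ∈ B
  union_mem : ∀ S ∈ B, ∀ T ∈ B, (S ∩ T).Nonempty → S ∪ T ∈ B
  univ_mem : Finset.univ ∈ B

/-- The restriction `B|_S = {T ∈ B : T ⊆ S}`, a building set on `S`. -/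
def restrictTo (B : Finset (Finset α)) (S : Finset α) : Finset (Finset α) :=
  B.filter (fun T => T ⊆ S)

/-- The nestohedron `P_B = ∑_{S ∈ B} conv (e_a : a ∈ S)`, a Minkowski sum of simplices in `ℝ^α`. For
a building set on a subset `S` of `α` this is the nestohedron in `ℝ^S`, placed in `ℝ^α`. -/
def nestohedron (B : Finset (Finset α)) : Set (α → ℝ) :=
  ∑ S ∈ B, convexHull ℝ ((fun a : α => (Pi.single a 1 : α → ℝ)) '' (S : Set α))

open Classical in
/-- The graphical building set of a graph: the sets of vertices inducing a connected subgraph. -/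
def graphicalBuildingSet (Γ : SimpleGraph α) : Finset (Finset α) :=
  Finset.univ.filter (fun S => (Γ.induce (S : Set α)).Connected)

end Nestohedra

open Classical in
/-- The building set `{{1, …, i}, {i} : 1 ≤ i ≤ n + 1}` of the `n`-cube. -/
def cubeBuildingSet (n : ℕ) : Finset (Finset (Fin (n + 1))) :=
  Finset.univ.filter (fun S => ∃ i, S = {i} ∨ S = Finset.Iic i)

/-- The standard cube `[0,1]^n`. -/
def standardCube (n : ℕ) : Set (Fin n → ℝ) := Set.Icc 0 1

/-- The permutohedron: the graph-associahedron of the complete graph on `n + 1` vertices. -/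
def permutohedron (n : ℕ) : Set (Fin (n + 1) → ℝ) :=
  nestohedron (graphicalBuildingSet (⊤ : SimpleGraph (Fin (n + 1))))

/-- The stellahedron: the graph-associahedron of the star graph on `n + 1` vertices. -/
def stellahedron (n : ℕ) : Set (Fin (n + 1) → ℝ) :=
  nestohedron (graphicalBuildingSet (SimpleGraph.starGraph (0 : Fin (n + 1))))

/-- The cyclohedron: the graph-associahedron of the cycle graph on `n + 1` vertices (a point for
`n = 0`, a single edge for `n = 1`). -/
def cyclohedron (n : ℕ) : Set (Fin (n + 1) → ℝ) :=
  nestohedron (graphicalBuildingSet (SimpleGraph.cycleGraph (n + 1)))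

/-- The associahedron: the graph-associahedron of the path graph on `n + 1` vertices. -/
def associahedron (n : ℕ) : Set (Fin (n + 1) → ℝ) :=
  nestohedron (graphicalBuildingSet (SimpleGraph.pathGraph (n + 1)))

end ToricFamilies

end

open ToricFamilies

/-! A simple polytope `P` has a cubical model. Let `𝓕` index its facets, and consider the points `y`
of the cube `[0,1]^𝓕` whose coordinates different from `1` are indexed by a set of facets with a
common point. Send the cube vertex that vanishes exactly on such a set `σ` to a chosen relative
interior point of the face `σ`, and extend linearly over the standard triangulation of the cube.
This is a homeomorphism onto `P` (`cubesHomeo`), and `y_F = 0` holds exactly on the facet `F`.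
Multiplying the coordinates by circle elements turns it into a homeomorphism of the moment-angle
manifold with the moment-angle complex of the nerve (`momentAngleHomeo`).

In cubical coordinates face embeddings become combinatorial. Suppose that an injection `e` of facets
identifies `K_P` both with a full subcomplex of `K_Q` and with the link of a simplex `Z` (`IsLink`).
Put `0` at the coordinates in `Z`, copy the coordinate at `F` to `e F`, and put `1` elsewhere. The
result is a face embedding, usually not affine, onto the face given by `Z`. Such maps compose
strictly, so it suffices to treat consecutive dimensions. The two maps from `Z_P` to `Z_{K_Q}` to be
compared differ only in the coordinates in `Z`, which are `0` for one and `1` for the other. Moving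
them along the unit interval is a homotopy inside `Z_{K_Q}`, and homotopy invariance of singular
cohomology gives condition 3.

It remains to find links. A nestohedron is cut out by one inequality per member of the building set
(`mem_nestohedron_iff`), and a set of proper members is a simplex of its nerve exactly when some
choice of an element in every member respects all of them (`nestohedronHRep_simplex_iff`). If `S`
omits a single point, the link of the facet `S` is the nerve of the nestohedron of the restriction
to `S`; a combinatorial equivalence then carries this to the previous polytope. For permutohedra,
stellahedra, associahedra and the cube building sets, deleting the last element restricts each
building set to the previous one.

For cyclohedra, deleting a vertex of the cycle would only give a path. The facet of a singleton is
used instead: its link belongs to the graph in which the neighbours of the deleted vertex are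
joined, which is the shorter cycle (`IsReconnected.exists_isLink`). For `[0,1]^n` the facet where
the last coordinate vanishes works. -/

noncomputable section

namespace ToricFamilies

set_option linter.unusedSectionVars false
open Filter Topology

/-! ### Simple polytopes presented by linear inequalities -/

/-- A presentation of a compact set `P` by linear inequalities `off F ≤ lin F x` on an affine
subspace such that the functionals which are tight at a point of `P` are linearly independent on
the direction of that subspace. -/
structure SimpleHRep {ι : Type} (P : Set (ι → ℝ)) (𝓕 : Type) where
  dir : Submodule ℝ (ι → ℝ)
  base : ι → ℝ
  lin : 𝓕 → (ι → ℝ) →ₗ[ℝ] ℝ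
  off : 𝓕 → ℝ
  base_mem : base ∈ P
  mem_iff : ∀ x, x ∈ P ↔ x - base ∈ dir ∧ ∀ F, off F ≤ lin F x
  isCompact : IsCompact P
  facet_nonempty : ∀ F, ∃ x ∈ P, lin F x = off F
  indep : ∀ x ∈ P, ∀ c : 𝓕 → ℝ, ∃ v ∈ dir, ∀ F, lin F x = off F → lin F v = c F

namespace SimpleHRep

variable {ι : Type} [Finite ι] {P : Set (ι → ℝ)} {𝓕 : Type} [Fintype 𝓕] [DecidableEq 𝓕]
  (R : SimpleHRep P 𝓕)

open Classical in
/-- The set of inequalities that are tight at a point. -/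
def zeros (x : ι → ℝ) : Finset 𝓕 := Finset.univ.filter fun F => R.lin F x = R.off F

@[simp] theorem mem_zeros {x : ι → ℝ} {F : 𝓕} : F ∈ R.zeros x ↔ R.lin F x = R.off F := by
  simp [zeros]

/-- A set of inequalities that are simultaneously tight at a point of `P`. -/
def Simplex (σ : Finset 𝓕) : Prop := ∃ x ∈ P, σ ⊆ R.zeros x

theorem Simplex.mono {R : SimpleHRep P 𝓕} {σ τ : Finset 𝓕} (h : R.Simplex τ) (hst : σ ⊆ τ) :
    R.Simplex σ := by
  obtain ⟨x, hx, h⟩ := h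
  exact ⟨x, hx, hst.trans h⟩

theorem simplex_zeros {x : ι → ℝ} (hx : x ∈ P) : R.Simplex (R.zeros x) := ⟨x, hx, subset_rfl⟩

theorem simplex_empty : R.Simplex ∅ := ⟨R.base, R.base_mem, by simp⟩

theorem simplex_singleton (F : 𝓕) : R.Simplex {F} := by
  obtain ⟨x, hx, h⟩ := R.facet_nonempty F
  exact ⟨x, hx, by simpa using h⟩

include R in
theorem convex : Convex ℝ P := by
  intro x hx y hy a b ha hb hab
  rw [R.mem_iff] at hx hy ⊢
  refine ⟨?_, fun F => ?_⟩
  · have : a • x + b • y - R.base = a • (x - R.base) + b • (y - R.base) := by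
      rw [smul_sub, smul_sub, sub_add_sub_comm, ← add_smul, hab, one_smul]
    rw [this]
    exact R.dir.add_mem (R.dir.smul_mem _ hx.1) (R.dir.smul_mem _ hy.1)
  · have h1 := mul_le_mul_of_nonneg_left (hx.2 F) ha
    have h2 := mul_le_mul_of_nonneg_left (hy.2 F) hb
    simp only [map_add, map_smul, smul_eq_mul]
    have : R.off F = a * R.off F + b * R.off F := by rw [← add_mul, hab, one_mul]
    linarith

theorem continuous_lin (F : 𝓕) : Continuous (R.lin F) :=
  have := Fintype.ofFinite ι
  LinearMap.continuous_of_finiteDimensional _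

theorem off_le {x : ι → ℝ} (hx : x ∈ P) (F : 𝓕) : R.off F ≤ R.lin F x := ((R.mem_iff x).1 hx).2 F

theorem sub_mem_dir {x y : ι → ℝ} (hx : x ∈ P) (hy : y ∈ P) : x - y ∈ R.dir := by
  have := R.dir.sub_mem ((R.mem_iff x).1 hx).1 ((R.mem_iff y).1 hy).1
  simpa using this

theorem mem_of_add {x v : ι → ℝ} (hx : x ∈ P) (hv : v ∈ R.dir)
    (h : ∀ F, R.off F ≤ R.lin F (x + v)) : x + v ∈ P := by
  refine (R.mem_iff _).2 ⟨?_, h⟩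
  have := R.dir.add_mem ((R.mem_iff x).1 hx).1 hv
  rwa [add_comm, ← add_sub_assoc, add_comm v] at this

/-- A small move in a direction which does not violate the tight inequalities stays in `P`. -/
theorem eventually_add_mem {x v : ι → ℝ} (hx : x ∈ P) (hv : v ∈ R.dir)
    (h : ∀ F ∈ R.zeros x, 0 ≤ R.lin F v) :
    ∀ᶠ ε in 𝓝[>] (0 : ℝ), x + ε • v ∈ P ∧ ∀ F, F ∉ R.zeros x → R.off F < R.lin F (x + ε • v) := by
  have h1 : ∀ᶠ ε in 𝓝[>] (0 : ℝ), ∀ F, F ∉ R.zeros x → R.off F < R.lin F (x + ε • v) := by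
    rw [eventually_all]
    intro F
    by_cases hF : F ∈ R.zeros x
    · simp [hF]
    · have hlt : R.off F < R.lin F x :=
        lt_of_le_of_ne (R.off_le hx F) fun h => hF (R.mem_zeros.2 h.symm)
      have hc : Continuous fun ε : ℝ => R.lin F (x + ε • v) := (R.continuous_lin F).comp (by fun_prop)
      have h0 : Tendsto (fun ε : ℝ => R.lin F (x + ε • v)) (𝓝[>] 0) (𝓝 (R.lin F x)) := by
        have := (hc.tendsto 0).mono_left (nhdsWithin_le_nhds (s := Set.Ioi 0))
        simpa using this
      filter_upwards [h0.eventually (lt_mem_nhds hlt)] with ε hε _ using hε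
  filter_upwards [h1, self_mem_nhdsWithin] with ε hε hpos
  refine ⟨R.mem_of_add hx (R.dir.smul_mem _ hv) fun F => ?_, hε⟩
  by_cases hF : F ∈ R.zeros x
  · have := h F hF
    rw [R.mem_zeros] at hF
    simp only [map_add, map_smul, smul_eq_mul, hF]
    have := mul_nonneg (le_of_lt hpos) this
    linarith
  · exact (hε F hF).le

/-- Independence of the tight functionals gives a direction that keeps those in `σ` constant and
increases the other tight ones. A short move along it makes exactly `σ` tight. -/
theorem exists_zeros_eq {σ : Finset 𝓕} (h : R.Simplex σ) : ∃ x ∈ P, R.zeros x = σ := by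
  obtain ⟨x, hx, hσ⟩ := h
  obtain ⟨v, hv, hv'⟩ := R.indep x hx fun F => if F ∈ σ then 0 else 1
  have := R.eventually_add_mem hx hv (fun F hF => by
    rw [hv' F (R.mem_zeros.1 hF)]; split_ifs <;> norm_num)
  obtain ⟨ε, ⟨hP, hlt⟩, hpos⟩ := (this.and self_mem_nhdsWithin).exists
  refine ⟨_, hP, ?_⟩
  ext F
  rw [R.mem_zeros]
  by_cases hF : F ∈ R.zeros x
  · have h1 := hv' F (R.mem_zeros.1 hF)
    rw [R.mem_zeros] at hF
    have h3 : (0 : ℝ) < ε := hpos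
    by_cases h2 : F ∈ σ
    · simp [h1, h2, hF]
    · simp [h1, h2, hF, h3.ne']
  · have := hlt F hF
    exact ⟨fun h => absurd h this.ne', fun h => absurd (hσ h) hF⟩

open Classical in
/-- A point in the relative interior of the face given by a simplex. -/
def bary (σ : Finset 𝓕) : ι → ℝ := if h : R.Simplex σ then (R.exists_zeros_eq h).choose else 0

theorem bary_mem {σ : Finset 𝓕} (h : R.Simplex σ) : R.bary σ ∈ P := by
  rw [bary, dif_pos h]
  exact (R.exists_zeros_eq h).choose_spec.1

theorem zeros_bary {σ : Finset 𝓕} (h : R.Simplex σ) : R.zeros (R.bary σ) = σ := by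
  rw [bary, dif_pos h]
  exact (R.exists_zeros_eq h).choose_spec.2

/-- The tight inequalities at an inner point of a segment in `P`. -/
theorem zeros_combo {x y : ι → ℝ} (hx : x ∈ P) (hy : y ∈ P) {a b : ℝ} (ha : 0 < a) (hb : 0 < b)
    (hab : a + b = 1) : R.zeros (a • x + b • y) = R.zeros x ∩ R.zeros y := by
  ext F
  simp only [R.mem_zeros, Finset.mem_inter, map_add, map_smul, smul_eq_mul]
  have hx := R.off_le hx F
  have hy := R.off_le hy F
  constructor
  · intro h
    have e : a * (R.lin F x - R.off F) + b * (R.lin F y - R.off F) = 0 := by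
      linear_combination h - R.off F * hab
    have h1 := mul_nonneg ha.le (sub_nonneg.2 hx)
    have h2 := mul_nonneg hb.le (sub_nonneg.2 hy)
    have h3 : a * (R.lin F x - R.off F) = 0 := by linarith
    have h4 : b * (R.lin F y - R.off F) = 0 := by linarith
    constructor
    · linarith [(mul_eq_zero.1 h3).resolve_left ha.ne']
    · linarith [(mul_eq_zero.1 h4).resolve_left hb.ne']
  · rintro ⟨h1, h2⟩
    rw [h1, h2, ← add_mul, hab, one_mul]

end SimpleHRep

/-! ### The layers of a point of the cube -/

section Layers

variable {𝓕 : Type} [Fintype 𝓕] [DecidableEq 𝓕]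

/-- The amount of time `s ∈ [0, 1]` during which `{F | y F ≤ s}` equals `σ`. -/
def layer (σ : Finset 𝓕) (y : 𝓕 → unitInterval) : ℝ := max 0 (((σᶜ.inf y : unitInterval) : ℝ) - (σ.sup y : unitInterval))

theorem continuous_layer (σ : Finset 𝓕) : Continuous (layer σ) := by
  unfold layer
  have h1 : Continuous fun y : 𝓕 → unitInterval => σᶜ.inf y :=
    Continuous.finset_inf_apply fun i _ => continuous_apply i
  have h2 : Continuous fun y : 𝓕 → unitInterval => σ.sup y :=
    Continuous.finset_sup_apply fun i _ => continuous_apply i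
  fun_prop

/-- The affine self-map of the unit interval with `0 ↦ m` and `1 ↦ 1`. -/
def raise (m t : unitInterval) : unitInterval := ⟨m + (1 - m) * t, by
  have h1 := m.2.1; have h2 := m.2.2; have h3 := t.2.1; have h4 := t.2.2
  constructor <;> nlinarith [mul_nonneg (sub_nonneg.2 h2) h3, mul_nonneg (sub_nonneg.2 h2) (sub_nonneg.2 h4)]⟩

theorem raise_mono (m : unitInterval) : Monotone (raise m) := by
  intro s t h
  have h : (s : ℝ) ≤ t := h
  have := mul_le_mul_of_nonneg_left h (sub_nonneg.2 m.2.2)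
  exact Subtype.coe_le_coe.1 (by simp only [raise]; linarith)

/-- The point `m χ + (1 - m) z` where `χ` is `0` on `σ` and `1` elsewhere. -/
def cone (m : unitInterval) (z : 𝓕 → unitInterval) (σ : Finset 𝓕) : 𝓕 → unitInterval := fun F => if F ∈ σ then 0 else raise m (z F)

theorem cone_le (m : unitInterval) (z : 𝓕 → unitInterval) (σ : Finset 𝓕) (F : 𝓕) : cone m z σ F ≤ raise m (z F) := by
  unfold cone
  split_ifs
  · exact unitInterval.nonneg'
  · exact le_rfl

/-- The sublevel set of the cone point is `σ` up to time `m`; afterwards it runs through the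
sublevel sets of `z`, with time rescaled by `1 - m`. The empty infimum `1` and the empty supremum
`0` make this hold for the extreme sets as well. -/
theorem layer_cone (m : unitInterval) (z : 𝓕 → unitInterval) (σ τ : Finset 𝓕) (hz : ∀ F ∈ σ, z F = 0) :
    layer τ (cone m z σ) = (if τ = σ then (m : ℝ) else 0) + (1 - m) * layer τ z := by
  have htop : raise m ⊤ = ⊤ := Subtype.ext (by change (m : ℝ) + (1 - m) * 1 = 1; ring)
  have hm : (0 : ℝ) ≤ 1 - m := sub_nonneg.2 m.2.2
  have hinf : σ ⊆ τ → τᶜ.inf (cone m z σ) = raise m (τᶜ.inf z) := by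
    intro h
    rw [Finset.apply_inf_eq_inf_comp_of_linearOrder _ (raise_mono m) htop]
    refine Finset.inf_congr rfl fun F hF => ?_
    have : F ∉ σ := fun h' => Finset.mem_compl.1 hF (h h')
    simp [cone, this]
  by_cases hσ : σ ⊆ τ
  · by_cases he : τ = σ
    · subst he
      have hs : τ.sup z = 0 := le_antisymm (Finset.sup_le fun F hF => (hz F hF).le) unitInterval.nonneg'
      have hs' : τ.sup (cone m z τ) = 0 :=
        le_antisymm (Finset.sup_le fun F hF => by simp [cone, hF]) unitInterval.nonneg'
      have h0 : (0 : ℝ) ≤ (τᶜ.inf z : unitInterval) := (τᶜ.inf z).2.1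
      have hm0 := m.2.1
      simp only [layer, hs, hs', hinf hσ, if_true, raise, Set.Icc.coe_zero, sub_zero]
      rw [max_eq_right h0, max_eq_right (by positivity)]
    · obtain ⟨F1, h1, h1'⟩ : ∃ F ∈ τ, F ∉ σ := by
        by_contra! h
        exact he (Finset.Subset.antisymm h hσ)
      have hsup : τ.sup (cone m z σ) = raise m (τ.sup z) := by
        refine le_antisymm (Finset.sup_le fun F hF =>
          (cone_le m z σ F).trans (raise_mono m (Finset.le_sup hF))) ?_
        obtain ⟨F2, h2, h2'⟩ := Finset.exists_mem_eq_sup τ ⟨F1, h1⟩ z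
        by_cases h3 : F2 ∈ σ
        · rw [h2', hz F2 h3]
          refine le_trans (raise_mono m (unitInterval.nonneg' (t := z F1))) ?_
          refine le_trans (le_of_eq ?_) (Finset.le_sup h1)
          simp [cone, h1']
        · rw [h2']
          refine le_trans (le_of_eq ?_) (Finset.le_sup h2)
          simp [cone, h3]
      simp only [layer, hinf hσ, hsup, if_neg he, raise, zero_add]
      rw [mul_max_of_nonneg _ _ hm]
      ring_nf
  · obtain ⟨F1, h1, h1'⟩ := Finset.not_subset.1 hσ
    have he : τ ≠ σ := fun h => hσ h.symm.subset
    have key : ∀ y : 𝓕 → unitInterval, y F1 = 0 → layer τ y = 0 := by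
      intro y hy
      have : τᶜ.inf y = 0 := le_antisymm ((Finset.inf_le (Finset.mem_compl.2 h1')).trans hy.le)
        unitInterval.nonneg'
      rw [layer, this]
      have := (τ.sup y).2.1
      exact max_eq_left (by simpa using this)
    rw [key _ (by simp [cone, h1]), key _ (hz F1 h1), if_neg he]
    simp

/-- Take for `m` the least coordinate outside `σ` and stretch `[m, 1]` back to `[0, 1]`. The minimal
coordinate becomes a new zero, which is what later inductions use. If `m = 1`, in particular if `σ`
is everything, `y` is a vertex of the cube. -/
theorem exists_eq_cone (y : 𝓕 → unitInterval) (σ : Finset 𝓕) (hσ : ∀ F, F ∈ σ ↔ y F = 0) :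
    cone 1 y σ = y ∨ ∃ (m : unitInterval) (z : 𝓕 → unitInterval), 0 < m ∧ m < 1 ∧ y = cone m z σ ∧ (∀ F ∈ σ, z F = 0) ∧
      (∃ F, F ∉ σ ∧ z F = 0) ∧ ∀ F, z F ≠ 1 → y F ≠ 1 := by
  obtain ⟨m, hm⟩ : ∃ m, m = σᶜ.inf y := ⟨_, rfl⟩
  have hle : ∀ F, F ∉ σ → m ≤ y F := fun F hF => hm ▸ Finset.inf_le (Finset.mem_compl.2 hF)
  by_cases h1 : m = 1
  · left
    funext F
    by_cases hF : F ∈ σ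
    · simp [cone, hF, (hσ F).1 hF]
    · have : y F = 1 := le_antisymm unitInterval.le_one' (h1 ▸ hle F hF)
      simp only [cone, hF, if_false, this]
      exact Subtype.ext (by simp [raise])
  · right
    have hne : σᶜ.Nonempty := by
      by_contra h
      rw [Finset.not_nonempty_iff_eq_empty] at h
      rw [h, Finset.inf_empty] at hm
      exact h1 hm
    obtain ⟨F0, hF0, hF0'⟩ := Finset.exists_mem_eq_inf σᶜ hne y
    rw [Finset.mem_compl] at hF0
    have hF0' : m = y F0 := hm.trans hF0'
    have hpos : 0 < m := by
      rw [hF0']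
      exact lt_of_le_of_ne unitInterval.nonneg' fun h => hF0 ((hσ _).2 h.symm)
    have hlt : m < 1 := lt_of_le_of_ne unitInterval.le_one' h1
    have hlt' : (0 : ℝ) < 1 - m := sub_pos.2 hlt
    let z : 𝓕 → unitInterval := fun F => if hF : F ∈ σ then 0 else ⟨((y F : ℝ) - m) / (1 - m), by
      have h2 : (m : ℝ) ≤ y F := hle F hF
      have h3 := (y F).2.2
      constructor
      · exact div_nonneg (sub_nonneg.2 h2) hlt'.le
      · rw [div_le_one hlt']
        linarith⟩
    refine ⟨m, z, hpos, hlt, ?_, fun F hF => by simp [z, hF], ⟨F0, hF0, ?_⟩, fun F h h' => ?_⟩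
    · funext F
      by_cases hF : F ∈ σ
      · simp [cone, hF, (hσ F).1 hF]
      · simp only [cone, hF, if_false, raise, z, dif_neg, not_false_eq_true]
        apply Subtype.ext
        simp only
        field_simp
        ring
    · simp [z, hF0, ← hF0']
    · apply h
      have hF : F ∉ σ := fun hF => by rw [(hσ F).1 hF] at h'; exact zero_ne_one h'
      simp only [z, hF, dif_neg, not_false_eq_true]
      apply Subtype.ext
      simp [h', div_self hlt'.ne']

end Layers

namespace SimpleHRep

variable {ι : Type} [Finite ι] {P : Set (ι → ℝ)} {𝓕 : Type} [Fintype 𝓕] [DecidableEq 𝓕]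
  (R : SimpleHRep P 𝓕)

/-! ### The cubical subdivision of a simple polytope -/

/-- The set of coordinates at which a function does not take the value `1`. -/
def support (y : 𝓕 → unitInterval) : Finset 𝓕 := Finset.univ.filter fun F => y F ≠ 1

@[simp] theorem mem_support {y : 𝓕 → unitInterval} {F : 𝓕} : F ∈ support y ↔ y F ≠ 1 := by
  simp [support]

/-- The set of coordinates at which a function vanishes. -/
def vanishing (y : 𝓕 → unitInterval) : Finset 𝓕 := Finset.univ.filter fun F => y F = 0

@[simp] theorem mem_vanishing {y : 𝓕 → unitInterval} {F : 𝓕} : F ∈ vanishing y ↔ y F = 0 := by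
  simp [vanishing]

theorem vanishing_subset_support (y : 𝓕 → unitInterval) : vanishing y ⊆ support y := by
  intro F hF
  rw [mem_vanishing] at hF
  rw [mem_support, hF]
  exact zero_ne_one

/-- The cubical complex: the union of the faces of the cube that contain the vertex `(1, …, 1)` and
correspond to simplices. -/
def cubes : Set (𝓕 → unitInterval) := {y | R.Simplex (support y)}

theorem isClosed_cubes : IsClosed R.cubes := by
  have : R.cubes = ⋃ σ ∈ {σ : Finset 𝓕 | R.Simplex σ}, {y | ∀ F, F ∉ σ → y F = 1} := by
    ext y
    simp only [cubes, Set.mem_ofPred_eq, Set.mem_iUnion, exists_prop]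
    constructor
    · exact fun h => ⟨_, h, fun F hF => by simpa using hF⟩
    · rintro ⟨σ, hσ, h⟩
      refine hσ.mono fun F hF => ?_
      by_contra hF'
      exact (mem_support.1 hF) (h F hF')
  rw [this]
  refine (Set.toFinite _).isClosed_biUnion fun σ _ => ?_
  simp only [Set.ofPred_forall]
  refine isClosed_iInter fun F => isClosed_iInter fun _ => ?_
  exact isClosed_eq (continuous_apply F) continuous_const

instance : CompactSpace R.cubes := isCompact_iff_compactSpace.1 R.isClosed_cubes.isCompact

/-- The barycentric map from the cube: vertices of the cubical complex go to centres of faces. -/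
def fromCube (y : 𝓕 → unitInterval) : ι → ℝ := ∑ σ : Finset 𝓕, layer σ y • R.bary σ

theorem continuous_fromCube : Continuous R.fromCube := by
  unfold fromCube
  have := fun σ : Finset 𝓕 => continuous_layer σ
  fun_prop

theorem fromCube_cone (m : unitInterval) (z : 𝓕 → unitInterval) (σ : Finset 𝓕)
    (hz : ∀ F ∈ σ, z F = 0) :
    R.fromCube (cone m z σ) = (m : ℝ) • R.bary σ + (1 - m : ℝ) • R.fromCube z := by
  simp only [fromCube, layer_cone m z σ _ hz, add_smul, Finset.sum_add_distrib, Finset.smul_sum,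
    mul_smul]
  congr 1
  simp [ite_smul]

theorem cone_one (z z' : 𝓕 → unitInterval) (σ : Finset 𝓕) : cone 1 z σ = cone 1 z' σ := by
  funext F
  unfold cone
  split_ifs
  · rfl
  · exact Subtype.ext (by simp [raise])

theorem fromCube_cone_one (z : 𝓕 → unitInterval) (σ : Finset 𝓕) :
    R.fromCube (cone 1 z σ) = R.bary σ := by
  rw [cone_one z 0, R.fromCube_cone 1 0 σ fun _ _ => rfl]
  simp

theorem exists_cone {y : 𝓕 → unitInterval} (hy : y ∈ R.cubes) :
    cone 1 y (vanishing y) = y ∨ ∃ (m : unitInterval) (z : 𝓕 → unitInterval), 0 < m ∧ m < 1 ∧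
      z ∈ R.cubes ∧ vanishing y ⊂ vanishing z ∧ y = cone m z (vanishing y) ∧
      R.fromCube y = (m : ℝ) • R.bary (vanishing y) + (1 - m : ℝ) • R.fromCube z := by
  rcases exists_eq_cone y (vanishing y) (fun F => mem_vanishing) with h | ⟨m, z, h0, h1, hyz, hz, ⟨F, hF, hF'⟩, hs⟩
  · exact Or.inl h
  · refine Or.inr ⟨m, z, h0, h1, ?_, ?_, hyz, ?_⟩
    · exact Simplex.mono hy fun F hF => mem_support.2 (hs F (mem_support.1 hF))
    · refine (Finset.ssubset_iff_of_subset fun G hG => mem_vanishing.2 (hz G hG)).2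
        ⟨F, mem_vanishing.2 hF', hF⟩
    · conv_lhs => rw [hyz]
      exact R.fromCube_cone m z _ hz

/-- Induction on the number of nonzero coordinates. Off the cube vertices the image is an inner
point of a segment from the centre of the face `vanishing y` to a point of a smaller face, so its
tight set is the intersection of theirs. -/
theorem fromCube_spec (y : 𝓕 → unitInterval) (hy : y ∈ R.cubes) :
    R.fromCube y ∈ P ∧ R.zeros (R.fromCube y) = vanishing y := by
  have hs : R.Simplex (vanishing y) := Simplex.mono hy (vanishing_subset_support y)
  rcases R.exists_cone hy with h | ⟨m, z, h0, h1, hz, hlt, -, he⟩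
  · rw [← h, R.fromCube_cone_one, h]
    exact ⟨R.bary_mem hs, R.zeros_bary hs⟩
  · have ih := fromCube_spec z hz
    have h0 : (0 : ℝ) < m := h0
    have h1 : (0 : ℝ) < 1 - m := sub_pos.2 h1
    have hm : (m : ℝ) + (1 - m) = 1 := by ring
    rw [he, R.zeros_combo (R.bary_mem hs) ih.1 h0 h1 hm, ih.2, R.zeros_bary hs]
    exact ⟨R.convex (R.bary_mem hs) ih.1 h0.le h1.le hm, Finset.inter_eq_left.2 hlt.subset⟩
termination_by Fintype.card 𝓕 - (vanishing y).card
decreasing_by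
  have := Finset.card_lt_card hlt
  have := Finset.card_le_univ (vanishing z)
  omega

/-- Follow the ray from the centre `b` of the smallest face containing `p` through `p` until it
leaves `P`. The exit point `q` lies in a smaller face, hence is in the image by induction, and `p`
is on the segment from `b` to `q`. -/
theorem fromCube_surj {p : ι → ℝ} (hp : p ∈ P) : ∃ y ∈ R.cubes, R.fromCube y = p := by
  have hs : R.Simplex (R.zeros p) := R.simplex_zeros hp
  set σ := R.zeros p with hσ
  set b := R.bary σ with hb
  have hbP : b ∈ P := R.bary_mem hs
  have hbz : R.zeros b = σ := R.zeros_bary hs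
  by_cases hpb : p = b
  · refine ⟨cone 1 0 σ, ?_, ?_⟩
    · refine hs.mono fun F hF => ?_
      by_contra h
      refine mem_support.1 hF ?_
      simp only [cone, h, if_false]
      exact Subtype.ext (by simp [raise])
    · rw [R.fromCube_cone_one, hpb]
  · have hcont : Continuous fun t : ℝ => b + t • (p - b) := by fun_prop
    set T : Set ℝ := {t | 1 ≤ t ∧ b + t • (p - b) ∈ P} with hT
    have hne : (1 : ℝ) ∈ T := ⟨le_rfl, by simpa using hp⟩
    have hcl : IsClosed T :=
      IsClosed.inter isClosed_Ici (R.isCompact.isClosed.preimage hcont)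
    have := Fintype.ofFinite ι
    obtain ⟨C, hC⟩ := R.isCompact.isBounded.exists_norm_le
    have hnorm : 0 < ‖p - b‖ := norm_pos_iff.2 (sub_ne_zero.2 hpb)
    have hbd : BddAbove T := by
      refine ⟨(C + ‖b‖) / ‖p - b‖, fun t ht => ?_⟩
      rw [le_div_iff₀ hnorm]
      have h1 := hC _ ht.2
      have h2 : ‖t • (p - b)‖ ≤ ‖b + t • (p - b)‖ + ‖b‖ := by
        have := norm_sub_le (b + t • (p - b)) b
        simpa using this
      rw [norm_smul, Real.norm_of_nonneg (by linarith [ht.1])] at h2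
      linarith
    have hmem : sSup T ∈ T := hcl.csSup_mem ⟨1, hne⟩ hbd
    set s := sSup T with hs'
    set q := b + s • (p - b) with hq
    have hqP : q ∈ P := hmem.2
    have hspos : 0 < s := lt_of_lt_of_le one_pos hmem.1
    have hpbF : ∀ F ∈ σ, R.lin F (p - b) = 0 := fun F hF => by
      have h1 := R.mem_zeros.1 (hσ ▸ hF)
      have h2 := R.mem_zeros.1 (hbz.symm ▸ hF)
      simp [h1, h2]
    have hsub : σ ⊆ R.zeros q := fun F hF => by
      have h2 := R.mem_zeros.1 (hbz.symm ▸ hF)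
      have h3 := hpbF F hF
      rw [R.mem_zeros, hq, map_add, map_smul, h3, h2]
      simp
    -- If no new inequality were tight at `q`, the ray could be continued beyond the supremum `s`.
    have hlt : σ ⊂ R.zeros q := by
      refine lt_of_le_of_ne hsub fun heq => ?_
      have hd : p - b ∈ R.dir := R.sub_mem_dir hp hbP
      have := R.eventually_add_mem hqP hd (fun F hF => (hpbF F (heq ▸ hF)).ge)
      obtain ⟨ε, ⟨hε, -⟩, hpos⟩ := (this.and self_mem_nhdsWithin).exists
      have hpos : 0 < ε := hpos
      have : s + ε ∈ T := ⟨by linarith [hmem.1], by rwa [add_smul, ← add_assoc]⟩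
      have := le_csSup hbd this
      linarith
    have hs1 : 1 < s := by
      refine lt_of_le_of_ne hmem.1 fun h => hlt.ne ?_
      rw [hq, ← h, one_smul, add_sub_cancel]
    obtain ⟨z, hz, hzq⟩ := fromCube_surj hqP
    have hzv : vanishing z = R.zeros q := by rw [← hzq, (R.fromCube_spec z hz).2]
    have hz0 : ∀ F ∈ σ, z F = 0 := fun F hF => mem_vanishing.1 (hzv ▸ hsub hF)
    -- From `q = b + s (p - b)` one gets `p = (1 - s⁻¹) b + s⁻¹ q`.
    let m : unitInterval := ⟨1 - s⁻¹, by
      constructor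
      · rw [sub_nonneg]; exact inv_le_one_of_one_le₀ hs1.le
      · have := inv_pos.2 hspos; linarith⟩
    refine ⟨cone m z σ, ?_, ?_⟩
    · refine Simplex.mono hz fun F hF => ?_
      rw [mem_support] at hF ⊢
      intro h
      have hFσ : F ∉ σ := fun hF' => by rw [hz0 F hF'] at h; exact zero_ne_one h
      refine hF ?_
      simp only [cone, hFσ, if_false, h]
      exact Subtype.ext (by simp [raise])
    · rw [R.fromCube_cone m z σ hz0, hzq, hq]
      change (1 - s⁻¹) • b + (1 - (1 - s⁻¹)) • (b + s • (p - b)) = p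
      rw [sub_sub_cancel, smul_add, smul_smul, inv_mul_cancel₀ hspos.ne', sub_smul, one_smul, one_smul]
      abel
termination_by Fintype.card 𝓕 - (R.zeros p).card
decreasing_by
  exact Nat.sub_lt_sub_left ((Finset.card_lt_card hlt).trans_le (Finset.card_le_univ _))
    (Finset.card_lt_card hlt)

/-- The tight set of the image recovers the vanishing set, so both points are cones with the same
apex. It remains to show that the cone parameters agree; the bases then agree by induction. -/
theorem fromCube_inj (y : 𝓕 → unitInterval) (hy : y ∈ R.cubes) (z : 𝓕 → unitInterval)
    (hz : z ∈ R.cubes) (h : R.fromCube y = R.fromCube z) : y = z := by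
  have hv : vanishing y = vanishing z := by
    rw [← (R.fromCube_spec y hy).2, ← (R.fromCube_spec z hz).2, h]
  have hs : R.Simplex (vanishing y) := Simplex.mono hy (vanishing_subset_support y)
  have hb : R.zeros (R.bary (vanishing y)) = vanishing y := R.zeros_bary hs
  have hbP := R.bary_mem hs
  -- The apex is not hit by a cone point with parameter below `1`: the base point would equal the
  -- apex, although its tight set is strictly larger.
  have key : ∀ (x w : 𝓕 → unitInterval) (m : unitInterval), m < 1 → w ∈ R.cubes →
      vanishing y ⊂ vanishing w →
      (m : ℝ) • R.bary (vanishing y) + (1 - m : ℝ) • R.fromCube w ≠ R.bary (vanishing y) := by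
    intro x w m hm hw hlt he
    have h1 : (0 : ℝ) < 1 - m := sub_pos.2 hm
    have h2 : (1 - m : ℝ) • R.fromCube w = (1 - m : ℝ) • R.bary (vanishing y) := by
      rw [sub_smul 1 (m : ℝ) (R.bary _), one_smul, eq_sub_iff_add_eq', he]
    have h3 := smul_right_injective _ h1.ne' h2
    have h4 := (R.fromCube_spec w hw).2
    rw [h3, hb] at h4
    exact hlt.ne h4
  rcases R.exists_cone hy with h1 | ⟨m, y', m0, m1, hy', hlt, hyc, he⟩
  · rcases R.exists_cone hz with h2 | ⟨n, z', n0, n1, hz', hlt', hzc, he'⟩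
    · rw [← h1, ← h2, hv]
      exact cone_one _ _ _
    · rw [← hv] at he' hlt'
      rw [← h1, R.fromCube_cone_one, he'] at h
      exact absurd h.symm (key y z' n n1 hz' hlt')
  · rcases R.exists_cone hz with h2 | ⟨n, z', n0, n1, hz', hlt', hzc, he'⟩
    · rw [← h2, R.fromCube_cone_one, ← hv, he] at h
      exact absurd h (key y y' m m1 hy' hlt)
    · rw [← hv] at he' hlt' hzc
      -- If `m < n`, the image of `y'` would be an inner point of the segment from the apex to the
      -- image of `z'`, so its tight set would not exceed `vanishing y`.
      have step : ∀ (m n : unitInterval) (y' z' : 𝓕 → unitInterval), y' ∈ R.cubes → z' ∈ R.cubes →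
          n < 1 → vanishing y ⊂ vanishing y' →
          (m : ℝ) • R.bary (vanishing y) + (1 - m : ℝ) • R.fromCube y' =
            (n : ℝ) • R.bary (vanishing y) + (1 - n : ℝ) • R.fromCube z' → vanishing y ⊂ vanishing z' →
          ¬ m < n := by
        intro m n y' z' hy' hz' n1 hlt he hlt' hmn
        have hmn' : (m : ℝ) < n := hmn
        have h1 : (0 : ℝ) < 1 - n := sub_pos.2 n1
        have h2 : (0 : ℝ) < 1 - m := by linarith
        have h3 : R.fromCube y' = ((n - m : ℝ) / (1 - m)) • R.bary (vanishing y) +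
            ((1 - n : ℝ) / (1 - m)) • R.fromCube z' := by
          refine smul_right_injective _ h2.ne' ?_
          simp only [smul_add, smul_smul, mul_div_cancel₀ _ h2.ne']
          rw [sub_smul (n : ℝ) m, sub_add_eq_add_sub, ← he]
          abel
        have h4 := R.zeros_combo hbP (R.fromCube_spec z' hz').1
          (div_pos (sub_pos.2 hmn') h2) (div_pos h1 h2) (by field_simp; ring)
        rw [← h3, (R.fromCube_spec y' hy').2, hb] at h4
        exact hlt.not_subset (h4 ▸ Finset.inter_subset_left)
      rw [he, he'] at h
      have hmn : m = n := le_antisymm (not_lt.1 (step n m z' y' hz' hy' m1 hlt' h.symm hlt))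
        (not_lt.1 (step m n y' z' hy' hz' n1 hlt h hlt'))
      subst hmn
      have h1 : (0 : ℝ) < 1 - m := sub_pos.2 m1
      have h5 := smul_right_injective _ h1.ne' (add_left_cancel h)
      have ih := fromCube_inj y' hy' z' hz' h5
      rw [hyc, hzc, ih]
termination_by Fintype.card 𝓕 - (vanishing y).card
decreasing_by
  have := Finset.card_lt_card hlt
  have := Finset.card_le_univ (vanishing y')
  omega

/-- The homeomorphism of the cubical complex with the polytope. -/
def cubesHomeo : R.cubes ≃ₜ P :=
  Continuous.homeoOfEquivCompactToT2
    (f := Equiv.ofBijective (fun y => (⟨R.fromCube y.1, (R.fromCube_spec y.1 y.2).1⟩ : P))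
      ⟨fun y z h => Subtype.ext (R.fromCube_inj _ y.2 _ z.2 (congrArg Subtype.val h)), fun p => by
        obtain ⟨y, hy, h⟩ := R.fromCube_surj p.2
        exact ⟨⟨y, hy⟩, Subtype.ext h⟩⟩)
    ((R.continuous_fromCube.comp continuous_subtype_val).subtype_mk _)

theorem zeros_cubesHomeo (y : R.cubes) : R.zeros (R.cubesHomeo y) = vanishing y.1 :=
  (R.fromCube_spec y.1 y.2).2

theorem vanishing_cubesHomeo_symm (p : P) : vanishing (R.cubesHomeo.symm p).1 = R.zeros p := by
  rw [← R.zeros_cubesHomeo, Homeomorph.apply_symm_apply]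

end SimpleHRep

namespace SimpleHRep

variable {ι : Type} [Finite ι] {P : Set (ι → ℝ)} {𝓕 : Type} [Fintype 𝓕] [DecidableEq 𝓕]
  (R : SimpleHRep P 𝓕)

/-! ### Faces and facets -/

/-- The face on which a set of inequalities is tight. -/
def face (σ : Finset 𝓕) : Set (ι → ℝ) := {x | x ∈ P ∧ σ ⊆ R.zeros x}

theorem face_empty : R.face ∅ = P := by ext; simp [face]

theorem face_nonempty_iff {σ : Finset 𝓕} : (R.face σ).Nonempty ↔ R.Simplex σ := Iff.rfl

theorem bary_mem_face {σ : Finset 𝓕} (h : R.Simplex σ) : R.bary σ ∈ R.face σ :=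
  ⟨R.bary_mem h, (R.zeros_bary h).ge⟩

theorem face_subset_iff {σ τ : Finset 𝓕} (h : R.Simplex σ) : R.face σ ⊆ R.face τ ↔ τ ⊆ σ := by
  constructor
  · intro hs
    have := (hs (R.bary_mem_face h)).2
    rwa [R.zeros_bary h] at this
  · exact fun hs x hx => ⟨hx.1, hs.trans hx.2⟩

theorem isExposed_face (σ : Finset 𝓕) : IsExposed ℝ P (R.face σ) := by
  rintro ⟨z, hz, hzσ⟩
  -- The sum of the functionals in `σ` attains its lower bound only where each of them is tight.
  let l : (ι → ℝ) →L[ℝ] ℝ := ⟨-∑ F ∈ σ, R.lin F, by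
    have := fun F => R.continuous_lin F
    simp only [AddHom.toFun_eq_coe, LinearMap.coe_toAddHom]
    fun_prop⟩
  have hl : ∀ x, l x = -∑ F ∈ σ, R.lin F x := fun x => by simp [l]
  have hmax : ∀ x ∈ P, l x ≤ -∑ F ∈ σ, R.off F := fun x hx => by
    rw [hl, neg_le_neg_iff]
    exact Finset.sum_le_sum fun F _ => R.off_le hx F
  refine ⟨l, Set.ext fun x => ⟨fun hx => ⟨hx.1, fun y hy => ?_⟩, fun hx => ⟨hx.1, ?_⟩⟩⟩
  · refine (hmax y hy).trans (le_of_eq ?_)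
    rw [hl, Finset.sum_congr rfl fun F hF => (R.mem_zeros.1 (hx.2 hF))]
  · have h1 : l z = -∑ F ∈ σ, R.off F := by
      rw [hl, Finset.sum_congr rfl fun F hF => (R.mem_zeros.1 (hzσ hF))]
    have h2 := hx.2 z hz
    rw [h1, hl, neg_le_neg_iff] at h2
    have h3 := (Finset.sum_eq_sum_iff_of_le fun F (_ : F ∈ σ) => R.off_le hx.1 F).1
      (le_antisymm (Finset.sum_le_sum fun F _ => R.off_le hx.1 F) h2)
    exact fun F hF => R.mem_zeros.2 (h3 F hF).symm

/-- A point `x` of `A` with minimal tight set is a relative interior point, and that tight set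
defines `A`. -/
theorem exists_eq_face {A : Set (ι → ℝ)} (hA : IsExposed ℝ P A) (hne : A.Nonempty) :
    ∃ σ, R.Simplex σ ∧ A = R.face σ := by
  obtain ⟨l, hl⟩ := hA hne
  have hAP : A ⊆ P := hA.subset
  obtain ⟨x, hx, hmin⟩ : ∃ x ∈ A, ∀ y ∈ A, ¬ R.zeros y ⊂ R.zeros x := by
    obtain ⟨x0, hx0⟩ := hne
    obtain ⟨s, ⟨x, hx, rfl⟩, hs⟩ := (Set.toFinite (R.zeros '' A)).exists_minimal ⟨_, x0, hx0, rfl⟩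
    exact ⟨x, hx, fun y hy h => h.2 (hs ⟨y, hy, rfl⟩ h.1)⟩
  have hxP := hAP hx
  have hxmax : ∀ y ∈ P, l y ≤ l x := by rw [hl] at hx; exact hx.2
  refine ⟨_, R.simplex_zeros hxP, Set.ext fun z => ⟨fun hz => ?_, fun hz => ?_⟩⟩
  · refine ⟨hAP hz, ?_⟩
    have hzmax : ∀ y ∈ P, l y ≤ l z := by rw [hl] at hz; exact hz.2
    -- The tight set of the midpoint is the intersection, so minimality at `x` forces that of `z` to
    -- contain that of `x`.
    have hmid : (1 / 2 : ℝ) • x + (1 / 2 : ℝ) • z ∈ A := by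
      rw [hl]
      refine ⟨R.convex hxP (hAP hz) (by norm_num) (by norm_num) (by norm_num), fun y hy => ?_⟩
      simp only [map_add, map_smul, smul_eq_mul]
      linarith [hxmax y hy, hzmax y hy]
    have h1 := hmin _ hmid
    rw [R.zeros_combo hxP (hAP hz) (by norm_num) (by norm_num) (by norm_num)] at h1
    by_contra h
    exact h1 ((Finset.ssubset_iff_subset_ne).2 ⟨Finset.inter_subset_left, fun h' =>
      h (Finset.inter_eq_left.1 h')⟩)
  · have h0 : ∀ F ∈ R.zeros x, R.lin F (x - z) = 0 := fun F hF => by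
      have h1 := R.mem_zeros.1 hF
      have h2 := R.mem_zeros.1 (hz.2 hF)
      simp [h1, h2]
    -- The segment from `z` to `x` can be prolonged beyond `x` inside `P`. Since `l` is maximal at
    -- `x`, it cannot be smaller at `z`.
    have := R.eventually_add_mem hxP (R.sub_mem_dir hxP hz.1) fun F hF => (h0 F hF).ge
    obtain ⟨ε, ⟨hε, -⟩, hpos⟩ := (this.and self_mem_nhdsWithin).exists
    have h1 := hxmax _ hε
    simp only [map_add, map_smul, map_sub, smul_eq_mul] at h1
    have hpos : 0 < ε := hpos
    have h2 : l x ≤ l z := by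
      by_contra! h
      have := mul_pos hpos (sub_pos.2 h)
      linarith
    rw [hl]
    exact ⟨hz.1, fun y hy => (hxmax y hy).trans h2⟩

/-- The direction of the affine hull of a face. -/
def faceDir (σ : Finset 𝓕) : Submodule ℝ (ι → ℝ) := R.dir ⊓ ⨅ F ∈ σ, (R.lin F).ker

theorem mem_faceDir {σ : Finset 𝓕} {v : ι → ℝ} :
    v ∈ R.faceDir σ ↔ v ∈ R.dir ∧ ∀ F ∈ σ, R.lin F v = 0 := by
  simp [faceDir]

theorem faceDir_empty : R.faceDir ∅ = R.dir := by ext; simp [mem_faceDir]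

theorem vectorSpan_face {σ : Finset 𝓕} (h : R.Simplex σ) :
    vectorSpan ℝ (R.face σ) = R.faceDir σ := by
  refine le_antisymm ?_ fun v hv => ?_
  · rw [vectorSpan_def, Submodule.span_le]
    rintro _ ⟨x, hx, y, hy, rfl⟩
    refine R.mem_faceDir.2 ⟨R.sub_mem_dir hx.1 hy.1, fun F hF => ?_⟩
    have h1 := R.mem_zeros.1 (hx.2 hF)
    have h2 := R.mem_zeros.1 (hy.2 hF)
    simp [h1, h2]
  · rw [mem_faceDir] at hv
    have := R.eventually_add_mem (R.bary_mem h) hv.1 fun F hF =>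
      (hv.2 F (R.zeros_bary h ▸ hF)).ge
    obtain ⟨ε, ⟨hε, -⟩, hpos⟩ := (this.and self_mem_nhdsWithin).exists
    have hpos : 0 < ε := hpos
    have hm : R.bary σ + ε • v ∈ R.face σ := ⟨hε, fun F hF => by
      have h1 := R.mem_zeros.1 ((R.zeros_bary h).symm ▸ hF)
      simp [h1, hv.2 F hF]⟩
    have := (vectorSpan ℝ (R.face σ)).smul_mem ε⁻¹
      (vsub_mem_vectorSpan ℝ hm (R.bary_mem_face h))
    simpa [smul_smul, inv_mul_cancel₀ hpos.ne'] using this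

/-- Rank-nullity for the evaluation of the functionals in `σ` on `dir`, which is surjective by
independence. This is where simplicity enters: each tight inequality lowers the dimension by exactly
one. -/
theorem finrank_faceDir {σ : Finset 𝓕} (h : R.Simplex σ) :
    Module.finrank ℝ (R.faceDir σ) + σ.card = Module.finrank ℝ R.dir := by
  let f : R.dir →ₗ[ℝ] (σ → ℝ) := LinearMap.pi fun F => R.lin F.1 ∘ₗ R.dir.subtype
  have hf : ∀ v F, f v F = R.lin F.1 v.1 := fun v F => rfl
  have hsurj : LinearMap.range f = ⊤ := by
    rw [LinearMap.range_eq_top]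
    intro c
    obtain ⟨v, hv, h'⟩ := R.indep _ (R.bary_mem h) fun F => if hF : F ∈ σ then c ⟨F, hF⟩ else 0
    refine ⟨⟨v, hv⟩, funext fun F => ?_⟩
    rw [hf, h' F (R.mem_zeros.1 ((R.zeros_bary h).symm ▸ F.2)), dif_pos F.2]
  have hker : f.ker.map R.dir.subtype = R.faceDir σ := by
    ext v
    rw [mem_faceDir, Submodule.mem_map]
    constructor
    · rintro ⟨w, hw, rfl⟩
      exact ⟨w.2, fun F hF => congrFun (LinearMap.mem_ker.1 hw) ⟨F, hF⟩⟩
    · rintro ⟨hv, h0⟩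
      exact ⟨⟨v, hv⟩, LinearMap.mem_ker.2 (funext fun F => h0 F.1 F.2), rfl⟩
  have h1 := f.finrank_range_add_finrank_ker
  rw [hsurj, finrank_top, Module.finrank_fintype_fun_eq_card, Fintype.card_coe] at h1
  rw [← hker, Submodule.finrank_map_subtype_eq]
  omega

theorem polyDim_eq : polyDim P = Module.finrank ℝ R.dir := by
  have := R.vectorSpan_face R.simplex_empty
  rw [face_empty, faceDir_empty] at this
  rw [polyDim, this]

theorem polyDim_face {σ : Finset 𝓕} (h : R.Simplex σ) : polyDim (R.face σ) + σ.card = polyDim P := by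
  rw [polyDim, R.vectorSpan_face h, R.polyDim_eq, R.finrank_faceDir h]

/-- The facets of `P` correspond to the inequalities. -/
def facetEquiv : 𝓕 ≃ Facet P :=
  Equiv.ofBijective (fun F => ⟨R.face {F}, R.isExposed_face _,
      R.face_nonempty_iff.2 (R.simplex_singleton F), R.polyDim_face (R.simplex_singleton F)⟩) <| by
    constructor
    · intro F G h
      have h : R.face {F} = R.face {G} := congrArg Subtype.val h
      have := (R.face_subset_iff (R.simplex_singleton F)).1 h.subset
      exact (Finset.singleton_subset_singleton.1 this).symm
    · rintro ⟨A, hA, hne, hdim⟩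
      obtain ⟨σ, hσ, rfl⟩ := R.exists_eq_face hA hne
      have := R.polyDim_face hσ
      obtain ⟨F, rfl⟩ := Finset.card_eq_one.1 (show σ.card = 1 by omega)
      exact ⟨F, rfl⟩

theorem facetEquiv_val (F : 𝓕) : (R.facetEquiv F).1 = R.face {F} := rfl

theorem mem_facetEquiv {F : 𝓕} {x : ι → ℝ} (hx : x ∈ P) :
    x ∈ (R.facetEquiv F).1 ↔ F ∈ R.zeros x := by
  simp [facetEquiv_val, face, hx]

theorem mem_facet {F : Facet P} {x : ι → ℝ} (hx : x ∈ P) :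
    x ∈ F.1 ↔ R.facetEquiv.symm F ∈ R.zeros x := by
  rw [← R.mem_facetEquiv hx, Equiv.apply_symm_apply]

/-- Small moves in both directions `v` and `-v` stay in `P`, so extremality forces `v = 0`. -/
theorem faceDir_zeros_of_extreme {x : ι → ℝ} (hx : x ∈ P.extremePoints ℝ) :
    R.faceDir (R.zeros x) = ⊥ := by
  rw [eq_bot_iff]
  intro v hv
  rw [mem_faceDir] at hv
  rw [mem_extremePoints] at hx
  have h1 := R.eventually_add_mem hx.1 hv.1 fun F hF => (hv.2 F hF).ge
  have h2 := R.eventually_add_mem hx.1 (R.dir.neg_mem hv.1) fun F hF => by simp [hv.2 F hF]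
  obtain ⟨ε, ⟨⟨hε, -⟩, hε', -⟩, hpos⟩ := ((h1.and h2).and self_mem_nhdsWithin).exists
  have hpos : 0 < ε := hpos
  have := (hx.2 _ hε _ hε' ⟨1 / 2, 1 / 2, by norm_num, by norm_num, by norm_num, by module⟩).1
  have : ε • v = 0 := by simpa using this
  simpa using (smul_eq_zero.1 this).resolve_left hpos.ne'

include R in
theorem finite_extremePoints : (P.extremePoints ℝ).Finite := by
  refine Set.Finite.of_finite_image (Set.toFinite (R.zeros '' P.extremePoints ℝ)) ?_
  intro x hx y hy h
  have : x - y ∈ R.faceDir (R.zeros x) := R.mem_faceDir.2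
    ⟨R.sub_mem_dir (extremePoints_subset hx) (extremePoints_subset hy), fun F hF => by
      have h1 := R.mem_zeros.1 hF
      have h2 := R.mem_zeros.1 (h ▸ hF)
      simp [h1, h2]⟩
  rw [R.faceDir_zeros_of_extreme hx] at this
  exact sub_eq_zero.1 (by simpa using this)

theorem isSimplePolytope {n : ℕ} (hn : Module.finrank ℝ R.dir = n) : IsSimplePolytope n P where
  exists_finset := by
    have hfin := R.finite_extremePoints
    refine ⟨hfin.toFinset, ?_, ?_⟩
    · rw [Set.Finite.toFinset_nonempty]
      exact R.isCompact.extremePoints_nonempty ⟨_, R.base_mem⟩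
    -- Krein-Milman; no closure is needed because there are only finitely many extreme points.
    · rw [Set.Finite.coe_toFinset, ← (hfin.isCompact_convexHull (𝕜 := ℝ)).isClosed.closure_eq,
        closure_convexHull_extremePoints R.isCompact R.convex]
  dim_eq := R.polyDim_eq.trans hn
  simple v hv := by
    have hvP := extremePoints_subset hv
    have h1 := R.finrank_faceDir (R.simplex_zeros hvP)
    rw [R.faceDir_zeros_of_extreme hv, finrank_bot, zero_add, hn] at h1
    have h2 : {F : Facet P | v ∈ F.1} = R.facetEquiv '' (R.zeros v : Set 𝓕) := by
      ext F
      simp only [Set.mem_ofPred_eq, R.mem_facet hvP, Set.mem_image, Finset.mem_coe]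
      constructor
      · exact fun h => ⟨_, h, by simp⟩
      · rintro ⟨G, hG, rfl⟩
        simpa using hG
    rw [h2, Set.ncard_image_of_injective _ R.facetEquiv.injective, Set.ncard_coe_finset, h1]

/-! ### Combinatorial equivalence -/

/-- An element of a bounded order which is neither the least nor the greatest one and such that
only the greatest element is above it. -/
def IsProperCoatom {X : Type*} [PartialOrder X] (A : X) : Prop :=
  (∃ C, ¬ A ≤ C) ∧ (∃ C, ¬ C ≤ A) ∧ ∀ C, A ≤ C → C = A ∨ ∀ D, D ≤ C

theorem IsProperCoatom.map {X Y : Type*} [PartialOrder X] [PartialOrder Y] (f : X ≃o Y) {A : X}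
    (h : IsProperCoatom A) : IsProperCoatom (f A) := by
  obtain ⟨⟨C, hC⟩, ⟨D, hD⟩, h⟩ := h
  refine ⟨⟨f C, by simpa using hC⟩, ⟨f D, by simpa using hD⟩, fun E hE => ?_⟩
  rcases h (f.symm E) (f.le_symm_apply.2 hE) with h | h
  · exact Or.inl (by rw [← h, f.apply_symm_apply])
  · exact Or.inr fun G => f.symm.le_iff_le.1 (h _)

/-- A face given by tight inequalities, as an element of the face lattice. -/
def toFace (σ : Finset 𝓕) : Face P := ⟨R.face σ, R.isExposed_face σ⟩

theorem toFace_le_iff {σ τ : Finset 𝓕} (h : R.Simplex σ) : R.toFace σ ≤ R.toFace τ ↔ τ ⊆ σ :=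
  R.face_subset_iff h

theorem eq_toFace (A : Face P) : A.1 = ∅ ∨ ∃ σ, R.Simplex σ ∧ A = R.toFace σ := by
  rcases A.1.eq_empty_or_nonempty with h | h
  · exact Or.inl h
  · obtain ⟨σ, hσ, h⟩ := R.exists_eq_face A.2 h
    exact Or.inr ⟨σ, hσ, Subtype.ext h⟩

theorem le_toFace_empty (A : Face P) : A ≤ R.toFace ∅ := by
  change A.1 ⊆ R.face ∅
  rw [face_empty]
  exact A.2.subset

/-- An order-theoretic description of facets, hence preserved by isomorphisms of face lattices.
Excluding the least element matters when `P` is a point: the empty face is then a coatom but not a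
facet. -/
theorem isProperCoatom_iff (A : Face P) : IsProperCoatom A ↔ ∃ F, A = R.toFace {F} := by
  constructor
  · rintro ⟨⟨C, hC⟩, ⟨D, hD⟩, h⟩
    rcases R.eq_toFace A with hA | ⟨σ, hσ, rfl⟩
    · exact absurd (show A.1 ⊆ C.1 by simp [hA]) hC
    · obtain ⟨F, hF⟩ : σ.Nonempty := by
        rw [Finset.nonempty_iff_ne_empty]
        rintro rfl
        exact hD (R.le_toFace_empty D)
      refine ⟨F, ?_⟩
      rcases h _ ((R.toFace_le_iff hσ).2 (Finset.singleton_subset_iff.2 hF)) with h | h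
      · exact h.symm
      · have := (R.toFace_le_iff R.simplex_empty).1 (h (R.toFace ∅))
        simp at this
  · rintro ⟨F, rfl⟩
    refine ⟨⟨⟨∅, isExposed_empty⟩, fun h => ?_⟩, ⟨R.toFace ∅, fun h => ?_⟩, fun C hC => ?_⟩
    · have := h (R.bary_mem_face (R.simplex_singleton F))
      exact this
    · have := (R.toFace_le_iff R.simplex_empty).1 h
      simp at this
    · rcases R.eq_toFace C with h | ⟨σ, hσ, rfl⟩
      · have := hC (R.bary_mem_face (R.simplex_singleton F))
        rw [h] at this
        exact absurd this (Set.notMem_empty _)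
      · have := (R.toFace_le_iff (R.simplex_singleton F)).1 hC
        rcases Finset.subset_singleton_iff.1 this with rfl | rfl
        · exact Or.inr fun D => R.le_toFace_empty D
        · exact Or.inl rfl

/-- Facets meet when some nonempty face lies below all of them; nonemptiness is expressed as not
being least, so that the criterion uses only the order. -/
theorem simplex_iff_exists_face (σ : Finset 𝓕) :
    R.Simplex σ ↔ ∃ A : Face P, (∃ C, ¬ A ≤ C) ∧ ∀ F ∈ σ, A ≤ R.toFace {F} := by
  constructor
  · intro h
    refine ⟨R.toFace σ, ⟨⟨∅, isExposed_empty⟩, fun h' => ?_⟩, fun F hF => ?_⟩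
    · exact h' (R.bary_mem_face h)
    · exact (R.toFace_le_iff h).2 (Finset.singleton_subset_iff.2 hF)
  · rintro ⟨A, ⟨C, hC⟩, h⟩
    rcases R.eq_toFace A with hA | ⟨τ, hτ, rfl⟩
    · exact absurd (show A.1 ⊆ C.1 by simp [hA]) hC
    · exact hτ.mono fun F hF => Finset.singleton_subset_iff.1 ((R.toFace_le_iff hτ).1 (h F hF))

theorem exists_equiv_of_combEquiv {κ : Type} [Finite κ] {Q : Set (κ → ℝ)} {𝓖 : Type} [Fintype 𝓖]
    [DecidableEq 𝓖] (R' : SimpleHRep Q 𝓖) (h : CombEquiv P Q) :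
    ∃ e : 𝓕 ≃ 𝓖, ∀ σ, R.Simplex σ ↔ R'.Simplex (σ.map e.toEmbedding) := by
  obtain ⟨f⟩ := h
  have h1 : ∀ F, ∃ G, f (R.toFace {F}) = R'.toFace {G} := fun F =>
    (R'.isProperCoatom_iff _).1 (((R.isProperCoatom_iff _).2 ⟨F, rfl⟩).map f)
  choose e he using h1
  have hbij : Function.Bijective e := by
    constructor
    · intro F F' h
      have h2 : R.toFace {F} = R.toFace {F'} := f.injective (by rw [he, he, h])
      have := (R.toFace_le_iff (R.simplex_singleton F)).1 h2.le
      exact (Finset.singleton_subset_singleton.1 this).symm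
    · intro G
      obtain ⟨F, hF⟩ := (R.isProperCoatom_iff _).1
        (((R'.isProperCoatom_iff _).2 ⟨G, rfl⟩).map f.symm)
      refine ⟨F, ?_⟩
      have h2 : R'.toFace {G} = R'.toFace {e F} := by rw [← he, ← hF, f.apply_symm_apply]
      have := (R'.toFace_le_iff (R'.simplex_singleton G)).1 h2.le
      exact Finset.singleton_subset_singleton.1 this
  refine ⟨Equiv.ofBijective e hbij, fun σ => ?_⟩
  rw [simplex_iff_exists_face, simplex_iff_exists_face]
  constructor
  · rintro ⟨A, ⟨C, hC⟩, h⟩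
    refine ⟨f A, ⟨f C, by simpa using hC⟩, fun G hG => ?_⟩
    obtain ⟨F, hF, rfl⟩ := Finset.mem_map.1 hG
    exact (f.le_iff_le.2 (h F hF)).trans (he F).le
  · rintro ⟨A, ⟨C, hC⟩, h⟩
    refine ⟨f.symm A, ⟨f.symm C, by simpa using hC⟩, fun F hF => ?_⟩
    rw [f.symm_apply_le, he]
    exact h _ (Finset.mem_map_of_mem _ hF)

end SimpleHRep

namespace SimpleHRep

variable {ι : Type} [Finite ι] {P : Set (ι → ℝ)} {𝓕 : Type} [Fintype 𝓕] [DecidableEq 𝓕]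
  (R : SimpleHRep P 𝓕)

/-! ### The moment-angle manifold as a moment-angle complex -/

/-- The cubical coordinates of a point of a simple polytope. -/
def coord (p : P) : 𝓕 → unitInterval := (R.cubesHomeo.symm p).1

theorem continuous_coord : Continuous R.coord :=
  continuous_subtype_val.comp R.cubesHomeo.symm.continuous

theorem coord_injective : Function.Injective R.coord := fun _ _ h =>
  R.cubesHomeo.symm.injective (Subtype.ext h)

theorem coord_mem (p : P) : R.coord p ∈ R.cubes := (R.cubesHomeo.symm p).2

theorem exists_coord_eq {y : 𝓕 → unitInterval} (hy : y ∈ R.cubes) : ∃ p, R.coord p = y :=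
  ⟨R.cubesHomeo ⟨y, hy⟩, by simp [coord]⟩

theorem mem_zeros_iff_coord {p : P} {F : 𝓕} : F ∈ R.zeros p ↔ R.coord p F = 0 := by
  rw [← R.vanishing_cubesHomeo_symm p, mem_vanishing, coord]

theorem mem_facet_iff_coord {p : P} {F : Facet P} :
    (p : ι → ℝ) ∈ F.1 ↔ R.coord p (R.facetEquiv.symm F) = 0 := by
  rw [R.mem_facet p.2, mem_zeros_iff_coord]

theorem mem_nerveComplex_iff (σ : Finset (Facet P)) :
    (σ = ∅ ∨ σ ∈ (nerveComplex P).faces) ↔ R.Simplex (σ.map R.facetEquiv.symm.toEmbedding) := by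
  rcases σ.eq_empty_or_nonempty with rfl | hne
  · simp [R.simplex_empty]
  · have h1 : σ ∈ (nerveComplex P).faces ↔ (⋂ F ∈ σ, F.1).Nonempty :=
      ⟨fun h => h.2, fun h => ⟨hne, h⟩⟩
    simp only [hne.ne_empty, false_or, h1]
    constructor
    · rintro ⟨x, hx⟩
      simp only [Set.mem_iInter] at hx
      obtain ⟨F0, hF0⟩ := hne
      have hxP : x ∈ P := F0.2.1.subset (hx F0 hF0)
      refine ⟨x, hxP, fun G hG => ?_⟩
      obtain ⟨F, hF, rfl⟩ := Finset.mem_map.1 hG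
      exact (R.mem_facet hxP).1 (hx F hF)
    · rintro ⟨x, hxP, hx⟩
      refine ⟨x, ?_⟩
      simp only [Set.mem_iInter]
      exact fun F hF => (R.mem_facet hxP).2 (hx (Finset.mem_map_of_mem _ hF))

/-- Multiplication of cubical coordinates with elements of the circle. -/
def polar (t : Facet P → Circle) (y : 𝓕 → unitInterval) : Facet P → ℂ :=
  fun F => (t F : ℂ) * ((y (R.facetEquiv.symm F) : ℝ) : ℂ)

theorem norm_polar (t : Facet P → Circle) (y : 𝓕 → unitInterval) (F : Facet P) :
    ‖R.polar t y F‖ = y (R.facetEquiv.symm F) := by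
  rw [polar, norm_mul, Circle.norm_coe, one_mul, Complex.norm_real,
    Real.norm_of_nonneg (y (R.facetEquiv.symm F)).2.1]

theorem polar_mem (t : Facet P → Circle) {y : 𝓕 → unitInterval} (hy : y ∈ R.cubes) :
    R.polar t y ∈ momentAngleComplex (nerveComplex P) := by
  refine ⟨(support y).map R.facetEquiv.toEmbedding, ?_, fun F => ⟨fun _ => ?_, fun hF => ?_⟩⟩
  · rw [R.mem_nerveComplex_iff, Finset.map_map]
    refine Simplex.mono hy fun F hF => ?_
    obtain ⟨G, hG, rfl⟩ := Finset.mem_map.1 hF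
    simpa using hG
  · rw [mem_closedBall_zero_iff, norm_polar]
    exact (y _).2.2
  · rw [mem_sphere_zero_iff_norm, norm_polar]
    have : R.facetEquiv.symm F ∉ support y := fun h =>
      hF (Finset.mem_map.2 ⟨_, h, by simp⟩)
    rw [mem_support, not_not] at this
    rw [this]
    rfl

theorem exists_polar_eq {z : Facet P → ℂ} (hz : z ∈ momentAngleComplex (nerveComplex P)) :
    ∃ t, ∃ y ∈ R.cubes, R.polar t y = z := by
  obtain ⟨σ, hσ, h⟩ := hz
  have hle : ∀ F, ‖z F‖ ≤ 1 := fun F => by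
    by_cases hF : F ∈ σ
    · exact mem_closedBall_zero_iff.1 ((h F).1 hF)
    · exact (mem_sphere_zero_iff_norm.1 ((h F).2 hF)).le
  -- Polar decomposition; the phase is arbitrary, here `1`, where the coordinate vanishes.
  have ht : ∀ F, ∃ t : Circle, (t : ℂ) * (‖z F‖ : ℂ) = z F := fun F => by
    by_cases h0 : z F = 0
    · exact ⟨1, by simp [h0]⟩
    · have hn : (‖z F‖ : ℂ) ≠ 0 := by simpa using h0
      refine ⟨⟨z F / ‖z F‖, ?_⟩, div_mul_cancel₀ _ hn⟩
      rw [Submonoid.unitSphere, Submonoid.mem_mk]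
      simp [div_self (norm_ne_zero_iff.2 h0)]
  choose t ht using ht
  refine ⟨t, fun F => ⟨‖z (R.facetEquiv F)‖, norm_nonneg _, hle _⟩, ?_, funext fun F => ?_⟩
  · rw [R.mem_nerveComplex_iff] at hσ
    refine Simplex.mono hσ fun F hF => ?_
    rw [mem_support] at hF
    by_contra h'
    have h1 : R.facetEquiv F ∉ σ := fun h2 => h' (Finset.mem_map.2 ⟨_, h2, by simp⟩)
    exact hF (Subtype.ext (mem_sphere_zero_iff_norm.1 ((h _).2 h1)))
  · simp [polar, ht]

include R in
theorem compactSpace : CompactSpace P := isCompact_iff_compactSpace.1 R.isCompact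

/-- The map `[t, p] ↦ (t_F c(p)_F)_F` from the moment-angle manifold to the moment-angle complex,
where `c` is the cubical subdivision of the polytope. -/
def toComplex : MomentAngleManifold P → momentAngleComplex (nerveComplex P) :=
  Quotient.lift (fun x => ⟨R.polar x.1 (R.coord x.2), R.polar_mem x.1 (R.coord_mem x.2)⟩) (by
    rintro ⟨t, p⟩ ⟨s, q⟩ ⟨hpq, h⟩
    obtain rfl : p = q := hpq
    refine Subtype.ext (funext fun F => ?_)
    by_cases hF : (p : ι → ℝ) ∈ F.1
    · simp [polar, R.mem_facet_iff_coord.1 hF]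
    · simp only [polar]
      rw [show t F = s F from h F hF])

theorem continuous_polar : Continuous fun x : (Facet P → Circle) × (𝓕 → unitInterval) =>
    R.polar x.1 x.2 := by
  unfold polar
  refine continuous_pi fun F => ?_
  fun_prop

theorem continuous_toComplex : Continuous R.toComplex := by
  refine Continuous.quotient_lift (Continuous.subtype_mk ?_ _) _
  exact R.continuous_polar.comp (continuous_fst.prodMk (R.continuous_coord.comp continuous_snd))

/-- The moduli recover the cubical coordinates, hence `p`. The phase at `F` is recovered exactly
when the coordinate is nonzero, that is when `p` is not on `F`, which matches the defining
equivalence relation. -/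
theorem toComplex_bijective : Function.Bijective R.toComplex := by
  constructor
  · intro a b
    induction a using Quotient.inductionOn with | _ a => ?_
    induction b using Quotient.inductionOn with | _ b => ?_
    obtain ⟨t, p⟩ := a
    obtain ⟨s, q⟩ := b
    intro h
    have h : R.polar t (R.coord p) = R.polar s (R.coord q) := congrArg Subtype.val h
    have hpq : p = q := by
      refine R.coord_injective (funext fun F => Subtype.ext ?_)
      have h1 := R.norm_polar t (R.coord p) (R.facetEquiv F)
      rw [h, R.norm_polar] at h1
      simpa using h1.symm
    subst hpq
    refine Quotient.sound ⟨rfl, fun F hF => ?_⟩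
    have h1 := congrFun h F
    rw [R.mem_facet_iff_coord] at hF
    have h2 : ((R.coord p (R.facetEquiv.symm F) : ℝ) : ℂ) ≠ 0 := by
      rw [Complex.ofReal_ne_zero]
      exact fun h => hF (Subtype.ext h)
    exact Circle.ext (mul_right_cancel₀ h2 h1)
  · rintro ⟨z, hz⟩
    obtain ⟨t, y, hy, rfl⟩ := R.exists_polar_eq hz
    obtain ⟨p, rfl⟩ := R.exists_coord_eq hy
    exact ⟨Quotient.mk _ (t, p), rfl⟩

/-- The moment-angle manifold of a simple polytope is homeomorphic to the moment-angle complex of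
its nerve. -/
def momentAngleHomeo : MomentAngleManifold P ≃ₜ momentAngleComplex (nerveComplex P) :=
  haveI := R.compactSpace
  Continuous.homeoOfEquivCompactToT2 (f := Equiv.ofBijective _ R.toComplex_bijective)
    R.continuous_toComplex

end SimpleHRep

/-! ### Homotopy invariance of singular cohomology -/

universe u

theorem cohomologyMap_comp (𝕜 : Type u) [CommRing 𝕜] (k : ℕ) {X Y Z : Type} [TopologicalSpace X]
    [TopologicalSpace Y] [TopologicalSpace Z] (f : C(X, Y)) (g : C(Y, Z)) :
    cohomologyMap 𝕜 k (g.comp f) = cohomologyMap 𝕜 k g ≫ cohomologyMap 𝕜 k f := by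
  rw [cohomologyMap, cohomologyMap, cohomologyMap, ← Functor.map_comp, ← op_comp]
  rfl

/-- The opposite of a chain homotopy. -/
def homotopyOpposite {V : Type*} [Category V] [Preadditive V] {κ : Type*} {c : ComplexShape κ}
    {K L : HomologicalComplex V c} {f g : K ⟶ L} (h : Homotopy f g) :
    Homotopy ((HomologicalComplex.opFunctor V c).map f.op)
      ((HomologicalComplex.opFunctor V c).map g.op) where
  hom i j := (h.hom j i).op
  zero i j hij := by
    rw [h.zero j i hij, Limits.op_zero]
    rfl
  comm i := by
    have h1 : dNext (C := L.op) (D := K.op) i (fun i j => (h.hom j i).op) =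
        (prevD i h.hom).op := rfl
    have h2 : prevD (C := L.op) (D := K.op) i (fun i j => (h.hom j i).op) =
        (dNext i h.hom).op := rfl
    refine (congrArg Quiver.Hom.op (h.comm i)).trans ?_
    refine Eq.trans ?_ (congrArg₂ (· + ·) (congrArg₂ (· + ·) h1 h2) rfl).symm
    rw [op_add, op_add, add_comm (dNext i h.hom).op]
    rfl

/-- The chain homotopy induced on singular chains survives passage to the opposite category and then
the additive functor `Hom(-, 𝕜)`. -/
theorem cohomologyMap_eq_of_homotopy (𝕜 : Type u) [CommRing 𝕜] (k : ℕ) {X Y : Type}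
    [TopologicalSpace X] [TopologicalSpace Y] {f g : C(X, Y)} (H : f.Homotopy g) :
    cohomologyMap 𝕜 k f = cohomologyMap 𝕜 k g := by
  have H' : TopCat.Homotopy (TopCat.ofHom f) (TopCat.ofHom g) := H
  have h1 := homotopyOpposite (H'.singularChainComplexFunctorObjMap (ModuleCat.of 𝕜 𝕜))
  have h2 := (preadditiveYoneda.obj (ModuleCat.of 𝕜 𝕜)).mapHomotopy h1
  exact h2.homologyMap_eq k

namespace SimpleHRep

variable {ι κ μ : Type} [Finite ι] [Finite κ] [Finite μ] {P : Set (ι → ℝ)} {Q : Set (κ → ℝ)}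
  {S : Set (μ → ℝ)} {𝓕 𝓖 𝓗 : Type} [Fintype 𝓕] [DecidableEq 𝓕] [Fintype 𝓖] [DecidableEq 𝓖]
  [Fintype 𝓗] [DecidableEq 𝓗] {R : SimpleHRep P 𝓕} {R' : SimpleHRep Q 𝓖} {R'' : SimpleHRep S 𝓗}

/-! ### Nerves as links -/

/-- `e` identifies the nerve of `P` with a full subcomplex of the nerve of `Q` and with the link of
the simplex `Z` of the latter. -/
structure IsLink (R : SimpleHRep P 𝓕) (R' : SimpleHRep Q 𝓖) (e : 𝓕 ↪ 𝓖) (Z : Finset 𝓖) :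
    Prop where
  notMem : ∀ F, e F ∉ Z
  simplex_map : ∀ σ, R.Simplex σ ↔ R'.Simplex (σ.map e)
  simplex_union : ∀ σ, R.Simplex σ → R'.Simplex (σ.map e ∪ Z)
  mem_or_exists : ∀ G, R'.Simplex (insert G Z) → G ∈ Z ∨ ∃ F, e F = G

/-- `i` is the map of polytopes which in cubical coordinates is the inclusion of a link. -/
structure IsFaceMap (R : SimpleHRep P 𝓕) (R' : SimpleHRep Q 𝓖) (i : P → Q) (e : 𝓕 ↪ 𝓖)
    (Z : Finset 𝓖) : Prop extends IsLink R R' e Z where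
  coord_map : ∀ p F, R'.coord (i p) (e F) = R.coord p F
  coord_zero : ∀ p, ∀ G ∈ Z, R'.coord (i p) G = 0
  coord_one : ∀ p, ∀ G, G ∉ Z → (∀ F, e F ≠ G) → R'.coord (i p) G = 1

/-- The prescribed coordinates define a point of `Q` because their support lies in the join of a
simplex of `P` with `Z`, and the link condition makes that a simplex. -/
theorem IsLink.exists_isFaceMap {e : 𝓕 ↪ 𝓖} {Z : Finset 𝓖} (h : IsLink R R' e Z) :
    ∃ i, IsFaceMap R R' i e Z := by
  classical
  let y : P → 𝓖 → unitInterval := fun p G =>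
    if G ∈ Z then 0 else if hF : ∃ F, e F = G then R.coord p hF.choose else 1
  have hmap : ∀ p F, y p (e F) = R.coord p F := fun p F => by
    have hF : ∃ F', e F' = e F := ⟨F, rfl⟩
    simp only [y, h.notMem F, if_false, dif_pos hF]
    rw [e.injective hF.choose_spec]
  have hy : ∀ p, y p ∈ R'.cubes := fun p => by
    refine Simplex.mono (h.simplex_union _ (R.coord_mem p)) fun G hG => ?_
    rw [mem_support] at hG
    by_cases hZ : G ∈ Z
    · exact Finset.mem_union_right _ hZ
    · by_cases hF : ∃ F, e F = G
      · obtain ⟨F, rfl⟩ := hF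
        rw [hmap] at hG
        exact Finset.mem_union_left _ (Finset.mem_map_of_mem _ (mem_support.2 hG))
      · exact absurd (by simp only [y, hZ, if_false, dif_neg hF]) hG
  choose i hi using fun p => R'.exists_coord_eq (hy p)
  refine ⟨i, h, fun p F => by rw [hi, hmap], fun p G hG => ?_, fun p G hG hF => ?_⟩
  · rw [hi]; simp [y, hG]
  · rw [hi]
    have : ¬ ∃ F, e F = G := fun ⟨F, hF'⟩ => hF F hF'
    simp only [y, hG, if_false, dif_neg this]

theorem IsFaceMap.refl (R : SimpleHRep P 𝓕) : IsFaceMap R R id (Function.Embedding.refl 𝓕) ∅ where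
  notMem := by simp
  simplex_map := by simp
  simplex_union := by simp
  mem_or_exists := by simp
  coord_map _ _ := rfl
  coord_zero := by simp
  coord_one p G _ h := absurd rfl (h G)

/-- A link inside the link of `Z'` is the link of the union. Fullness of the second embedding is
what allows a simplex in its image to be pulled back. -/
theorem IsFaceMap.trans {i : P → Q} {e : 𝓕 ↪ 𝓖} {Z : Finset 𝓖} (h : IsFaceMap R R' i e Z)
    {i' : Q → S} {e' : 𝓖 ↪ 𝓗} {Z' : Finset 𝓗} (h' : IsFaceMap R' R'' i' e' Z') :
    IsFaceMap R R'' (i' ∘ i) (e.trans e') (Z.map e' ∪ Z') where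
  notMem F := by
    simp only [Finset.mem_union, Finset.mem_map, not_or, Function.Embedding.trans_apply]
    refine ⟨?_, h'.notMem _⟩
    rintro ⟨G, hG, hGF⟩
    exact h.notMem F (e'.injective hGF ▸ hG)
  simplex_map σ := by
    rw [h.simplex_map, h'.simplex_map, Finset.map_map]
  simplex_union σ hσ := by
    have := h'.simplex_union _ (h.simplex_union σ hσ)
    rwa [Finset.map_union, Finset.map_map, Finset.union_assoc] at this
  mem_or_exists G hG := by
    rcases h'.mem_or_exists G (hG.mono (Finset.insert_subset_insert _ Finset.subset_union_right))
      with h1 | ⟨F, rfl⟩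
    · exact Or.inl (Finset.mem_union_right _ h1)
    · have h2 : R'.Simplex (insert F Z) := by
        rw [h'.simplex_map, Finset.map_insert]
        exact hG.mono (Finset.insert_subset_insert _ Finset.subset_union_left)
      rcases h.mem_or_exists F h2 with h3 | ⟨F', rfl⟩
      · exact Or.inl (Finset.mem_union_left _ (Finset.mem_map_of_mem _ h3))
      · exact Or.inr ⟨F', rfl⟩
  coord_map p F := (h'.coord_map _ _).trans (h.coord_map _ _)
  coord_zero p G hG := by
    rcases Finset.mem_union.1 hG with hG | hG
    · obtain ⟨F, hF, rfl⟩ := Finset.mem_map.1 hG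
      exact (h'.coord_map _ _).trans (h.coord_zero _ _ hF)
    · exact h'.coord_zero _ _ hG
  coord_one p G hG hF := by
    rw [Finset.mem_union, not_or] at hG
    by_cases hG' : ∃ F, e' F = G
    · obtain ⟨F, rfl⟩ := hG'
      refine (h'.coord_map _ _).trans (h.coord_one _ _ (fun h => hG.1 (Finset.mem_map_of_mem _ h)) ?_)
      rintro F' rfl
      exact hF F' rfl
    · exact h'.coord_one _ _ hG.2 fun F h => hG' ⟨F, h⟩

namespace IsFaceMap

variable {i : P → Q} {e : 𝓕 ↪ 𝓖} {Z : Finset 𝓖} (h : IsFaceMap R R' i e Z)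

include h in
theorem mem_zeros_iff (p : P) (G : 𝓖) :
    G ∈ R'.zeros (i p) ↔ G ∈ Z ∨ ∃ F ∈ R.zeros p, e F = G := by
  rw [R'.mem_zeros_iff_coord]
  by_cases hZ : G ∈ Z
  · simp [hZ, h.coord_zero p G hZ]
  · by_cases hF : ∃ F, e F = G
    · obtain ⟨F, rfl⟩ := hF
      simp only [h.coord_map, hZ, false_or, ← R.mem_zeros_iff_coord]
      exact ⟨fun h => ⟨F, h, rfl⟩, fun ⟨F', h, h'⟩ => e.injective h' ▸ h⟩
    · rw [h.coord_one p G hZ fun F h => hF ⟨F, h⟩]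
      simp only [one_ne_zero, hZ, false_or, false_iff]
      exact fun ⟨F, _, h⟩ => hF ⟨F, h⟩

include h in
-- If `Z` is tight at `q`, the support of `q` contains `Z`, so every other facet in it is a vertex
-- of the link. The remaining coordinates of `q` are therefore `1`, and those along `e` give a point
-- of `P` by fullness.
theorem mem_range_iff (q : Q) : q ∈ Set.range i ↔ Z ⊆ R'.zeros q := by
  constructor
  · rintro ⟨p, rfl⟩ G hG
    exact (h.mem_zeros_iff p G).2 (Or.inl hG)
  · intro hZ
    have hG : ∀ G, G ∉ Z → (∀ F, e F ≠ G) → R'.coord q G = 1 := by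
      intro G hG hF
      by_contra h1
      have : R'.Simplex (insert G Z) := by
        refine Simplex.mono (R'.coord_mem q) (Finset.insert_subset (mem_support.2 h1) ?_)
        exact fun G hG => vanishing_subset_support _
          (mem_vanishing.2 (R'.mem_zeros_iff_coord.1 (hZ hG)))
      rcases h.mem_or_exists G this with h2 | ⟨F, h2⟩
      · exact hG h2
      · exact hF F h2
    obtain ⟨p, hp⟩ := R.exists_coord_eq (y := fun F => R'.coord q (e F)) (by
      refine (h.simplex_map _).2 (Simplex.mono (R'.coord_mem q) fun G hG => ?_)
      obtain ⟨F, hF, rfl⟩ := Finset.mem_map.1 hG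
      have h1 := mem_support.1 hF
      exact mem_support.2 h1)
    refine ⟨p, R'.coord_injective (funext fun G => ?_)⟩
    by_cases hZG : G ∈ Z
    · rw [h.coord_zero p G hZG, R'.mem_zeros_iff_coord.1 (hZ hZG)]
    · by_cases hF : ∃ F, e F = G
      · obtain ⟨F, rfl⟩ := hF
        rw [h.coord_map, hp]
      · have hF : ∀ F, e F ≠ G := fun F h => hF ⟨F, h⟩
        rw [hG G hZG hF, h.coord_one p G hZG hF]

include h in
theorem injective : Function.Injective i := fun p q hpq => by
  refine R.coord_injective (funext fun F => ?_)
  rw [← h.coord_map, ← h.coord_map, hpq]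

include h in
theorem isEmbedding : Topology.IsEmbedding i := by
  have := R.compactSpace
  have hc : Continuous fun p => R'.coord (i p) := by
    refine continuous_pi fun G => ?_
    by_cases hZ : G ∈ Z
    · simp only [h.coord_zero _ G hZ]
      exact continuous_const
    · by_cases hF : ∃ F, e F = G
      · obtain ⟨F, rfl⟩ := hF
        simp only [h.coord_map]
        exact (continuous_apply F).comp R.continuous_coord
      · simp only [h.coord_one _ G hZ fun F h => hF ⟨F, h⟩]
        exact continuous_const
  have hi : i = R'.cubesHomeo ∘ fun p => ⟨R'.coord (i p), R'.coord_mem _⟩ := by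
    funext p
    simp [coord]
  have hc' : Continuous i := by
    rw [hi]
    exact R'.cubesHomeo.continuous.comp (hc.subtype_mk _)
  exact (hc'.isClosedEmbedding h.injective).isEmbedding

include h in
theorem image_face (σ : Finset 𝓕) {A : Set P} (hA : Subtype.val '' A = R.face σ) :
    (fun p : P => (i p : κ → ℝ)) '' A = R'.face (σ.map e ∪ Z) := by
  have hA' : ∀ p : P, p ∈ A ↔ σ ⊆ R.zeros p := fun p => by
    have h1 : (p : ι → ℝ) ∈ Subtype.val '' A ↔ p ∈ A := by simp
    rw [← h1, hA]
    exact ⟨fun h => h.2, fun h => ⟨p.2, h⟩⟩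
  ext x
  constructor
  · rintro ⟨p, hp, rfl⟩
    refine ⟨(i p).2, fun G hG => (h.mem_zeros_iff p G).2 ?_⟩
    rcases Finset.mem_union.1 hG with hG | hG
    · obtain ⟨F, hF, rfl⟩ := Finset.mem_map.1 hG
      exact Or.inr ⟨F, (hA' p).1 hp hF, rfl⟩
    · exact Or.inl hG
  · rintro ⟨hx, hxz⟩
    obtain ⟨p, hp⟩ := (h.mem_range_iff ⟨x, hx⟩).2 (Finset.subset_union_right.trans hxz)
    have hpx : (i p : κ → ℝ) = x := congrArg Subtype.val hp
    refine ⟨p, (hA' p).2 fun F hF => ?_, hpx⟩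
    have h1 := hxz (Finset.mem_union_left _ (Finset.mem_map_of_mem e hF))
    rw [← hpx, h.mem_zeros_iff] at h1
    rcases h1 with h1 | ⟨F', h1, h2⟩
    · exact absurd h1 (h.notMem F)
    · exact e.injective h2 ▸ h1

include h in
theorem isExposed_iff (A : Set P) : IsExposed ℝ P (Subtype.val '' A) ↔
    IsExposed ℝ Q ((fun p : P => (i p : κ → ℝ)) '' A) := by
  rcases A.eq_empty_or_nonempty with rfl | hne
  · simp only [Set.image_empty]
    exact ⟨fun _ => isExposed_empty, fun _ => isExposed_empty⟩
  constructor
  · intro hA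
    obtain ⟨σ, -, hσ⟩ := R.exists_eq_face hA (hne.image _)
    rw [h.image_face σ hσ]
    exact R'.isExposed_face _
  · intro hA
    obtain ⟨τ, hτ, hA'⟩ := R'.exists_eq_face hA (hne.image _)
    have hmem : ∀ p, p ∈ A ↔ τ ⊆ R'.zeros (i p) := fun p => by
      have h1 : (i p : κ → ℝ) ∈ (fun p : P => (i p : κ → ℝ)) '' A ↔ p ∈ A := by
        constructor
        · rintro ⟨p', hp', hpp⟩
          exact h.injective (Subtype.ext hpp) ▸ hp'
        · exact fun hp => ⟨p, hp, rfl⟩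
      rw [← h1, hA']
      exact ⟨fun h => h.2, fun h => ⟨(i p).2, h⟩⟩
    let σ : Finset 𝓕 := Finset.univ.filter fun F => e F ∈ τ
    -- Nonemptiness of `A` is essential: `τ` is tight at some point of the image of `i`, so it
    -- consists of members of `Z` and images of facets of `P`.
    have hsub : ∀ G ∈ τ, G ∈ Z ∨ ∃ F, e F = G := by
      intro G hG
      obtain ⟨p, hp⟩ := hne
      rcases (h.mem_zeros_iff p G).1 ((hmem p).1 hp hG) with h1 | ⟨F, -, h1⟩
      · exact Or.inl h1
      · exact Or.inr ⟨F, h1⟩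
    have : Subtype.val '' A = R.face σ := by
      ext x
      have key : ∀ p, p ∈ A ↔ σ ⊆ R.zeros (p : P) := fun p => by
        rw [hmem]
        constructor
        · intro h1 F hF
          have h2 := (h.mem_zeros_iff p _).1 (h1 (Finset.mem_filter.1 hF).2)
          rcases h2 with h2 | ⟨F', h2, h3⟩
          · exact absurd h2 (h.notMem F)
          · exact e.injective h3 ▸ h2
        · intro h1 G hG
          rw [h.mem_zeros_iff]
          rcases hsub G hG with h2 | ⟨F, rfl⟩
          · exact Or.inl h2
          · exact Or.inr ⟨F, h1 (Finset.mem_filter.2 ⟨Finset.mem_univ _, hG⟩), rfl⟩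
      constructor
      · rintro ⟨p, hp, rfl⟩
        exact ⟨p.2, (key p).1 hp⟩
      · rintro ⟨hx, hxs⟩
        exact ⟨⟨x, hx⟩, (key _).2 hxs, rfl⟩
    rw [this]
    exact R.isExposed_face σ

/-- The face embedding given by the inclusion of a nontrivial link. -/
def toFaceEmbedding (hZ : Z.Nonempty) : FaceEmbedding P Q where
  toFun := i
  isEmbedding := h.isEmbedding
  isExposed_iff := h.isExposed_iff
  range_ne hr := by
    obtain ⟨G, hG⟩ := hZ
    -- An interior point of `Q` has no tight inequality, so it is outside the face given by the
    -- nonempty `Z`.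
    have h1 := (h.mem_range_iff ⟨R'.bary ∅, R'.bary_mem R'.simplex_empty⟩).1 (hr ▸ Set.mem_univ _) hG
    rw [R'.zeros_bary R'.simplex_empty] at h1
    exact absurd h1 (Finset.notMem_empty G)

/-- The inclusion of nerve complexes given by the inclusion of a link. -/
def toFullEmbedding : FullEmbedding (nerveComplex P) (nerveComplex Q) where
  toEmbedding := (R.facetEquiv.symm.toEmbedding.trans e).trans R'.facetEquiv.toEmbedding
  mem_iff σ := by
    rcases σ.eq_empty_or_nonempty with rfl | hne
    · simp only [Finset.map_empty]
      exact ⟨fun h => absurd h.1 (by simp), fun h => absurd h.1 (by simp)⟩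
    · have h1 := R.mem_nerveComplex_iff σ
      have h2 := R'.mem_nerveComplex_iff
        (σ.map ((R.facetEquiv.symm.toEmbedding.trans e).trans R'.facetEquiv.toEmbedding))
      simp only [hne.ne_empty, false_or] at h1
      simp only [Finset.map_eq_empty, hne.ne_empty, false_or] at h2
      rw [h1, h2, h.simplex_map, Finset.map_map, Finset.map_map]
      have : (((R.facetEquiv.symm.toEmbedding.trans e).trans R'.facetEquiv.toEmbedding).trans
          R'.facetEquiv.symm.toEmbedding) = R.facetEquiv.symm.toEmbedding.trans e := by
        ext; simp
      rw [this]

theorem toFullEmbedding_apply (F : Facet P) :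
    h.toFullEmbedding.toEmbedding F = R'.facetEquiv (e (R.facetEquiv.symm F)) := rfl

/-- A facet indexed by `Z` contains all of `i(P)`, so it cuts no facet; a relative interior point of
`G` then leaves `e` of `G` as the only candidate. Thus the torus map uses the same facet
correspondence as the nerve embedding. -/
theorem cuts_iff (hZ : Z.Nonempty) (G : Facet P) (H : Facet Q) :
    (h.toFaceEmbedding hZ).Cuts G H ↔ H = h.toFullEmbedding.toEmbedding G := by
  rw [toFullEmbedding_apply]
  constructor
  · intro hc
    have hc : ∀ p, R.facetEquiv.symm G ∈ R.zeros (p : P) ↔ R'.facetEquiv.symm H ∈ R'.zeros (i p) :=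
      fun p => by
        rw [← R.mem_facet p.2, ← R'.mem_facet (i p).2]
        exact hc p
    obtain ⟨x, hx, hx'⟩ := R.exists_zeros_eq (R.simplex_singleton (R.facetEquiv.symm G))
    have h1 := (hc ⟨x, hx⟩).1 (by simp [hx'])
    rcases (h.mem_zeros_iff _ _).1 h1 with h2 | ⟨F, h2, h3⟩
    · have h4 := (hc ⟨R.bary ∅, R.bary_mem R.simplex_empty⟩).2
        ((h.mem_zeros_iff _ _).2 (Or.inl h2))
      rw [R.zeros_bary R.simplex_empty] at h4
      exact absurd h4 (Finset.notMem_empty _)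
    · rw [hx', Finset.mem_singleton] at h2
      rw [← h2, h3, Equiv.apply_symm_apply]
  · rintro rfl p
    change _ ↔ (i p : κ → ℝ) ∈ (R'.facetEquiv (e (R.facetEquiv.symm G))).1
    rw [R.mem_facet p.2, R'.mem_facetEquiv (i p).2, h.mem_zeros_iff]
    constructor
    · exact fun hp => Or.inr ⟨_, hp, rfl⟩
    · rintro (h1 | ⟨F, h1, h2⟩)
      · exact absurd h1 (h.notMem _)
      · exact e.injective h2 ▸ h1

theorem torusMap_apply (hZ : Z.Nonempty) (t : Facet P → Circle) (G : Facet P) :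
    (h.toFaceEmbedding hZ).torusMap t (h.toFullEmbedding.toEmbedding G) = t G := by
  have hG : ∃ G', (h.toFaceEmbedding hZ).Cuts G' (h.toFullEmbedding.toEmbedding G) :=
    ⟨G, (h.cuts_iff hZ _ _).2 rfl⟩
  rw [FaceEmbedding.torusMap, dif_pos hG]
  congr 1
  exact (h.toFullEmbedding.toEmbedding.injective ((h.cuts_iff hZ _ _).1 hG.choose_spec)).symm

theorem torusMap_of_forall_ne (hZ : Z.Nonempty) (t : Facet P → Circle) {H : Facet Q}
    (hH : ∀ G, h.toFullEmbedding.toEmbedding G ≠ H) : (h.toFaceEmbedding hZ).torusMap t H = 1 := by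
  rw [FaceEmbedding.torusMap, dif_neg]
  rintro ⟨G, hG⟩
  exact hH G ((h.cuts_iff hZ _ _).1 hG).symm

theorem toComplex_momentAngleMap_mk (hZ : Z.Nonempty) (x : (Facet P → Circle) × P) (H : Facet Q) :
    (R'.toComplex ((h.toFaceEmbedding hZ).momentAngleMap (Quotient.mk _ x))).1 H =
      ((h.toFaceEmbedding hZ).torusMap x.1 H : ℂ) *
        ((R'.coord (i x.2) (R'.facetEquiv.symm H) : ℝ) : ℂ) := rfl

theorem polar_eq_zero (hZ : Z.Nonempty) (x : MomentAngleManifold P) {H : Facet Q}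
    (hH : R'.facetEquiv.symm H ∈ Z) :
    (R'.toComplex ((h.toFaceEmbedding hZ).momentAngleMap x)).1 H = 0 := by
  induction x using Quotient.inductionOn with | _ x => ?_
  refine (h.toComplex_momentAngleMap_mk hZ x H).trans ?_
  rw [h.coord_zero x.2 _ hH]
  simp

/-- The homotopy that moves the coordinates in `Z` from `0` to `1`. -/
def homotopyMap (hZ : Z.Nonempty) (x : unitInterval × MomentAngleManifold P) :
    momentAngleComplex (nerveComplex Q) :=
  ⟨fun H => if R'.facetEquiv.symm H ∈ Z then ((x.1 : ℝ) : ℂ)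
    else (R'.toComplex ((h.toFaceEmbedding hZ).momentAngleMap x.2)).1 H, by
    -- The coordinates in `Z` vanish here, so they are off the unit circle and `σ` must contain `Z`.
    -- Hence the same `σ` serves throughout the homotopy.
    obtain ⟨σ, hσ, hs⟩ := (R'.toComplex ((h.toFaceEmbedding hZ).momentAngleMap x.2)).2
    refine ⟨σ, hσ, fun H => ⟨fun hH => ?_, fun hH => ?_⟩⟩
    · dsimp only
      split_ifs with hHZ
      · rw [mem_closedBall_zero_iff, Complex.norm_real, Real.norm_of_nonneg x.1.2.1]
        exact x.1.2.2
      · exact (hs H).1 hH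
    · have h1 := (hs H).2 hH
      dsimp only
      rw [if_neg]
      · exact h1
      · intro h2
        rw [h.polar_eq_zero hZ x.2 h2] at h1
        simp at h1⟩

theorem continuous_homotopyMap (hZ : Z.Nonempty) : Continuous (h.homotopyMap hZ) := by
  refine Continuous.subtype_mk (continuous_pi fun H => ?_) _
  split_ifs
  · fun_prop
  · have := R'.continuous_toComplex
    have := (h.toFaceEmbedding hZ).momentAngleMap.continuous
    exact (continuous_apply H).comp (continuous_subtype_val.comp (by fun_prop))

/-- The square formed by the maps of moment-angle manifolds and moment-angle complexes commutes up
to homotopy. -/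
def homotopy (hZ : Z.Nonempty) :
    ((R'.momentAngleHomeo : C(_, _)).comp (h.toFaceEmbedding hZ).momentAngleMap).Homotopy
      (h.toFullEmbedding.momentAngleMap.comp (R.momentAngleHomeo : C(_, _))) where
  toFun := h.homotopyMap hZ
  continuous_toFun := h.continuous_homotopyMap hZ
  map_zero_left x := by
    refine Subtype.ext (funext fun H => ?_)
    change (if R'.facetEquiv.symm H ∈ Z then (((0 : unitInterval) : ℝ) : ℂ) else _) =
      (R'.toComplex ((h.toFaceEmbedding hZ).momentAngleMap x)).1 H
    split_ifs with hH
    · rw [h.polar_eq_zero hZ x hH]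
      simp
    · rfl
  map_one_left x := by
    refine Subtype.ext (funext fun H => ?_)
    change (if R'.facetEquiv.symm H ∈ Z then (((1 : unitInterval) : ℝ) : ℂ) else
      (R'.toComplex ((h.toFaceEmbedding hZ).momentAngleMap x)).1 H) =
      Function.extend h.toFullEmbedding.toEmbedding (R.toComplex x).1 (fun _ => 1) H
    induction x using Quotient.inductionOn with | _ x => ?_
    by_cases hG : ∃ G, h.toFullEmbedding.toEmbedding G = H
    · obtain ⟨G, rfl⟩ := hG
      rw [h.toFullEmbedding.toEmbedding.injective.extend_apply, if_neg]
      · change ((h.toFaceEmbedding hZ).torusMap x.1 _ : ℂ) * ((R'.coord (i x.2) _ : ℝ) : ℂ) =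
          (x.1 G : ℂ) * ((R.coord x.2 (R.facetEquiv.symm G) : ℝ) : ℂ)
        rw [h.torusMap_apply, toFullEmbedding_apply, Equiv.symm_apply_apply, h.coord_map]
      · rw [toFullEmbedding_apply, Equiv.symm_apply_apply]
        exact h.notMem _
    · rw [Function.extend_apply' _ _ _ hG]
      split_ifs with hH
      · simp
      · refine (h.toComplex_momentAngleMap_mk hZ x H).trans ?_
        rw [h.torusMap_of_forall_ne hZ _ fun G hG' => hG ⟨G, hG'⟩, h.coord_one _ _ hH]
        · simp
        · intro F hF
          refine hG ⟨R.facetEquiv F, ?_⟩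
          rw [toFullEmbedding_apply, Equiv.symm_apply_apply, hF, Equiv.apply_symm_apply]

end IsFaceMap

/-! ### Geometric direct families -/

universe w

/-- A sequence of simple polytopes in which each nerve is the link of a simplex in the next one, and
also a full subcomplex, is a geometric direct family. -/
theorem isGeometricDirectFamily (𝕜 : Type w) [CommRing 𝕜] {ι : ℕ → Type} [∀ n, Finite (ι n)]
    {P : ∀ n, Set (ι n → ℝ)} {𝓕 : ℕ → Type} [∀ n, Fintype (𝓕 n)] [∀ n, DecidableEq (𝓕 n)]
    (R : ∀ n, SimpleHRep (P n) (𝓕 n)) (hdim : ∀ n, Module.finrank ℝ (R n).dir = n)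
    (hlink : ∀ n, ∃ (e : 𝓕 n ↪ 𝓕 (n + 1)) (Z : Finset (𝓕 (n + 1))), Z.Nonempty ∧
      IsLink (R n) (R (n + 1)) e Z) : IsGeometricDirectFamily 𝕜 P := by
  choose e Z hZ hl using hlink
  choose i hi using fun n => (hl n).exists_isFaceMap
  -- All embeddings are composites of the consecutive ones, which makes both systems strictly
  -- compatible.
  let I : ∀ r n : ℕ, r ≤ n → P r → P n := fun r n hrn =>
    Nat.leRecOn (C := fun n => P r → P n) hrn (fun {k} f => i k ∘ f) id
  let E : ∀ r n : ℕ, r ≤ n → (𝓕 r ↪ 𝓕 n) := fun r n hrn =>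
    Nat.leRecOn (C := fun n => 𝓕 r ↪ 𝓕 n) hrn (fun {k} f => f.trans (e k)) (.refl _)
  have I_self : ∀ r, I r r le_rfl = id := fun r => Nat.leRecOn_self _
  have E_self : ∀ r, E r r le_rfl = .refl _ := fun r => Nat.leRecOn_self _
  have I_succ : ∀ r n (h : r ≤ n), I r (n + 1) (h.trans n.le_succ) = i n ∘ I r n h :=
    fun r n h => Nat.leRecOn_succ h _
  have E_succ : ∀ r n (h : r ≤ n), E r (n + 1) (h.trans n.le_succ) = (E r n h).trans (e n) :=
    fun r n h => Nat.leRecOn_succ h _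
  -- The simplex `W` collects the images of the successive `Z`; it is empty only for `r = n`, where
  -- the map is the identity.
  have hI : ∀ r n (h : r ≤ n), ∃ W, (r < n → W.Nonempty) ∧
      IsFaceMap (R r) (R n) (I r n h) (E r n h) W := by
    intro r n h
    induction n, h using Nat.le_induction with
    | base =>
      refine ⟨∅, fun h => absurd h (lt_irrefl r), ?_⟩
      rw [I_self, E_self]
      exact IsFaceMap.refl _
    | succ n h ih =>
      obtain ⟨W, -, hW⟩ := ih
      refine ⟨W.map (e n) ∪ Z n, fun _ => (hZ n).mono Finset.subset_union_right, ?_⟩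
      rw [I_succ, E_succ]
      exact hW.trans (hi n)
  choose W hW hF using hI
  refine ⟨fun n => (R n).isSimplePolytope (hdim n),
    fun r n hrn => (hF r n hrn.le).toFaceEmbedding (hW r n hrn.le hrn),
    fun r n hrn => (hF r n hrn.le).toFullEmbedding, fun n => (R n).momentAngleHomeo, ?_, ?_, ?_⟩
  · intro q r n hqr hrn p
    change I r n hrn.le (I q r hqr.le p) = I q n (hqr.trans hrn).le p
    have : ∀ n (hrn : r ≤ n), I r n hrn (I q r hqr.le p) = I q n (hqr.le.trans hrn) p := by
      intro n hrn
      induction n, hrn using Nat.le_induction with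
      | base => rw [I_self]; rfl
      | succ n h ih => rw [I_succ r n h, I_succ q n (hqr.le.trans h), Function.comp, ih]; rfl
    exact this n hrn.le
  · intro q r n hqr hrn F
    simp only [IsFaceMap.toFullEmbedding_apply, Equiv.symm_apply_apply]
    congr 1
    have : ∀ F n (hrn : r ≤ n), E r n hrn (E q r hqr.le F) = E q n (hqr.le.trans hrn) F := by
      intro F n hrn
      induction n, hrn using Nat.le_induction with
      | base => rw [E_self]; rfl
      | succ n h ih =>
        rw [E_succ r n h, E_succ q n (hqr.le.trans h), Function.Embedding.trans_apply, ih]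
        rfl
    exact this _ n hrn.le
  · intro r n hrn k
    rw [← cohomologyMap_comp, ← cohomologyMap_comp]
    exact (cohomologyMap_eq_of_homotopy 𝕜 k ((hF r n hrn.le).homotopy (hW r n hrn.le hrn))).symm

end SimpleHRep

/-! ### Nestohedra as simple polytopes -/

section Nestohedron

variable {α : Type} [Fintype α] [DecidableEq α] [Nonempty α]

/-- Connected building sets on a subset `S` of `α`. -/
structure IsBuildingOn (B : Finset (Finset α)) (S : Finset α) : Prop where
  empty_notMem : ∅ ∉ B
  subset : ∀ T ∈ B, T ⊆ S
  singleton_mem : ∀ a ∈ S, {a} ∈ B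
  union_mem : ∀ T ∈ B, ∀ T' ∈ B, (T ∩ T').Nonempty → T ∪ T' ∈ B
  self_mem : S ∈ B

theorem IsConnectedBuildingSet.isBuildingOn {B : Finset (Finset α)} (h : IsConnectedBuildingSet B) :
    IsBuildingOn B Finset.univ :=
  ⟨h.empty_notMem, fun _ _ => Finset.subset_univ _, fun a _ => h.singleton_mem a, h.union_mem,
    h.univ_mem⟩

theorem IsBuildingOn.restrictTo {B : Finset (Finset α)} {S : Finset α} (h : IsBuildingOn B S)
    {S' : Finset α} (hS' : S' ∈ B) : IsBuildingOn (restrictTo B S') S' where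
  empty_notMem h' := h.empty_notMem (Finset.mem_filter.1 h').1
  subset T hT := (Finset.mem_filter.1 hT).2
  singleton_mem a ha := Finset.mem_filter.2 ⟨h.singleton_mem a (h.subset _ hS' ha), by simpa⟩
  union_mem T hT T' hT' hne := by
    simp only [ToricFamilies.restrictTo, Finset.mem_filter] at *
    exact ⟨h.union_mem _ hT.1 _ hT'.1 hne, Finset.union_subset hT.2 hT'.2⟩
  self_mem := Finset.mem_filter.2 ⟨hS', subset_rfl⟩

theorem IsBuildingOn.nonempty {B : Finset (Finset α)} {S : Finset α} (h : IsBuildingOn B S)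
    {T : Finset α} (hT : T ∈ B) : T.Nonempty :=
  Finset.nonempty_iff_ne_empty.2 fun h' => h.empty_notMem (h' ▸ hT)

/-- The number of elements of `B` contained in `U`. -/
def numSubsets (B : Finset (Finset α)) (U : Finset α) : ℕ := (B.filter (· ⊆ U)).card

theorem convex_nestohedron (B : Finset (Finset α)) : Convex ℝ (nestohedron B) :=
  convex_sum _ fun _ _ => convex_convexHull ℝ _

theorem isCompact_nestohedron (B : Finset (Finset α)) : IsCompact (nestohedron B) := by
  unfold nestohedron
  induction B using Finset.induction_on with
  | empty => simp
  | insert T B hT ih =>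
    rw [Finset.sum_insert hT]
    exact IsCompact.add ((Set.toFinite _).isCompact_convexHull (𝕜 := ℝ)) ih

/-- The point of a nestohedron given by the choice of a vertex of each summand. -/
def choicePoint (B : Finset (Finset α)) (ch : Finset α → α) : α → ℝ :=
  ∑ T ∈ B, Pi.single (ch T) 1

theorem choicePoint_mem {B : Finset (Finset α)} {ch : Finset α → α} (h : ∀ T ∈ B, ch T ∈ T) :
    choicePoint B ch ∈ nestohedron B := by
  refine Set.finsetSum_mem_finsetSum _ _ _ fun T hT => ?_
  exact subset_convexHull ℝ _ ⟨_, h T hT, rfl⟩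

theorem sum_single (U : Finset α) (a : α) (r : ℝ) :
    ∑ b ∈ U, (Pi.single a r : α → ℝ) b = if a ∈ U then r else 0 := by
  simp [Pi.single_apply]

theorem sum_choicePoint (B : Finset (Finset α)) (ch : Finset α → α) (U : Finset α) :
    ∑ a ∈ U, choicePoint B ch a = (B.filter fun T => ch T ∈ U).card := by
  simp only [choicePoint, Finset.sum_apply]
  rw [Finset.sum_comm]
  simp only [sum_single]
  rw [Finset.sum_boole]

theorem exists_decomposition {B : Finset (Finset α)} {x : α → ℝ} (hx : x ∈ nestohedron B) :
    ∃ f : Finset α → α → ℝ, (∀ T ∈ B, (∀ a, 0 ≤ f T a) ∧ (∀ a, a ∉ T → f T a = 0) ∧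
      ∑ a ∈ T, f T a = 1) ∧ ∑ T ∈ B, f T = x := by
  obtain ⟨f, hf, hfx⟩ := (Set.mem_finsetSum _ _ _).1 hx
  refine ⟨f, fun T hT => ?_, hfx⟩
  have hconv : Convex ℝ {v : α → ℝ | (∀ a, 0 ≤ v a) ∧ (∀ a, a ∉ T → v a = 0) ∧ ∑ a ∈ T, v a = 1} := by
    rintro v ⟨h1, h2, h3⟩ w ⟨h1', h2', h3'⟩ a b ha hb hab
    refine ⟨fun c => ?_, fun c hc => ?_, ?_⟩
    · exact add_nonneg (mul_nonneg ha (h1 c)) (mul_nonneg hb (h1' c))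
    · simp [h2 c hc, h2' c hc]
    · simp [Finset.sum_add_distrib, ← Finset.mul_sum, h3, h3', hab]
  refine convexHull_min ?_ hconv (hf hT)
  rintro _ ⟨a, ha, rfl⟩
  have ha : a ∈ T := ha
  refine ⟨fun b => ?_, fun b hb => ?_, ?_⟩
  · by_cases h : b = a <;> simp [h]
  · have : b ≠ a := fun h => hb (h ▸ ha)
    simp [this]
  · simp only [sum_single, if_pos ha]

/-- Points of a nestohedron satisfy the defining inequalities, and a choice of elements in the
supports of the summands detects the tight ones. -/
theorem nestohedron_spec {B : Finset (Finset α)} {x : α → ℝ} (hx : x ∈ nestohedron B) :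
    (∀ U, (numSubsets B U : ℝ) ≤ ∑ a ∈ U, x a) ∧ ∃ ch : Finset α → α, (∀ T ∈ B, ch T ∈ T) ∧
      ∀ U, ∑ a ∈ U, x a = numSubsets B U → ∀ T ∈ B, ch T ∈ U → T ⊆ U := by
  obtain ⟨f, hf, rfl⟩ := exists_decomposition hx
  have hsum : ∀ U, ∑ a ∈ U, (∑ T ∈ B, f T) a = ∑ T ∈ B, ∑ a ∈ U, f T a := fun U => by
    simp only [Finset.sum_apply]
    exact Finset.sum_comm
  have hnum : ∀ U, (numSubsets B U : ℝ) = ∑ T ∈ B, if T ⊆ U then 1 else 0 := fun U => by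
    rw [Finset.sum_boole, numSubsets]
  have hle : ∀ U, ∀ T ∈ B, (if T ⊆ U then (1 : ℝ) else 0) ≤ ∑ a ∈ U, f T a := by
    intro U T hT
    split_ifs with h
    · rw [← (hf T hT).2.2]
      exact Finset.sum_le_sum_of_subset_of_nonneg h fun a _ _ => (hf T hT).1 a
    · exact Finset.sum_nonneg fun a _ => (hf T hT).1 a
  have hpos : ∀ T ∈ B, ∃ a ∈ T, f T a ≠ 0 := by
    intro T hT
    by_contra! h
    have := (hf T hT).2.2
    rw [Finset.sum_eq_zero h] at this
    exact zero_ne_one this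
  refine ⟨fun U => ?_, ?_⟩
  · rw [hsum, hnum]
    exact Finset.sum_le_sum (hle U)
  -- Choose `ch T` in the support of the summand `f T`. If `U` is tight and `T ⊄ U`, equality in
  -- each summand forces `f T` to have no mass on `U`.
  · choose! ch hch using hpos
    refine ⟨ch, fun T hT => (hch T hT).1, fun U hU T hT hTU => ?_⟩
    by_contra hsub
    rw [hsum, hnum] at hU
    have := (Finset.sum_eq_sum_iff_of_le (hle U)).1 hU.symm T hT
    rw [if_neg hsub] at this
    have := (Finset.sum_eq_zero_iff_of_nonneg fun a _ => (hf T hT).1 a).1 this.symm _ hTU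
    exact (hch T hT).2 this

/-- The inequalities for elements of a building set imply those for all subsets. -/
theorem numSubsets_le {B : Finset (Finset α)} {S : Finset α} (hB : IsBuildingOn B S) {x : α → ℝ}
    (hx : ∀ T ∈ B, (numSubsets B T : ℝ) ≤ ∑ a ∈ T, x a) (U : Finset α) (hU : U ⊆ S) :
    (numSubsets B U : ℝ) ≤ ∑ a ∈ U, x a := by
  induction U using Finset.strongInduction with | H U ih => ?_
  rcases U.eq_empty_or_nonempty with rfl | ⟨a, ha⟩
  · have : numSubsets B ∅ = 0 := by
      rw [numSubsets, Finset.card_eq_zero, Finset.filter_eq_empty_iff]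
      intro T hT h
      exact hB.empty_notMem (Finset.subset_empty.1 h ▸ hT)
    simp [this]
  -- By closure under unions, a member inside `U` is either contained in the maximal member `T` or
  -- disjoint from it, so the count splits over `T` and `U \ T`.
  · obtain ⟨T, hT, hmax⟩ := (B.filter (· ⊆ U)).exists_maximal
      ⟨{a}, Finset.mem_filter.2 ⟨hB.singleton_mem a (hU ha), by simpa⟩⟩
    obtain ⟨hTB, hTU⟩ := Finset.mem_filter.1 hT
    have hTne := hB.nonempty hTB
    have hsplit : B.filter (· ⊆ U) = B.filter (· ⊆ T) ∪ B.filter (· ⊆ U \ T) := by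
      ext T'
      simp only [Finset.mem_union, Finset.mem_filter, ← and_or_left]
      refine and_congr_right fun hT' => ⟨fun h => ?_, ?_⟩
      · by_cases hne : (T ∩ T').Nonempty
        · left
          have h1 := hmax (Finset.mem_filter.2 ⟨hB.union_mem _ hTB _ hT' hne,
            Finset.union_subset hTU h⟩) Finset.subset_union_left
          exact Finset.subset_union_right.trans h1
        · right
          rw [Finset.not_nonempty_iff_eq_empty, ← Finset.disjoint_iff_inter_eq_empty] at hne
          exact Finset.subset_sdiff.2 ⟨h, hne.symm⟩
      · rintro (h | h)
        · exact h.trans hTU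
        · exact h.trans Finset.sdiff_subset
    have hlt : U \ T ⊂ U := Finset.sdiff_ssubset hTU hTne
    have h1 := ih _ hlt (hlt.subset.trans hU)
    have h2 := hx T hTB
    have h3 : numSubsets B U ≤ numSubsets B T + numSubsets B (U \ T) := by
      rw [numSubsets, hsplit]
      exact Finset.card_union_le _ _
    have h4 : (numSubsets B U : ℝ) ≤ numSubsets B T + numSubsets B (U \ T) := by exact_mod_cast h3
    have h5 := Finset.sum_sdiff hTU (f := x)
    linarith

/-- A lower bound for linear functionals with nonnegative coefficients. -/
theorem sum_le_sum_mul {B : Finset (Finset α)} {x : α → ℝ} (U : Finset α) (c : α → ℝ)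
    (w : Finset α → ℝ) (hx : ∀ V, V ⊆ U → (numSubsets B V : ℝ) ≤ ∑ a ∈ V, x a)
    (hc : ∀ a ∈ U, 0 ≤ c a) (hw : ∀ T ∈ B, ∀ a ∈ T, w T ≤ c a) (hB : ∅ ∉ B) :
    ∑ T ∈ B with T ⊆ U, w T ≤ ∑ a ∈ U, c a * x a := by
  induction hn : U.card generalizing U c w with
  | zero =>
    rw [Finset.card_eq_zero] at hn
    subst hn
    rw [Finset.sum_eq_zero, Finset.sum_empty]
    intro T hT
    obtain ⟨hT, h⟩ := Finset.mem_filter.1 hT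
    exact absurd (Finset.subset_empty.1 h ▸ hT) hB
  | succ n ih =>
    -- Abel summation: subtracting the least coefficient `c a` kills the term at `a`, and the
    -- subtracted part is controlled by the inequality for `U` itself.
    obtain ⟨a, ha, hmin⟩ := U.exists_min_image c (Finset.card_pos.1 (by omega))
    have h1 := ih (U.erase a) (fun b => c b - c a) (fun T => w T - c a)
      (fun V hV => hx V (hV.trans (Finset.erase_subset _ _)))
      (fun b hb => sub_nonneg.2 (hmin b (Finset.mem_of_mem_erase hb)))
      (fun T hT b hb => sub_le_sub_right (hw T hT b hb) _)
      (by rw [Finset.card_erase_of_mem ha, hn]; rfl)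
    have h2 : ∑ b ∈ U.erase a, (c b - c a) * x b = ∑ b ∈ U, (c b - c a) * x b := by
      rw [← Finset.add_sum_erase _ _ ha]
      simp
    have h3 : ∑ b ∈ U, (c b - c a) * x b = ∑ b ∈ U, c b * x b - c a * ∑ b ∈ U, x b := by
      rw [Finset.mul_sum, ← Finset.sum_sub_distrib]
      exact Finset.sum_congr rfl fun b _ => sub_mul _ _ _
    -- The members lost by erasing `a` contain `a`, so their terms are nonpositive.
    have h4 : ∑ T ∈ B with T ⊆ U, (w T - c a) ≤ ∑ T ∈ B with T ⊆ U.erase a, (w T - c a) := by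
      have hsub : B.filter (· ⊆ U.erase a) ⊆ B.filter (· ⊆ U) := fun T hT => by
        simp only [Finset.mem_filter] at hT ⊢
        exact ⟨hT.1, hT.2.trans (Finset.erase_subset _ _)⟩
      rw [← Finset.sum_sdiff hsub]
      refine add_le_of_nonpos_left (Finset.sum_nonpos fun T hT => ?_)
      simp only [Finset.mem_sdiff, Finset.mem_filter, not_and] at hT
      have haT : a ∈ T := by
        by_contra haT
        exact hT.2 hT.1.1 (Finset.subset_erase.2 ⟨hT.1.2, haT⟩)
      linarith [hw T hT.1.1 a haT]
    have h5 : ∑ T ∈ B with T ⊆ U, (w T - c a) =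
        ∑ T ∈ B with T ⊆ U, w T - numSubsets B U * c a := by
      rw [Finset.sum_sub_distrib, Finset.sum_const, nsmul_eq_mul, numSubsets]
    have h6 := mul_le_mul_of_nonneg_left (hx U subset_rfl) (hc a ha)
    linarith

/-- For sufficiency, separate `x` from the nestohedron by a functional `l`. Choosing in each `T` an
element where `l` is least gives a point of the nestohedron, and `sum_le_sum_mul` shows that `l x`
is at least its value. -/
theorem mem_nestohedron_iff {B : Finset (Finset α)} {S : Finset α} (hB : IsBuildingOn B S)
    {x : α → ℝ} : x ∈ nestohedron B ↔ (∀ a, a ∉ S → x a = 0) ∧ ∑ a ∈ S, x a = numSubsets B S ∧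
      ∀ T ∈ B, (numSubsets B T : ℝ) ≤ ∑ a ∈ T, x a := by
  constructor
  · intro hx
    refine ⟨fun a ha => ?_, ?_, fun T _ => (nestohedron_spec hx).1 T⟩
    · obtain ⟨f, hf, rfl⟩ := exists_decomposition hx
      rw [Finset.sum_apply]
      exact Finset.sum_eq_zero fun T hT => (hf T hT).2.1 a fun h => ha (hB.subset T hT h)
    · obtain ⟨f, hf, rfl⟩ := exists_decomposition hx
      simp only [Finset.sum_apply]
      rw [Finset.sum_comm, numSubsets, Finset.filter_true_of_mem hB.subset, Finset.card_eq_sum_ones,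
        Nat.cast_sum]
      refine Finset.sum_congr rfl fun T hT => ?_
      rw [← Finset.sum_subset (hB.subset T hT) fun a _ h => (hf T hT).2.1 a h, (hf T hT).2.2]
      simp
  · rintro ⟨h0, hS, hx⟩
    by_contra hxP
    obtain ⟨l, u, hlx, hl⟩ := geometric_hahn_banach_point_closed (convex_nestohedron B)
      (isCompact_nestohedron B).isClosed hxP
    have hne : ∀ T ∈ B, ∃ a ∈ T, ∀ b ∈ T, l (Pi.single a 1) ≤ l (Pi.single b 1) := fun T hT =>
      T.exists_min_image (fun a => l (Pi.single a 1)) (hB.nonempty hT)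
    choose! ch hch hmin using hne
    have h1 := hl _ (choicePoint_mem hch)
    obtain ⟨a0, ha0⟩ := hB.nonempty hB.self_mem
    -- Subtracting the constant `m` makes the coefficients nonnegative; the effect cancels because
    -- the coordinate sum over `S` is the number of members.
    obtain ⟨m, hm⟩ : ∃ m, ∀ a, m ≤ l (Pi.single a 1) :=
      ⟨_, fun a => ciInf_le (Set.finite_range _).bddBelow a⟩
    have h2 := sum_le_sum_mul S (fun a => l (Pi.single a 1) - m)
      (fun T => l (Pi.single (ch T) 1) - m) (fun V hV => numSubsets_le hB hx V hV)
      (fun a _ => sub_nonneg.2 (hm a)) (fun T hT a ha => sub_le_sub_right (hmin T hT a ha) _)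
      hB.empty_notMem
    rw [Finset.filter_true_of_mem hB.subset, Finset.sum_sub_distrib, Finset.sum_const,
      nsmul_eq_mul] at h2
    simp only [sub_mul, Finset.sum_sub_distrib, ← Finset.mul_sum, hS] at h2
    rw [numSubsets, Finset.filter_true_of_mem hB.subset] at h2
    have h3 : l x = ∑ a ∈ S, l (Pi.single a 1) * x a := by
      have : x = ∑ a ∈ S, x a • (Pi.single a 1 : α → ℝ) := by
        funext b
        simp only [Finset.sum_apply, Pi.smul_apply, Pi.single_apply, smul_eq_mul, mul_ite, mul_one,
          mul_zero, Finset.sum_ite_eq]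
        split_ifs with hb
        · rfl
        · exact h0 b hb
      conv_lhs => rw [this]
      rw [map_sum]
      exact Finset.sum_congr rfl fun a _ => by rw [map_smul, smul_eq_mul, mul_comm]
    have h4 : l (choicePoint B ch) = ∑ T ∈ B, l (Pi.single (ch T) 1) := map_sum _ _ _
    linarith

/-- The index set of the facets of a nestohedron. -/
abbrev ProperMember (B : Finset (Finset α)) (S : Finset α) : Type :=
  {T : Finset α // T ∈ B ∧ T ≠ S}

/-- `ch` chooses an element of each member of `B` which is not in `U` unless the member is contained
in `U`, for all `U` in a given family. -/
def IsChoice (B : Finset (Finset α)) (ch : Finset α → α) (τ : Set (Finset α)) : Prop :=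
  (∀ T ∈ B, ch T ∈ T) ∧ ∀ U ∈ τ, ∀ T ∈ B, ch T ∈ U → T ⊆ U

theorem IsChoice.sum_eq {B : Finset (Finset α)} {ch : Finset α → α} {τ : Set (Finset α)}
    (h : IsChoice B ch τ) {U : Finset α} (hU : U ∈ τ) :
    ∑ a ∈ U, choicePoint B ch a = numSubsets B U := by
  rw [sum_choicePoint, numSubsets]
  congr 2
  ext T
  simp only [Finset.mem_filter]
  exact and_congr_right fun hT => ⟨fun h' => h.2 U hU T hT h', fun h' => h' (h.1 T hT)⟩

theorem exists_isChoice {B : Finset (Finset α)} {x : α → ℝ} (hx : x ∈ nestohedron B) :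
    ∃ ch, IsChoice B ch {U | ∑ a ∈ U, x a = numSubsets B U} := by
  obtain ⟨-, ch, h1, h2⟩ := nestohedron_spec hx
  exact ⟨ch, h1, h2⟩

theorem exists_isChoice_singleton {B : Finset (Finset α)} {S : Finset α} (hB : IsBuildingOn B S)
    (U : Finset α) : ∃ ch, IsChoice B ch {U} := by
  have : ∀ T ∈ B, ∃ a ∈ T, a ∈ U → T ⊆ U := by
    intro T hT
    by_cases h : T ⊆ U
    · obtain ⟨a, ha⟩ := hB.nonempty hT
      exact ⟨a, ha, fun _ => h⟩
    · obtain ⟨a, ha, ha'⟩ := Finset.not_subset.1 h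
      exact ⟨a, ha, fun h => absurd h ha'⟩
  choose! ch h1 h2 using this
  refine ⟨ch, h1, ?_⟩
  rintro _ rfl
  exact h2

/-- The functionals which are tight at a point of a nestohedron can take arbitrary values. -/
theorem exists_direction {B : Finset (Finset α)} {S : Finset α} (hB : IsBuildingOn B S)
    {ch : Finset α → α} {τ : Finset (Finset α)} (hτ : τ ⊆ B) (hch : IsChoice B ch τ)
    (c : Finset α → ℝ) : ∃ v : α → ℝ, (∀ a, a ∉ S → v a = 0) ∧ ∀ T ∈ τ, ∑ a ∈ T, v a = c T := by
  -- Seek `v` as a combination of the basis vectors at the chosen elements. The matrix with entries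
  -- `[ch T' ∈ T]` is unitriangular for inclusion, since `ch T' ∈ T` forces `T' ⊆ T`.
  let A : (τ → ℝ) →ₗ[ℝ] (τ → ℝ) :=
    { toFun := fun w T => ∑ T' : τ, if ch T'.1 ∈ T.1 then w T' else 0
      map_add' := fun w w' => by
        funext T
        simp only [Pi.add_apply, ← Finset.sum_add_distrib]
        exact Finset.sum_congr rfl fun T' _ => by split_ifs <;> simp
      map_smul' := fun r w => by
        funext T
        simp only [Pi.smul_apply, smul_eq_mul, RingHom.id_apply, Finset.mul_sum]
        exact Finset.sum_congr rfl fun T' _ => by split_ifs <;> simp }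
  have hA : Function.Injective A := by
    rw [← LinearMap.ker_eq_bot, LinearMap.ker_eq_bot']
    intro w hw
    by_contra hne
    have hex : (Finset.univ.filter fun T : τ => w T ≠ 0).Nonempty := by
      obtain ⟨T, hT⟩ := Function.ne_iff.1 hne
      exact ⟨T, by simpa using hT⟩
    obtain ⟨T, hT, hmin⟩ := Finset.exists_min_image _ (fun T : τ => T.1.card) hex
    have h1 : ∑ T' : τ, (if ch T'.1 ∈ T.1 then w T' else 0) = 0 := congrFun hw T
    rw [Finset.sum_eq_single T] at h1
    · rw [if_pos (hch.1 _ (hτ T.2))] at h1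
      exact (Finset.mem_filter.1 hT).2 h1
    · intro T' _ hT'
      split_ifs with h
      · by_contra h0
        have h2 := hch.2 T.1 T.2 T'.1 (hτ T'.2) h
        have h3 := hmin T' (Finset.mem_filter.2 ⟨Finset.mem_univ _, h0⟩)
        exact hT' (Subtype.ext (Finset.eq_of_subset_of_card_le h2 h3))
      · rfl
    · exact fun h => absurd (Finset.mem_univ _) h
  obtain ⟨w, hw⟩ := (LinearMap.injective_iff_surjective.1 hA) fun T => c T.1
  refine ⟨∑ T' : τ, Pi.single (ch T'.1) (w T'), fun a ha => ?_, fun T hT => ?_⟩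
  · rw [Finset.sum_apply]
    refine Finset.sum_eq_zero fun T' _ => ?_
    have : a ≠ ch T'.1 := fun h => ha (h ▸ hB.subset _ (hτ T'.2) (hch.1 _ (hτ T'.2)))
    simp [this]
  · have h1 := congrFun hw ⟨T, hT⟩
    refine Eq.trans ?_ h1
    simp only [Finset.sum_apply]
    rw [Finset.sum_comm]
    exact Finset.sum_congr rfl fun T' _ => sum_single _ _ _

/-- The presentation of a nestohedron by linear inequalities. -/
def nestohedronHRep {B : Finset (Finset α)} {S : Finset α} (hB : IsBuildingOn B S) :
    SimpleHRep (nestohedron B) (ProperMember B S) where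
  dir :=
    { carrier := {v | (∀ a, a ∉ S → v a = 0) ∧ ∑ a ∈ S, v a = 0}
      add_mem' := fun {v w} hv hw =>
        ⟨fun a ha => by simp [hv.1 a ha, hw.1 a ha], by simp [Finset.sum_add_distrib, hv.2, hw.2]⟩
      zero_mem' := by simp
      smul_mem' := fun r v hv =>
        ⟨fun a ha => by simp [hv.1 a ha], by simp [← Finset.mul_sum, hv.2]⟩ }
  base := choicePoint B (exists_isChoice_singleton hB S).choose
  lin T := ∑ a ∈ T.1, LinearMap.proj a
  off T := numSubsets B T.1
  base_mem := choicePoint_mem (exists_isChoice_singleton hB S).choose_spec.1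
  mem_iff x := by
    have hb := (mem_nestohedron_iff hB).1
      (choicePoint_mem (exists_isChoice_singleton hB S).choose_spec.1)
    rw [mem_nestohedron_iff hB]
    simp only [Submodule.mem_mk, AddSubmonoid.mem_mk, AddSubsemigroup.mem_mk, Set.mem_ofPred_eq,
      Pi.sub_apply, Finset.sum_sub_distrib, hb.2.1, LinearMap.sum_apply, LinearMap.proj_apply]
    constructor
    · rintro ⟨h0, hS, hx⟩
      refine ⟨⟨fun a ha => by rw [h0 a ha, hb.1 a ha, sub_zero], by rw [hS, sub_self]⟩,
        fun T => hx _ T.2.1⟩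
    · rintro ⟨⟨h0, hS⟩, hx⟩
      have hS' := sub_eq_zero.1 hS
      refine ⟨fun a ha => ?_, hS', fun T hT => ?_⟩
      · have := h0 a ha
        rwa [hb.1 a ha, sub_zero] at this
      · by_cases h : T = S
        · rw [h, hS']
        · exact hx ⟨T, hT, h⟩
  isCompact := isCompact_nestohedron B
  facet_nonempty T := by
    obtain ⟨ch, hch⟩ := exists_isChoice_singleton hB T.1
    refine ⟨choicePoint B ch, choicePoint_mem hch.1, ?_⟩
    simp only [LinearMap.sum_apply, LinearMap.proj_apply]
    exact hch.sum_eq rfl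
  indep x hx c := by
    obtain ⟨ch, hch⟩ := exists_isChoice hx
    obtain ⟨v, hv0, hv⟩ := exists_direction hB
      (τ := B.filter fun T => ∑ a ∈ T, x a = numSubsets B T) (Finset.filter_subset _ _)
      (ch := ch) ⟨hch.1, fun U hU => hch.2 U (Finset.mem_filter.1 hU).2⟩
      -- The value `0` at `S`, which is always tight, is what puts `v` into the direction space.
      (fun T => if hT : T ∈ B ∧ T ≠ S then c ⟨T, hT⟩ else 0)
    refine ⟨v, ⟨hv0, ?_⟩, fun T hT => ?_⟩
    · rw [hv S (Finset.mem_filter.2 ⟨hB.self_mem, ((mem_nestohedron_iff hB).1 hx).2.1⟩), dif_neg]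
      simp
    · simp only [LinearMap.sum_apply, LinearMap.proj_apply] at hT ⊢
      rw [hv T.1 (Finset.mem_filter.2 ⟨T.2.1, hT⟩), dif_pos T.2]

/-- A choice gives the point `choicePoint B ch`, tight on every set the choice respects; conversely
the supports of the summands at a common point give a choice. This replaces the usual description by
nested sets. -/
theorem nestohedronHRep_simplex_iff {B : Finset (Finset α)} {S : Finset α} (hB : IsBuildingOn B S)
    (σ : Finset (ProperMember B S)) :
    (nestohedronHRep hB).Simplex σ ↔ ∃ ch, IsChoice B ch {U | ∃ F ∈ σ, F.1 = U} := by
  have hz : ∀ x F, F ∈ (nestohedronHRep hB).zeros x ↔ ∑ a ∈ F.1, x a = numSubsets B F.1 := by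
    intro x F
    rw [SimpleHRep.mem_zeros]
    simp [nestohedronHRep]
  constructor
  · rintro ⟨x, hx, h⟩
    obtain ⟨ch, hch⟩ := exists_isChoice hx
    refine ⟨ch, hch.1, ?_⟩
    rintro _ ⟨F, hF, rfl⟩
    exact hch.2 F.1 ((hz x F).1 (h hF))
  · rintro ⟨ch, hch⟩
    exact ⟨_, choicePoint_mem hch.1, fun F hF => (hz _ F).2 (hch.sum_eq ⟨F, hF, rfl⟩)⟩

theorem finrank_nestohedronHRep {B : Finset (Finset α)} (hB : IsBuildingOn B Finset.univ) :
    Module.finrank ℝ (nestohedronHRep hB).dir + 1 = Fintype.card α := by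
  let f : (α → ℝ) →ₗ[ℝ] ℝ := ∑ a, LinearMap.proj a
  have hf : (nestohedronHRep hB).dir = f.ker := by
    ext v
    simp [nestohedronHRep, f]
  have hr : LinearMap.range f = ⊤ := by
    rw [LinearMap.range_eq_top]
    intro r
    obtain ⟨a⟩ := ‹Nonempty α›
    exact ⟨Pi.single a r, by simp [f]⟩
  have := f.finrank_range_add_finrank_ker
  rw [hr, finrank_top, Module.finrank_self, Module.finrank_fintype_fun_eq_card] at this
  rw [hf]
  omega

end Nestohedron

/-! ### Links in nerves of nestohedra -/

theorem SimpleHRep.IsLink.equiv_trans {ι ι' κ : Type} [Finite ι] [Finite ι'] [Finite κ]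
    {P : Set (ι → ℝ)} {P' : Set (ι' → ℝ)} {Q : Set (κ → ℝ)} {𝓕 𝓕' 𝓖 : Type} [Fintype 𝓕]
    [DecidableEq 𝓕] [Fintype 𝓕'] [DecidableEq 𝓕'] [Fintype 𝓖] [DecidableEq 𝓖]
    {R : SimpleHRep P 𝓕} {R' : SimpleHRep P' 𝓕'} {R'' : SimpleHRep Q 𝓖} {e : 𝓕' ↪ 𝓖}
    {Z : Finset 𝓖} (h : R'.IsLink R'' e Z) (f : 𝓕 ≃ 𝓕')
    (hf : ∀ σ, R.Simplex σ ↔ R'.Simplex (σ.map f.toEmbedding)) :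
    R.IsLink R'' (f.toEmbedding.trans e) Z where
  notMem F := h.notMem _
  simplex_map σ := by rw [hf, h.simplex_map, Finset.map_map]
  simplex_union σ hσ := by
    rw [← Finset.map_map]
    exact h.simplex_union _ ((hf σ).1 hσ)
  mem_or_exists G hG := by
    rcases h.mem_or_exists G hG with h | ⟨F, rfl⟩
    · exact Or.inl h
    · exact Or.inr ⟨f.symm F, by simp⟩

section NestohedronLinks

variable {α β : Type} [Fintype α] [DecidableEq α] [Nonempty α] [Fintype β] [DecidableEq β]
  [Nonempty β]

/-- A criterion for the nerve of a nestohedron to be the link of a vertex in the nerve of another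
nestohedron. -/
theorem exists_isLink {B : Finset (Finset α)} {S₁ : Finset α} (hB : IsBuildingOn B S₁)
    {B' : Finset (Finset β)} {S₂ : Finset β} (hB' : IsBuildingOn B' S₂) (E : Finset α → Finset β)
    {S : Finset β} (hS : S ∈ B') (hS₂ : S ≠ S₂)
    (hE : ∀ T ∈ B, T ≠ S₁ → E T ∈ B' ∧ E T ≠ S₂ ∧ E T ≠ S)
    (hinj : ∀ T ∈ B, ∀ T' ∈ B, E T = E T' → T = T')
    (hres : ∀ τ : Set (Finset α), (∀ U ∈ τ, U ∈ B ∧ U ≠ S₁) → ∀ ch', IsChoice B' ch' (E '' τ) →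
      ∃ ch, IsChoice B ch τ)
    (hext : ∀ τ : Set (Finset α), (∀ U ∈ τ, U ∈ B ∧ U ≠ S₁) → ∀ ch, IsChoice B ch τ →
      ∃ ch', IsChoice B' ch' (insert S (E '' τ)))
    (hlink : ∀ G ∈ B', G ≠ S₂ → G ≠ S → ∀ ch', IsChoice B' ch' {G, S} →
      ∃ T ∈ B, T ≠ S₁ ∧ E T = G) :
    ∃ (e : ProperMember B S₁ ↪ ProperMember B' S₂) (Z : Finset (ProperMember B' S₂)), Z.Nonempty ∧
      (nestohedronHRep hB).IsLink (nestohedronHRep hB') e Z := by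
  let e : ProperMember B S₁ ↪ ProperMember B' S₂ :=
    ⟨fun T => ⟨E T.1, (hE T.1 T.2.1 T.2.2).1, (hE T.1 T.2.1 T.2.2).2.1⟩, fun T T' h =>
      Subtype.ext (hinj _ T.2.1 _ T'.2.1 (congrArg Subtype.val h))⟩
  have himage : ∀ σ : Finset (ProperMember B S₁), {U | ∃ F ∈ σ.map e, F.1 = U} =
      E '' {U | ∃ F ∈ σ, F.1 = U} := by
    intro σ
    ext U
    constructor
    · rintro ⟨F, hF, rfl⟩
      obtain ⟨G, hG, rfl⟩ := Finset.mem_map.1 hF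
      exact ⟨G.1, ⟨G, hG, rfl⟩, rfl⟩
    · rintro ⟨_, ⟨G, hG, rfl⟩, rfl⟩
      exact ⟨e G, Finset.mem_map_of_mem _ hG, rfl⟩
  have hmem : ∀ σ : Finset (ProperMember B S₁), ∀ U ∈ {U | ∃ F ∈ σ, F.1 = U}, U ∈ B ∧ U ≠ S₁ := by
    rintro σ _ ⟨F, -, rfl⟩
    exact F.2
  refine ⟨e, {⟨S, hS, hS₂⟩}, Finset.singleton_nonempty _, ?_, ?_, ?_, ?_⟩
  · intro F hF
    exact (hE F.1 F.2.1 F.2.2).2.2 (congrArg Subtype.val (Finset.mem_singleton.1 hF))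
  · intro σ
    rw [nestohedronHRep_simplex_iff, nestohedronHRep_simplex_iff, himage]
    constructor
    · rintro ⟨ch, hch⟩
      obtain ⟨ch', h1, h2⟩ := hext _ (hmem σ) ch hch
      exact ⟨ch', h1, fun U hU => h2 U (Set.mem_insert_of_mem _ hU)⟩
    · rintro ⟨ch', hch'⟩
      exact hres _ (hmem σ) ch' hch'
  · intro σ hσ
    rw [nestohedronHRep_simplex_iff] at hσ ⊢
    obtain ⟨ch, hch⟩ := hσ
    obtain ⟨ch', h1, h2⟩ := hext _ (hmem σ) ch hch
    refine ⟨ch', h1, ?_⟩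
    rintro _ ⟨F, hF, rfl⟩
    rcases Finset.mem_union.1 hF with hF | hF
    · refine h2 _ (Set.mem_insert_of_mem _ ?_)
      rw [← himage]
      exact ⟨F, hF, rfl⟩
    · rw [Finset.mem_singleton.1 hF]
      exact h2 S (Set.mem_insert _ _)
  · intro G hG
    rw [nestohedronHRep_simplex_iff] at hG
    obtain ⟨ch', h1, h2⟩ := hG
    by_cases hGS : G.1 = S
    · exact Or.inl (Finset.mem_singleton.2 (Subtype.ext hGS))
    · obtain ⟨T, hT, hT', hTG⟩ := hlink G.1 G.2.1 G.2.2 hGS ch' ⟨h1, by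
        rintro U (rfl | rfl)
        · exact h2 _ ⟨G, by simp, rfl⟩
        · exact h2 _ ⟨⟨U, hS, hS₂⟩, by simp, rfl⟩⟩
      exact Or.inr ⟨⟨T, hT, hT'⟩, Subtype.ext hTG⟩

/-- If `S` misses a single element, the only facets that meet the facet `S` of a nestohedron are
those of the subsets of `S`. -/
theorem subset_of_isChoice_pair {B : Finset (Finset α)} (hB : IsBuildingOn B Finset.univ)
    {S : Finset α} {a₀ : α} (hS : ∀ a, a ∈ S ↔ a ≠ a₀) {G : Finset α} (hG : G ≠ Finset.univ)
    {ch : Finset α → α} (h : IsChoice B ch {G, S}) : G ⊆ S := by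
  intro a ha
  rw [hS]
  rintro rfl
  -- The choice in the full set either lies in `S`, forcing `S` to be full, or is `a₀ ∈ G`, forcing
  -- `G` to be full.
  by_cases h1 : ch Finset.univ ∈ S
  · have := h.2 S (by simp) _ hB.self_mem h1
    exact (hS a).1 (this (Finset.mem_univ a)) rfl
  · rw [hS, not_not] at h1
    have := h.2 G (by simp) _ hB.self_mem (h1 ▸ ha)
    exact hG (Finset.eq_univ_iff_forall.2 fun b => this (Finset.mem_univ b))

/-- The nerve of the nestohedron of the restriction of a building set to a member with a one-point
complement is a link. -/
theorem exists_isLink_restrictTo {B : Finset (Finset α)} (hB : IsBuildingOn B Finset.univ)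
    {S : Finset α} (hSB : S ∈ B) {a₀ : α} (hS : ∀ a, a ∈ S ↔ a ≠ a₀) :
    ∃ (e : ProperMember (restrictTo B S) S ↪ ProperMember B Finset.univ)
      (Z : Finset (ProperMember B Finset.univ)), Z.Nonempty ∧
      (nestohedronHRep (hB.restrictTo hSB)).IsLink (nestohedronHRep hB) e Z := by
  have hmem : ∀ T, T ∈ restrictTo B S ↔ T ∈ B ∧ T ⊆ S := fun T => Finset.mem_filter
  have ha₀ : a₀ ∉ S := fun h => (hS a₀).1 h rfl
  have hne : ∀ T, T ⊆ S → T ≠ Finset.univ := fun T hT h => ha₀ (hT (h ▸ Finset.mem_univ _))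
  refine exists_isLink (hB.restrictTo hSB) hB id hSB (hne S subset_rfl) ?_ (fun _ _ _ _ h => h)
    ?_ ?_ ?_
  · intro T hT hTS
    exact ⟨((hmem T).1 hT).1, hne T ((hmem T).1 hT).2, hTS⟩
  · rintro τ - ch' hch'
    rw [Set.image_id] at hch'
    exact ⟨ch', fun T hT => hch'.1 T ((hmem T).1 hT).1,
      fun U hU T hT => hch'.2 U hU T ((hmem T).1 hT).1⟩
  · intro τ hτ ch hch
    -- A member not inside `S` contains `a₀`; choosing `a₀` there avoids `S` and all its subsets.
    refine ⟨fun T => if T ⊆ S then ch T else a₀, fun T hT => ?_, ?_⟩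
    · dsimp only
      split_ifs with h
      · exact hch.1 T ((hmem T).2 ⟨hT, h⟩)
      · obtain ⟨a, ha, ha'⟩ := Finset.not_subset.1 h
        rw [hS, not_not] at ha'
        exact ha' ▸ ha
    · rw [Set.image_id]
      rintro U hU T hT
      dsimp only
      split_ifs with h
      · intro hTU
        rcases hU with rfl | hU
        · exact h
        · exact hch.2 U hU T ((hmem T).2 ⟨hT, h⟩) hTU
      · intro h'
        rcases hU with rfl | hU
        · exact absurd h' ha₀
        · exact absurd (((hmem U).1 (hτ U hU).1).2 h') ha₀
  · intro G hG hG' hGS ch' hch'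
    exact ⟨G, (hmem G).2 ⟨hG, subset_of_isChoice_pair hB hS hG' hch'⟩, hGS, rfl⟩

/-- The nerve of a nestohedron is a link in the nerve of the nestohedron of a building set on one
more element that restricts to the given one. -/
theorem exists_isLink_map {B : Finset (Finset α)} (hB : IsBuildingOn B Finset.univ)
    {B' : Finset (Finset β)} (hB' : IsBuildingOn B' Finset.univ) (φ : α ↪ β) {b₀ : β}
    (hφ : ∀ b, (∃ a, φ a = b) ↔ b ≠ b₀) (hmap : ∀ T, T.map φ ∈ B' ↔ T ∈ B) :
    ∃ (e : ProperMember B Finset.univ ↪ ProperMember B' Finset.univ)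
      (Z : Finset (ProperMember B' Finset.univ)), Z.Nonempty ∧
      (nestohedronHRep hB).IsLink (nestohedronHRep hB') e Z := by
  have hS : ∀ b, b ∈ Finset.univ.map φ ↔ b ≠ b₀ := fun b => by simp [← hφ]
  have hb₀ : ∀ T : Finset α, b₀ ∉ T.map φ := fun T h =>
    (hS b₀).1 (Finset.map_subset_map.2 (Finset.subset_univ T) h) rfl
  have hne : ∀ T : Finset α, T.map φ ≠ Finset.univ := fun T h => hb₀ T (h ▸ Finset.mem_univ _)
  have hex : ∀ T' : Finset β, b₀ ∉ T' → ∃ T : Finset α, T.map φ = T' := by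
    intro T' hT'
    refine ⟨Finset.univ.filter fun a => φ a ∈ T', ?_⟩
    ext b
    simp only [Finset.mem_map, Finset.mem_filter, Finset.mem_univ, true_and]
    constructor
    · rintro ⟨a, ha, rfl⟩
      exact ha
    · intro hb
      obtain ⟨a, rfl⟩ := (hφ b).2 fun h => hT' (h ▸ hb)
      exact ⟨a, hb, rfl⟩
  refine exists_isLink hB hB' (fun T => T.map φ) ((hmap _).2 hB.self_mem) (hne _) ?_
    (fun T _ T' _ h => Finset.map_injective φ h) ?_ ?_ ?_
  · intro T hT hTS
    exact ⟨(hmap T).2 hT, hne T, fun h => hTS (Finset.map_injective φ h)⟩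
  · rintro τ - ch' hch'
    have : ∀ T ∈ B, ∃ a ∈ T, φ a = ch' (T.map φ) := fun T hT =>
      Finset.mem_map.1 (hch'.1 _ ((hmap T).2 hT))
    choose! ch h1 h2 using this
    refine ⟨ch, h1, fun U hU T hT hTU => ?_⟩
    have := hch'.2 _ ⟨U, hU, rfl⟩ _ ((hmap T).2 hT) (h2 T hT ▸ Finset.mem_map_of_mem φ hTU)
    exact Finset.map_subset_map.1 this
  · intro τ hτ ch hch
    -- Choose `b₀` whenever it is available, and transport the old choice otherwise.
    have : ∀ T' ∈ B', ∃ b ∈ T', b ≠ b₀ → ∃ T ∈ B, T.map φ = T' ∧ b = φ (ch T) := by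
      intro T' hT'
      by_cases h : b₀ ∈ T'
      · exact ⟨b₀, h, fun h => absurd rfl h⟩
      · obtain ⟨T, rfl⟩ := hex T' h
        have hT := (hmap T).1 hT'
        exact ⟨φ (ch T), Finset.mem_map_of_mem _ (hch.1 T hT), fun _ => ⟨T, hT, rfl, rfl⟩⟩
    choose! ch' h1 h2 using this
    refine ⟨ch', h1, ?_⟩
    rintro U (rfl | ⟨U, hU, rfl⟩) T' hT' hTU
    · obtain ⟨T, -, rfl, -⟩ := h2 T' hT' ((hS _).1 hTU)
      exact Finset.map_subset_map.2 (Finset.subset_univ _)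
    · have hb : ch' T' ≠ b₀ := fun h => hb₀ U (h ▸ hTU)
      obtain ⟨T, hT, rfl, hTc⟩ := h2 T' hT' hb
      rw [hTc] at hTU
      exact Finset.map_subset_map.2 (hch.2 U hU T hT ((Finset.mem_map' φ).1 hTU))
  · intro G hG hG' hGS ch' hch'
    have hsub := subset_of_isChoice_pair hB' hS hG' hch'
    obtain ⟨T, rfl⟩ := hex G fun h => (hS b₀).1 (hsub h) rfl
    refine ⟨T, (hmap T).1 hG, ?_, rfl⟩
    rintro rfl
    exact hGS rfl

end NestohedronLinks

/-! ### Families of nestohedra -/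

section Families

universe w

theorem isGeometricDirectFamily_nestohedron (𝕜 : Type w) [CommRing 𝕜]
    {B : ∀ n : ℕ, Finset (Finset (Fin (n + 1)))} (hB : ∀ n, IsBuildingOn (B n) Finset.univ)
    (hlink : ∀ n, ∃ (e : ProperMember (B n) Finset.univ ↪ ProperMember (B (n + 1)) Finset.univ)
      (Z : Finset (ProperMember (B (n + 1)) Finset.univ)), Z.Nonempty ∧
      (nestohedronHRep (hB n)).IsLink (nestohedronHRep (hB (n + 1))) e Z) :
    IsGeometricDirectFamily 𝕜 fun n => nestohedron (B n) :=
  SimpleHRep.isGeometricDirectFamily 𝕜 (fun n => nestohedronHRep (hB n))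
    (fun n => by have := finrank_nestohedronHRep (hB n); simpa using this) hlink

theorem isGeometricDirectFamily_of_combEquiv (𝕜 : Type w) [CommRing 𝕜]
    (B : ∀ n : ℕ, Finset (Finset (Fin (n + 1)))) (hB : ∀ n, IsConnectedBuildingSet (B n))
    (hS : ∀ n : ℕ, 2 ≤ n → ∃ S ∈ B n, S.card = n ∧
      CombEquiv (nestohedron (restrictTo (B n) S)) (nestohedron (B (n - 1)))) :
    IsGeometricDirectFamily 𝕜 fun n => nestohedron (B n) := by
  have hB' := fun n => (hB n).isBuildingOn
  refine isGeometricDirectFamily_nestohedron 𝕜 hB' fun n => ?_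
  obtain ⟨S, hSB, hcard, f, hf⟩ : ∃ S, ∃ (hS : S ∈ B (n + 1)), S.card = n + 1 ∧
      ∃ f : ProperMember (B n) Finset.univ ≃ ProperMember (restrictTo (B (n + 1)) S) S,
        ∀ σ, (nestohedronHRep (hB' n)).Simplex σ ↔
          (nestohedronHRep ((hB' (n + 1)).restrictTo hS)).Simplex (σ.map f.toEmbedding) := by
    -- The hypothesis starts in dimension `2`. From dimension `0` to `1` any singleton serves, since
    -- neither a point nor its restriction has proper members.
    rcases n with _ | n
    · have h1 : IsEmpty (ProperMember (B 0) Finset.univ) := ⟨fun ⟨T, hT, hT'⟩ => by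
        obtain ⟨a, ha⟩ := (hB' 0).nonempty hT
        refine hT' (Finset.eq_univ_iff_forall.2 fun b => ?_)
        rwa [show b = a from Fin.ext (by omega)]⟩
      have h2 : IsEmpty (ProperMember (restrictTo (B 1) {0}) {0}) := ⟨fun ⟨T, hT, hT'⟩ => by
        have hT := Finset.mem_filter.1 hT
        obtain ⟨a, ha⟩ := (hB' 1).nonempty hT.1
        refine hT' (Finset.Subset.antisymm hT.2 ?_)
        rw [Finset.singleton_subset_iff]
        have := Finset.mem_singleton.1 (hT.2 ha)
        exact this ▸ ha⟩
      refine ⟨{0}, (hB 1).singleton_mem 0, rfl, Equiv.equivOfIsEmpty _ _, fun σ => ?_⟩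
      rw [Finset.eq_empty_of_isEmpty σ, Finset.map_empty]
      exact iff_of_true (SimpleHRep.simplex_empty _) (SimpleHRep.simplex_empty _)
    · obtain ⟨S, hSB, hcard, hcomb⟩ := hS (n + 1 + 1) (by omega)
      refine ⟨S, hSB, hcard, ?_⟩
      obtain ⟨g⟩ := hcomb
      exact SimpleHRep.exists_equiv_of_combEquiv _ _ ⟨g.symm⟩
  obtain ⟨a₀, ha₀⟩ : ∃ a₀, Sᶜ = {a₀} := by
    rw [← Finset.card_eq_one, Finset.card_compl, hcard, Fintype.card_fin]
    omega
  have hS : ∀ a, a ∈ S ↔ a ≠ a₀ := fun a => by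
    have : a ∈ Sᶜ ↔ a = a₀ := by rw [ha₀, Finset.mem_singleton]
    rw [Finset.mem_compl] at this
    rw [Ne, ← this, not_not]
  obtain ⟨e, Z, hZ, he⟩ := exists_isLink_restrictTo (hB' (n + 1)) hSB hS
  exact ⟨_, Z, hZ, he.equiv_trans f hf⟩

theorem exists_castSucc_iff {n : ℕ} (b : Fin (n + 1)) :
    (∃ a, Fin.castSuccEmb a = b) ↔ b ≠ Fin.last n := by
  simp [Fin.exists_castSucc_eq]

/-- A sequence of building sets, each of which is the restriction of the next one, gives a geometric
direct family. -/
theorem isGeometricDirectFamily_of_castSucc (𝕜 : Type w) [CommRing 𝕜]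
    {B : ∀ n : ℕ, Finset (Finset (Fin (n + 1)))} (hB : ∀ n, IsConnectedBuildingSet (B n))
    (hmap : ∀ n T, T.map Fin.castSuccEmb ∈ B (n + 1) ↔ T ∈ B n) :
    IsGeometricDirectFamily 𝕜 fun n => nestohedron (B n) :=
  isGeometricDirectFamily_nestohedron 𝕜 (fun n => (hB n).isBuildingOn) fun n =>
    exists_isLink_map _ _ Fin.castSuccEmb exists_castSucc_iff (hmap n)

/-! ### The building sets of the cubes. -/

theorem mem_cubeBuildingSet {n : ℕ} {S : Finset (Fin (n + 1))} :
    S ∈ cubeBuildingSet n ↔ ∃ i, S = {i} ∨ S = Finset.Iic i := by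
  simp [cubeBuildingSet]

theorem isConnectedBuildingSet_cubeBuildingSet (n : ℕ) :
    IsConnectedBuildingSet (cubeBuildingSet n) where
  empty_notMem h := by
    obtain ⟨i, h | h⟩ := mem_cubeBuildingSet.1 h
    · exact Finset.singleton_ne_empty i h.symm
    · exact Finset.notMem_empty i (h ▸ Finset.mem_Iic.2 le_rfl)
  singleton_mem a := mem_cubeBuildingSet.2 ⟨a, Or.inl rfl⟩
  univ_mem := mem_cubeBuildingSet.2 ⟨Fin.last n, Or.inr (by ext; simp [Fin.le_last])⟩
  union_mem S hS T hT hne := by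
    rw [mem_cubeBuildingSet] at *
    obtain ⟨i, rfl | rfl⟩ := hS <;> obtain ⟨j, rfl | rfl⟩ := hT <;> obtain ⟨a, ha⟩ := hne <;>
      simp only [Finset.mem_inter, Finset.mem_singleton, Finset.mem_Iic] at ha
    · exact ⟨i, Or.inl (by ext b; simp [← ha.1, ← ha.2])⟩
    · exact ⟨j, Or.inr (by ext b; simp only [Finset.mem_union, Finset.mem_singleton, Finset.mem_Iic]; grind)⟩
    · exact ⟨i, Or.inr (by ext b; simp only [Finset.mem_union, Finset.mem_singleton, Finset.mem_Iic]; grind)⟩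
    · exact ⟨max i j, Or.inr (by ext b; simp)⟩

theorem isGeometricDirectFamily_cubeBuildingSet (𝕜 : Type w) [CommRing 𝕜] :
    IsGeometricDirectFamily 𝕜 fun n => nestohedron (cubeBuildingSet n) := by
  refine isGeometricDirectFamily_of_castSucc 𝕜 isConnectedBuildingSet_cubeBuildingSet fun n T => ?_
  have hIic : ∀ i : Fin (n + 1), (Finset.Iic i).map Fin.castSuccEmb = Finset.Iic i.castSucc := by
    intro i
    ext b
    refine Fin.lastCases ?_ (fun b => ?_) b
    · simp
    · simp
  rw [mem_cubeBuildingSet, mem_cubeBuildingSet]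
  constructor
  · rintro ⟨i, hi⟩
    -- Both kinds of sets contain their index `i`, so `i` is not the last element.
    have hmem : i ∈ T.map Fin.castSuccEmb := by rcases hi with hi | hi <;> simp [hi]
    obtain ⟨a, -, rfl⟩ := Finset.mem_map.1 hmem
    refine ⟨a, hi.imp (fun hi => ?_) fun hi => ?_⟩
    · exact Finset.map_injective Fin.castSuccEmb (hi.trans (Finset.map_singleton _ _).symm)
    · exact Finset.map_injective Fin.castSuccEmb (hi.trans (hIic a).symm)
  · rintro ⟨i, rfl | rfl⟩
    · exact ⟨i.castSucc, Or.inl (Finset.map_singleton _ _)⟩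
    · exact ⟨i.castSucc, Or.inr (hIic i)⟩

/-! ### Graph-associahedra -/

theorem mem_graphicalBuildingSet {α : Type} [Fintype α] [DecidableEq α] {Γ : SimpleGraph α}
    {S : Finset α} : S ∈ graphicalBuildingSet Γ ↔ (Γ.induce (S : Set α)).Connected := by
  simp [graphicalBuildingSet]

theorem isConnectedBuildingSet_graphicalBuildingSet {α : Type} [Fintype α] [DecidableEq α]
    {Γ : SimpleGraph α} (h : Γ.Connected) : IsConnectedBuildingSet (graphicalBuildingSet Γ) where
  empty_notMem h' := by
    rw [mem_graphicalBuildingSet] at h'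
    obtain ⟨a, ha⟩ := h'.nonempty
    simp at ha
  singleton_mem a := by
    rw [mem_graphicalBuildingSet, Finset.coe_singleton]
    exact ⟨fun x y => by rw [Subsingleton.elim x y]⟩
  union_mem S hS T hT hne := by
    rw [mem_graphicalBuildingSet] at *
    rw [Finset.coe_union]
    exact SimpleGraph.induce_union_connected hS.preconnected hT.preconnected (by exact_mod_cast hne)
  univ_mem := by
    rw [mem_graphicalBuildingSet, Finset.coe_univ]
    exact (SimpleGraph.induceUnivIso Γ).connected_iff.2 h

theorem map_mem_graphicalBuildingSet {α β : Type} [Fintype α] [DecidableEq α] [Fintype β]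
    [DecidableEq β] {Γ : SimpleGraph α} {Γ' : SimpleGraph β} (φ : α ↪ β)
    (h : ∀ a b, Γ'.Adj (φ a) (φ b) ↔ Γ.Adj a b) (T : Finset α) :
    T.map φ ∈ graphicalBuildingSet Γ' ↔ T ∈ graphicalBuildingSet Γ := by
  rw [mem_graphicalBuildingSet, mem_graphicalBuildingSet, Finset.coe_map]
  let f : Γ.induce (T : Set α) ≃g Γ'.induce (φ '' (T : Set α)) :=
    { toEquiv := Equiv.Set.image φ _ φ.injective
      map_rel_iff' := fun {a b} => h a.1 b.1 }
  exact f.connected_iff.symm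

theorem isGeometricDirectFamily_graphical (𝕜 : Type w) [CommRing 𝕜]
    {Γ : ∀ n : ℕ, SimpleGraph (Fin (n + 1))} (hΓ : ∀ n, (Γ n).Connected)
    (h : ∀ n a b, (Γ (n + 1)).Adj (Fin.castSucc a) (Fin.castSucc b) ↔ (Γ n).Adj a b) :
    IsGeometricDirectFamily 𝕜 fun n => nestohedron (graphicalBuildingSet (Γ n)) :=
  isGeometricDirectFamily_of_castSucc 𝕜
    (fun n => isConnectedBuildingSet_graphicalBuildingSet (hΓ n))
    fun n T => map_mem_graphicalBuildingSet Fin.castSuccEmb (h n) T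

theorem isGeometricDirectFamily_permutohedron (𝕜 : Type w) [CommRing 𝕜] :
    IsGeometricDirectFamily 𝕜 permutohedron :=
  isGeometricDirectFamily_graphical 𝕜 (fun _ => SimpleGraph.connected_top) fun n a b => by simp

theorem isGeometricDirectFamily_stellahedron (𝕜 : Type w) [CommRing 𝕜] :
    IsGeometricDirectFamily 𝕜 stellahedron :=
  isGeometricDirectFamily_graphical 𝕜 (fun _ => SimpleGraph.connected_starGraph 0) fun n a b => by
    rw [SimpleGraph.starGraph_adj, SimpleGraph.starGraph_adj]
    simp only [ne_eq, Fin.castSucc_inj, Fin.castSucc_eq_zero_iff]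

theorem isGeometricDirectFamily_associahedron (𝕜 : Type w) [CommRing 𝕜] :
    IsGeometricDirectFamily 𝕜 associahedron :=
  isGeometricDirectFamily_graphical 𝕜 (fun n => SimpleGraph.pathGraph_connected n) fun n a b => by
    simp [SimpleGraph.pathGraph_adj]

end Families

/-! ### Reconnected complements and cyclohedra -/

section Reconnected

variable {α β : Type} [Fintype α] [DecidableEq α] [Nonempty α] [Fintype β] [DecidableEq β]
  [Nonempty β]

/-- `Γ` is the graph obtained from `Γ'` by deleting the vertex `b₀` and joining its neighbours. -/
structure IsReconnected (Γ : SimpleGraph α) (Γ' : SimpleGraph β) (φ : α ↪ β) (b₀ : β) : Prop where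
  exists_iff : ∀ b, (∃ a, φ a = b) ↔ b ≠ b₀
  adj_iff : ∀ a b, Γ.Adj a b ↔
    a ≠ b ∧ (Γ'.Adj (φ a) (φ b) ∨ (Γ'.Adj (φ a) b₀ ∧ Γ'.Adj (φ b) b₀))

namespace IsReconnected

variable {Γ : SimpleGraph α} {Γ' : SimpleGraph β} {φ : α ↪ β} {b₀ : β}

theorem map_ne (h : IsReconnected Γ Γ' φ b₀) (a : α) : φ a ≠ b₀ := (h.exists_iff _).1 ⟨a, rfl⟩

open Classical in
/-- The set of vertices of `Γ'` given by a set of vertices of `Γ`; the deleted vertex is added when it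
has a neighbour in the set. -/
def lift (Γ' : SimpleGraph β) (φ : α ↪ β) (b₀ : β) (T : Finset α) : Finset β :=
  T.map φ ∪ if ∃ a ∈ T, Γ'.Adj (φ a) b₀ then {b₀} else ∅

/-- The set of vertices of `Γ` given by a set of vertices of `Γ'`. -/
def pull (φ : α ↪ β) (T : Finset β) : Finset α := Finset.univ.filter fun a => φ a ∈ T

theorem mem_pull {T : Finset β} {a : α} : a ∈ pull φ T ↔ φ a ∈ T := by simp [pull]

theorem map_mem_lift (h : IsReconnected Γ Γ' φ b₀) {T : Finset α} {a : α} :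
    φ a ∈ lift Γ' φ b₀ T ↔ a ∈ T := by
  have := h.map_ne a
  unfold lift
  split_ifs <;> simp [this]

theorem self_mem_lift (h : IsReconnected Γ Γ' φ b₀) {T : Finset α} :
    b₀ ∈ lift Γ' φ b₀ T ↔ ∃ a ∈ T, Γ'.Adj (φ a) b₀ := by
  have h1 : b₀ ∉ T.map φ := fun h' => by
    obtain ⟨a, -, ha⟩ := Finset.mem_map.1 h'
    exact h.map_ne a ha
  unfold lift
  split_ifs with h2
  · simp only [Finset.mem_union, Finset.mem_singleton, or_true, true_iff]
    exact h2
  · simp only [Finset.union_empty, h1, false_iff]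
    exact h2

theorem cases (h : IsReconnected Γ Γ' φ b₀) (b : β) : b = b₀ ∨ ∃ a, b = φ a := by
  by_cases hb : b = b₀
  · exact Or.inl hb
  · obtain ⟨a, rfl⟩ := (h.exists_iff b).2 hb
    exact Or.inr ⟨a, rfl⟩

theorem pull_lift (h : IsReconnected Γ Γ' φ b₀) (T : Finset α) : pull φ (lift Γ' φ b₀ T) = T := by
  ext a
  rw [mem_pull, h.map_mem_lift]

theorem exists_adj_of_connected (h : IsReconnected Γ Γ' φ b₀) {T : Finset β}
    (hT : (Γ'.induce (T : Set β)).Connected) (hb : b₀ ∈ T) (hne : T ≠ {b₀}) :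
    ∃ a, φ a ∈ T ∧ Γ'.Adj (φ a) b₀ := by
  obtain ⟨c, hc, hcb⟩ : ∃ c ∈ T, c ≠ b₀ := by
    by_contra! h'
    exact hne (Finset.eq_singleton_iff_unique_mem.2 ⟨hb, h'⟩)
  obtain ⟨p⟩ := hT.preconnected ⟨b₀, hb⟩ ⟨c, hc⟩
  cases p with
  | nil => exact absurd rfl hcb
  | @cons _ z _ hadj _ =>
    have hadj : Γ'.Adj b₀ z.1 := hadj
    rcases h.cases z.1 with hz | ⟨a, ha⟩
    · exact absurd (hz ▸ hadj) (SimpleGraph.irrefl _)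
    · exact ⟨a, ha ▸ z.2, ha ▸ hadj.symm⟩

/-- An edge of `Γ` is either an edge of `Γ'` or can be replaced by the two-step path through `b₀`,
which then belongs to the lift. -/
theorem lift_mem (h : IsReconnected Γ Γ' φ b₀) {T : Finset α}
    (hT : T ∈ graphicalBuildingSet Γ) : lift Γ' φ b₀ T ∈ graphicalBuildingSet Γ' := by
  rw [mem_graphicalBuildingSet] at hT ⊢
  obtain ⟨a₀, ha₀⟩ := hT.nonempty
  have key : ∀ x y : (T : Set α), (Γ.induce (T : Set α)).Reachable x y →
      (Γ'.induce (lift Γ' φ b₀ T : Set β)).Reachable ⟨φ x.1, h.map_mem_lift.2 x.2⟩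
        ⟨φ y.1, h.map_mem_lift.2 y.2⟩ := by
    rintro x y ⟨p⟩
    induction p with
    | nil => exact SimpleGraph.Reachable.refl _
    | @cons u v w hadj p ih =>
      refine SimpleGraph.Reachable.trans ?_ ih
      have hadj : Γ.Adj u.1 v.1 := hadj
      rcases ((h.adj_iff _ _).1 hadj).2 with h1 | ⟨h1, h2⟩
      · exact SimpleGraph.Adj.reachable (G := Γ'.induce _) h1
      · have hb : b₀ ∈ lift Γ' φ b₀ T := h.self_mem_lift.2 ⟨u.1, u.2, h1⟩
        have r1 : (Γ'.induce (lift Γ' φ b₀ T : Set β)).Adj ⟨φ u.1, h.map_mem_lift.2 u.2⟩ ⟨b₀, hb⟩ :=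
          h1
        have r2 : (Γ'.induce (lift Γ' φ b₀ T : Set β)).Adj ⟨b₀, hb⟩ ⟨φ v.1, h.map_mem_lift.2 v.2⟩ :=
          h2.symm
        exact r1.reachable.trans r2.reachable
  have hbase : ∀ z : (lift Γ' φ b₀ T : Set β), (Γ'.induce (lift Γ' φ b₀ T : Set β)).Reachable
      ⟨φ a₀, h.map_mem_lift.2 ha₀⟩ z := by
    rintro ⟨z, hz⟩
    rcases h.cases z with rfl | ⟨a, rfl⟩
    · obtain ⟨a, ha, hadj⟩ := h.self_mem_lift.1 hz
      refine (key ⟨a₀, ha₀⟩ ⟨a, ha⟩ (hT.preconnected _ _)).trans ?_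
      exact SimpleGraph.Adj.reachable (G := Γ'.induce _) hadj
    · exact key ⟨a₀, ha₀⟩ ⟨a, h.map_mem_lift.1 hz⟩ (hT.preconnected _ _)
  have : Nonempty (lift Γ' φ b₀ T : Set β) := ⟨⟨φ a₀, h.map_mem_lift.2 ha₀⟩⟩
  exact ⟨fun x y => (hbase x).symm.trans (hbase y)⟩

/-- A passage of a walk through `b₀` is shortcut by the edge of `Γ` that joins the neighbours before
and after it. -/
theorem pull_mem (h : IsReconnected Γ Γ' φ b₀) {T : Finset β}
    (hT : T ∈ graphicalBuildingSet Γ') (hne : T ≠ {b₀}) : pull φ T ∈ graphicalBuildingSet Γ := by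
  rw [mem_graphicalBuildingSet] at hT ⊢
  -- For the induction, an end of the walk at `b₀` may be represented by any neighbour of `b₀` in
  -- the set.
  have key : ∀ x y : (T : Set β), (Γ'.induce (T : Set β)).Reachable x y →
      ∀ a b : (pull φ T : Set α), (x.1 = φ a.1 ∨ (x.1 = b₀ ∧ Γ'.Adj (φ a.1) b₀)) →
        (y.1 = φ b.1 ∨ (y.1 = b₀ ∧ Γ'.Adj (φ b.1) b₀)) →
        (Γ.induce (pull φ T : Set α)).Reachable a b := by
    have hadj' : ∀ a b : (pull φ T : Set α), (Γ'.Adj (φ a.1) (φ b.1) ∨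
        (Γ'.Adj (φ a.1) b₀ ∧ Γ'.Adj (φ b.1) b₀)) →
        (Γ.induce (pull φ T : Set α)).Reachable a b := by
      intro a b hab
      by_cases he : a.1 = b.1
      · rw [Subtype.ext he]
      · exact SimpleGraph.Adj.reachable (G := Γ.induce _) ((h.adj_iff _ _).2 ⟨he, hab⟩)
    rintro x y ⟨p⟩
    induction p with
    | @nil u =>
      rintro a b (ha | ⟨ha, ha'⟩) (hb | ⟨hb, hb'⟩)
      · rw [Subtype.ext (φ.injective (ha.symm.trans hb))]
      · exact absurd (ha.symm.trans hb) (h.map_ne _)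
      · exact absurd (hb.symm.trans ha) (h.map_ne _)
      · exact hadj' a b (Or.inr ⟨ha', hb'⟩)
    | @cons u v w hadj p ih =>
      intro a b ha hb
      have hadj : Γ'.Adj u.1 v.1 := hadj
      rcases h.cases v.1 with hv | ⟨c, hc⟩
      · rcases ha with ha | ⟨ha, -⟩
        · refine ih a b (Or.inr ⟨hv, ?_⟩) hb
          rwa [← ha, ← hv]
        · rw [hv, ha] at hadj
          exact absurd hadj (SimpleGraph.irrefl _)
      · have hcT : c ∈ (pull φ T : Set α) := mem_pull.2 (hc ▸ v.2)
        refine SimpleGraph.Reachable.trans ?_ (ih ⟨c, hcT⟩ b (Or.inl hc) hb)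
        refine hadj' a ⟨c, hcT⟩ ?_
        rcases ha with ha | ⟨ha, ha'⟩
        · left
          change Γ'.Adj (φ a.1) (φ c)
          rwa [← ha, ← hc]
        · right
          refine ⟨ha', ?_⟩
          change Γ'.Adj (φ c) b₀
          rw [← ha, ← hc]
          exact hadj.symm
  have hnonempty : Nonempty (pull φ T : Set α) := by
    obtain ⟨z, hz⟩ := hT.nonempty
    rcases h.cases z with rfl | ⟨a, rfl⟩
    · obtain ⟨a, ha, -⟩ := h.exists_adj_of_connected hT hz hne
      exact ⟨⟨a, mem_pull.2 ha⟩⟩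
    · exact ⟨⟨a, mem_pull.2 hz⟩⟩
  exact ⟨fun a b => key ⟨φ a.1, mem_pull.1 a.2⟩ ⟨φ b.1, mem_pull.1 b.2⟩ (hT.preconnected _ _) a b
    (Or.inl rfl) (Or.inl rfl)⟩

theorem exists_adj (h : IsReconnected Γ Γ' φ b₀) (hΓ' : Γ'.Connected) : ∃ a, Γ'.Adj (φ a) b₀ := by
  have h1 := (isConnectedBuildingSet_graphicalBuildingSet hΓ').univ_mem
  rw [mem_graphicalBuildingSet] at h1
  obtain ⟨a⟩ := ‹Nonempty α›
  obtain ⟨a, -, ha⟩ := h.exists_adj_of_connected h1 (Finset.mem_univ b₀) fun h' =>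
    h.map_ne a (Finset.mem_singleton.1 (h' ▸ Finset.mem_univ (φ a)))
  exact ⟨a, ha⟩

/-- The nerve of the graph-associahedron of a reconnected complement of a vertex is a link. -/
theorem exists_isLink (h : IsReconnected Γ Γ' φ b₀) (hΓ : Γ.Connected) (hΓ' : Γ'.Connected) :
    ∃ (e : ProperMember (graphicalBuildingSet Γ) Finset.univ ↪
        ProperMember (graphicalBuildingSet Γ') Finset.univ)
      (Z : Finset (ProperMember (graphicalBuildingSet Γ') Finset.univ)), Z.Nonempty ∧
      (nestohedronHRep (isConnectedBuildingSet_graphicalBuildingSet hΓ).isBuildingOn).IsLink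
        (nestohedronHRep (isConnectedBuildingSet_graphicalBuildingSet hΓ').isBuildingOn) e Z := by
  have hB := isConnectedBuildingSet_graphicalBuildingSet hΓ
  have hB' := isConnectedBuildingSet_graphicalBuildingSet hΓ'
  have hconn : ∀ T ∈ graphicalBuildingSet Γ', (Γ'.induce (T : Set β)).Connected := fun T hT =>
    mem_graphicalBuildingSet.1 hT
  refine ToricFamilies.exists_isLink hB.isBuildingOn hB'.isBuildingOn (lift Γ' φ b₀)
    (hB'.singleton_mem b₀) ?_ ?_ ?_ ?_ ?_ ?_
  · intro h'
    obtain ⟨a⟩ := ‹Nonempty α›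
    exact h.map_ne a (Finset.mem_singleton.1 (h' ▸ Finset.mem_univ (φ a)))
  · refine fun T hT hne => ⟨h.lift_mem hT, fun h' => hne ?_, fun h' => ?_⟩
    · exact Finset.eq_univ_iff_forall.2 fun a => h.map_mem_lift.1 (h' ▸ Finset.mem_univ _)
    · obtain ⟨a, ha⟩ := hB.isBuildingOn.nonempty hT
      exact h.map_ne a (Finset.mem_singleton.1 (h' ▸ h.map_mem_lift.2 ha))
  · intro T _ T' _ hTT'
    rw [← h.pull_lift T, hTT', h.pull_lift]
  · intro τ _ ch' hch'
    -- If the choice in the lift is `b₀`, replace it by a neighbour in `T`: any lift of a set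
    -- containing that neighbour contains `b₀`.
    have : ∀ T ∈ graphicalBuildingSet Γ, ∃ a ∈ T, ∀ U : Finset α, a ∈ U →
        ch' (lift Γ' φ b₀ T) ∈ lift Γ' φ b₀ U := by
      intro T hT
      have h1 := hch'.1 _ (h.lift_mem hT)
      rcases h.cases (ch' (lift Γ' φ b₀ T)) with h2 | ⟨a, h2⟩
      · rw [h2] at h1 ⊢
        obtain ⟨a, ha, hadj⟩ := h.self_mem_lift.1 h1
        exact ⟨a, ha, fun U hU => h.self_mem_lift.2 ⟨a, hU, hadj⟩⟩
      · rw [h2] at h1 ⊢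
        exact ⟨a, h.map_mem_lift.1 h1, fun U hU => h.map_mem_lift.2 hU⟩
    choose! ch h1 h2 using this
    refine ⟨ch, h1, fun U hU T hT hTU a ha => ?_⟩
    have := hch'.2 _ ⟨U, hU, rfl⟩ _ (h.lift_mem hT) (h2 T hT U hTU)
    exact h.map_mem_lift.1 (this (h.map_mem_lift.2 ha))
  · intro τ _ ch hch
    refine ⟨fun T => if T = {b₀} then b₀ else φ (ch (pull φ T)), fun T hT => ?_, ?_⟩
    · dsimp only
      split_ifs with hne
      · simp [hne]
      · exact mem_pull.1 (hch.1 _ (h.pull_mem hT hne))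
    · rintro U (rfl | ⟨U, hU, rfl⟩) T hT
      · dsimp only
        split_ifs with hne
        · exact fun _ => hne.subset
        · exact fun h' => absurd (Finset.mem_singleton.1 h') (h.map_ne _)
      · dsimp only
        split_ifs with hne
        · intro h'
          rw [hne]
          exact Finset.singleton_subset_iff.2 h'
        · intro h'
          have h1 := hch.2 U hU _ (h.pull_mem hT hne) (h.map_mem_lift.1 h')
          intro b hb
          rcases h.cases b with rfl | ⟨a, rfl⟩
          · obtain ⟨a, ha, hadj⟩ := h.exists_adj_of_connected (hconn T hT) hb hne
            exact h.self_mem_lift.2 ⟨a, h1 (mem_pull.2 ha), hadj⟩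
          · exact h.map_mem_lift.2 (h1 (mem_pull.2 hb))
  · intro G hG hG' hGb ch' hch'
    -- A set compatible with `{b₀}` that contains a neighbour of `b₀` contains `b₀`. Otherwise
    -- adding `b₀` gives a connected set whose chosen element, in `G` or equal to `b₀`, violates one
    -- of the two constraints.
    have hlift : lift Γ' φ b₀ (pull φ G) = G := by
      ext b
      rcases h.cases b with rfl | ⟨a, rfl⟩
      · rw [h.self_mem_lift]
        constructor
        · rintro ⟨a, ha, hadj⟩
          by_contra hb
          have hpair : ({φ a, b} : Finset β) ∈ graphicalBuildingSet Γ' := by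
            rw [mem_graphicalBuildingSet, Finset.coe_insert, Finset.coe_singleton]
            exact SimpleGraph.induce_pair_connected_of_adj hadj
          have hun := hB'.union_mem G hG _ hpair ⟨φ a, by simp [mem_pull.1 ha]⟩
          have hbU : b ∈ G ∪ {φ a, b} := by simp
          by_cases hc : ch' (G ∪ {φ a, b}) ∈ G
          · exact hb (hch'.2 G (by simp) _ hun hc hbU)
          · have h1 := hch'.1 _ hun
            rw [Finset.mem_union] at h1
            have h2 : ch' (G ∪ {φ a, b}) = b := by
              rcases h1 with h1 | h1
              · exact absurd h1 hc
              · rcases Finset.mem_insert.1 h1 with h1 | h1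
                · exact absurd (by rw [h1]; exact mem_pull.1 ha) hc
                · exact Finset.mem_singleton.1 h1
            have h3 := hch'.2 {b} (by simp) _ hun (by rw [h2]; simp)
            have h4 : φ a ∈ ({b} : Finset β) := h3 (by simp)
            exact h.map_ne a (Finset.mem_singleton.1 h4)
        · intro hb
          obtain ⟨a, ha, hadj⟩ := h.exists_adj_of_connected (hconn G hG) hb hGb
          exact ⟨a, mem_pull.2 ha, hadj⟩
      · rw [h.map_mem_lift, mem_pull]
    refine ⟨pull φ G, h.pull_mem hG hGb, fun h' => hG' ?_, hlift⟩
    rw [← hlift, h', Finset.eq_univ_iff_forall]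
    intro b
    rcases h.cases b with rfl | ⟨a, rfl⟩
    · obtain ⟨a, ha⟩ := h.exists_adj hΓ'
      exact h.self_mem_lift.2 ⟨a, Finset.mem_univ _, ha⟩
    · exact h.map_mem_lift.2 (Finset.mem_univ _)

end IsReconnected

end Reconnected

/-! ### Cycle graphs and cyclohedra. -/

theorem cycleGraph_adj_iff {n : ℕ} (a b : Fin (n + 1)) : (SimpleGraph.cycleGraph (n + 1)).Adj a b ↔
    (a : ℕ) ≠ b ∧ ((a : ℕ) + 1 = b ∨ (b : ℕ) + 1 = a ∨ ((a : ℕ) = 0 ∧ (b : ℕ) = n) ∨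
      ((b : ℕ) = 0 ∧ (a : ℕ) = n)) := by
  rcases n with _ | n
  · simp [SimpleGraph.cycleGraph]
  · rw [SimpleGraph.cycleGraph_adj, sub_eq_iff_eq_add', sub_eq_iff_eq_add', Fin.ext_iff, Fin.ext_iff,
      Fin.val_add_one, Fin.val_add_one]
    simp only [Fin.ext_iff, Fin.val_last]
    split_ifs <;> omega

/-- Deleting the last vertex leaves a path whose ends are the neighbours of that vertex; joining
them closes the path up, also in the degenerate small cases. -/
theorem isReconnected_cycleGraph (n : ℕ) : IsReconnected (SimpleGraph.cycleGraph (n + 1))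
    (SimpleGraph.cycleGraph (n + 1 + 1)) Fin.castSuccEmb (Fin.last (n + 1)) where
  exists_iff := exists_castSucc_iff
  adj_iff a b := by
    rw [cycleGraph_adj_iff, cycleGraph_adj_iff, cycleGraph_adj_iff, cycleGraph_adj_iff]
    simp only [ne_eq, Fin.ext_iff, Fin.castSuccEmb_apply, Fin.val_castSucc, Fin.val_last, and_true]
    have ha := a.isLt
    have hb := b.isLt
    generalize (a : ℕ) = x at ha ⊢
    generalize (b : ℕ) = y at hb ⊢
    constructor
    · omega
    · omega

universe w

theorem isGeometricDirectFamily_cyclohedron (𝕜 : Type w) [CommRing 𝕜] :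
    IsGeometricDirectFamily 𝕜 cyclohedron :=
  isGeometricDirectFamily_nestohedron 𝕜
    (fun _ => (isConnectedBuildingSet_graphicalBuildingSet
      SimpleGraph.cycleGraph_connected).isBuildingOn)
    fun n => (isReconnected_cycleGraph n).exists_isLink SimpleGraph.cycleGraph_connected SimpleGraph.cycleGraph_connected

/-! ### Cubes -/

/-- The presentation of the standard cube by linear inequalities. -/
def standardCubeHRep (n : ℕ) : SimpleHRep (standardCube n) (Fin n × Bool) where
  dir := ⊤
  base := 0
  lin F := if F.2 then -LinearMap.proj F.1 else LinearMap.proj F.1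
  off F := if F.2 then -1 else 0
  base_mem := ⟨le_rfl, zero_le_one⟩
  mem_iff x := by
    simp only [Submodule.mem_top, true_and]
    constructor
    · rintro ⟨h0, h1⟩ ⟨k, _ | _⟩
      · simpa using h0 k
      · simpa using h1 k
    · intro h
      exact ⟨fun k => by simpa using h (k, false), fun k => by simpa using h (k, true)⟩
  isCompact := isCompact_Icc
  facet_nonempty := by
    rintro ⟨k, _ | _⟩
    · exact ⟨0, ⟨le_rfl, zero_le_one⟩, by simp⟩
    · exact ⟨1, ⟨zero_le_one, le_rfl⟩, by simp⟩
  indep x hx c := by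
    -- Opposite facets are never tight together, so the coordinates can be set independently; the
    -- sign is that of the functional `-x k`.
    refine ⟨fun k => if x k = 0 then c (k, false) else -c (k, true), trivial, ?_⟩
    rintro ⟨k, _ | _⟩ h
    · have h : x k = 0 := by simpa using h
      simp [h]
    · have h : x k = 1 := by simpa using h
      simp [h]

theorem standardCubeHRep_simplex_iff {n : ℕ} {σ : Finset (Fin n × Bool)} :
    (standardCubeHRep n).Simplex σ ↔ ∃ x ∈ standardCube n, ∀ F ∈ σ, x F.1 = if F.2 then 1 else 0 := by
  have : ∀ x F, F ∈ (standardCubeHRep n).zeros x ↔ x F.1 = if F.2 then 1 else 0 := by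
    rintro x ⟨k, _ | _⟩
    · rw [SimpleHRep.mem_zeros]
      simp [standardCubeHRep]
    · rw [SimpleHRep.mem_zeros]
      simp [standardCubeHRep]
  simp only [SimpleHRep.Simplex, Finset.subset_iff, this]

/-- The facet where the last coordinate is `0` is again a cube, and the only facet that misses it is
the opposite one. -/
theorem standardCube_isLink (n : ℕ) : (standardCubeHRep n).IsLink (standardCubeHRep (n + 1))
    (Fin.castSuccEmb.prodMap (.refl Bool)) {(Fin.last n, false)} where
  notMem F h := by
    have := congrArg Prod.fst (Finset.mem_singleton.1 h)
    exact (Fin.castSucc_lt_last F.1).ne this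
  simplex_map σ := by
    rw [standardCubeHRep_simplex_iff, standardCubeHRep_simplex_iff]
    constructor
    · rintro ⟨x, hx, h⟩
      refine ⟨Fin.snoc x 0, ⟨fun k => ?_, fun k => ?_⟩, fun G hG => ?_⟩
      · refine Fin.lastCases ?_ (fun k => ?_) k
        · simp
        · simpa using hx.1 k
      · refine Fin.lastCases ?_ (fun k => ?_) k
        · simp
        · simpa using hx.2 k
      · obtain ⟨F, hF, rfl⟩ := Finset.mem_map.1 hG
        simpa using h F hF
    · rintro ⟨x, hx, h⟩
      exact ⟨fun k => x k.castSucc, ⟨fun k => hx.1 _, fun k => hx.2 _⟩, fun F hF =>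
        h _ (Finset.mem_map_of_mem _ hF)⟩
  simplex_union σ hσ := by
    rw [standardCubeHRep_simplex_iff] at hσ ⊢
    obtain ⟨x, hx, h⟩ := hσ
    refine ⟨Fin.snoc x 0, ⟨fun k => ?_, fun k => ?_⟩, fun G hG => ?_⟩
    · refine Fin.lastCases ?_ (fun k => ?_) k
      · simp
      · simpa using hx.1 k
    · refine Fin.lastCases ?_ (fun k => ?_) k
      · simp
      · simpa using hx.2 k
    · rcases Finset.mem_union.1 hG with hG | hG
      · obtain ⟨F, hF, rfl⟩ := Finset.mem_map.1 hG
        simpa using h F hF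
      · rw [Finset.mem_singleton.1 hG]
        simp
  mem_or_exists := by
    rintro ⟨k, b⟩ hG
    rw [standardCubeHRep_simplex_iff] at hG
    obtain ⟨x, -, h⟩ := hG
    refine Fin.lastCases (motive := fun k => (x k = if b then 1 else 0) →
      (k, b) ∈ ({(Fin.last n, false)} : Finset _) ∨
        ∃ F, (Fin.castSuccEmb.prodMap (.refl Bool)) F = (k, b)) ?_ (fun k _ => ?_) k
      (h (k, b) (by simp))
    · intro h1
      have h2 := h (Fin.last n, false) (by simp)
      left
      cases b
      · simp
      · simp only [h2] at h1
        simp at h1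
    · exact Or.inr ⟨(k, b), rfl⟩

theorem isGeometricDirectFamily_standardCube (𝕜 : Type w) [CommRing 𝕜] :
    IsGeometricDirectFamily 𝕜 standardCube :=
  SimpleHRep.isGeometricDirectFamily 𝕜 standardCubeHRep
    (fun n => by
      change Module.finrank ℝ (⊤ : Submodule ℝ (Fin n → ℝ)) = n
      simp)
    fun n => ⟨_, _, Finset.singleton_nonempty _, standardCube_isLink n⟩

end ToricFamilies

end

theorem proposition4p12 (𝕜 : Type*) [CommRing 𝕜] :
    (∀ B : ∀ n : ℕ, Finset (Finset (Fin (n + 1))),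
      (∀ n, IsConnectedBuildingSet (B n)) →
      (∀ n : ℕ, 2 ≤ n → ∃ S ∈ B n, S.card = n ∧
        CombEquiv (nestohedron (restrictTo (B n) S)) (nestohedron (B (n - 1)))) →
      IsGeometricDirectFamily 𝕜 (fun n => nestohedron (B n))) ∧
    IsGeometricDirectFamily 𝕜 standardCube ∧
    IsGeometricDirectFamily 𝕜 (fun n => nestohedron (cubeBuildingSet n)) ∧
    IsGeometricDirectFamily 𝕜 permutohedron ∧
    IsGeometricDirectFamily 𝕜 stellahedron ∧
    IsGeometricDirectFamily 𝕜 cyclohedron ∧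
    IsGeometricDirectFamily 𝕜 associahedron :=
  ⟨isGeometricDirectFamily_of_combEquiv 𝕜, isGeometricDirectFamily_standardCube 𝕜,
    isGeometricDirectFamily_cubeBuildingSet 𝕜, isGeometricDirectFamily_permutohedron 𝕜,
    isGeometricDirectFamily_stellahedron 𝕜, isGeometricDirectFamily_cyclohedron 𝕜,
    isGeometricDirectFamily_associahedron 𝕜⟩
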